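/- **Setting.** Let $\Theta\subset\mathbb{R}^3$ be a convex open set with compact closure $\overline{\Theta}\subset\{(\beta,\sigma,\gamma):\ \beta\in(0,2),\ \sigma>0,\ \gamma\in\mathbb{R}\}$. For $\theta=(\beta,\sigma,\gamma)\in\Theta$, let $X=(X_t)_{t\ge 0}$ be, under $P_\theta$, a real-valued Lévy process with $$E_\theta[e^{iuX_1}]=\exp\{-(\sigma|u|)^\beta+i\gamma u\},\qquad u\in\mathbb{R}.$$ For each $n\ge 1$, $X$ is observed at the times $jh_n$, $j=0,\dots,n$, where $h_n>0$, $h_n\to 0$ and $\liminf_{n\to\infty} nh_n>0$. Write $\Delta_j^nX=X_{jh_n}-X_{(j-1)h_n}$ and let $$\phi_\beta(y;\sigma)=\frac1{2\pi}\int_{\mathbb{R}}\exp\{-iuy-(\sigma|u|)^\beta\}\,du,\qquad \phi_\beta(y)=\phi_\beta(y;1),$$ so that $\phi_\beta(\cdot\,;\sigma)$ is the density of the symmetric $\beta$-stable law with characteristic function $\exp\{-(\sigma|u|)^\beta\}$; $\partial\phi_\beta$ denotes the derivative of $\phi_\beta(y)$ in $y$. The log-likelihood function is $$\ell_n(\theta)=\sum_{j=1}^n\log\phi_\beta\big(\Delta_j^nX-\gamma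 h_n;\ \sigma h_n^{1/\beta}\big),$$ and we put $$A_n(\beta)=\mathrm{diag}\Big\{\frac1{\sqrt n\,\log(1/h_n)},\ \frac1{\sqrt n},\ \frac1{\sqrt n\,h_n^{1-1/\beta}}\Big\},\qquad \mathcal{S}_n(\theta)=A_n(\beta)\,\partial_\theta\ell_n(\theta).$$ **Theorem (LAN with singular Fisher information).** Fix any $\theta=(\beta,\sigma,\gamma)\in\Theta$. The constants $$H_\beta=\int_{\mathbb{R}}\frac{\{\phi_\beta(y)+y\,\partial\phi_\beta(y)\}^2}{\phi_\beta(y)}\,dy,\qquad M_\beta=\int_{\mathbb{R}}\frac{\{\partial\phi_\beta(y)\}^2}{\phi_\beta(y)}\,dy$$ are finite. Let $$\mathcal{I}(\theta)=\begin{pmatrix}H_\beta/\beta^4&H_\beta/(\sigma\beta^2)&0\\ H_\beta/(\sigma\beta^2)&H_\beta/\sigma^2&0\\ 0&0&M_\beta/\sigma^2\end{pmatrix}.$$ Then for each $u\in\mathbb{R}^3$ we have $\theta+A_n(\beta)u\in\Theta$ for all sufficiently large $n$ and, under $P_\theta$ as $n\to\infty$, $$\ell_n(\theta+A_n(\beta)u)-\ell_n(\theta)=\mathcal{S}_n(\theta)\cdot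 u-\tfrac12\,u^\top\mathcal{I}(\theta)u+o_p(1).$$ Moreover $\mathcal{I}(\theta)$ is nonnegative definite and $\mathcal{S}_n(\theta)$ converges in distribution under $P_\theta$ to $N_3(0,\mathcal{I}(\theta))$. The Fisher information matrix $\mathcal{I}(\theta)$ is singular, i.e. $\det\mathcal{I}(\theta)=0$, for every $\theta\in\Theta$. -/

import Mathlib

open MeasureTheory ProbabilityTheory Filter Topology
open scoped NNReal ENNReal

noncomputable section

namespace SymStable

/-- `φ_β(y; σ)`: the density at `y` of the symmetric `β`-stable law with characteristic function
`u ↦ exp (-(σ|u|)^β)`, in the form given by Fourier inversion,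
`(2π)⁻¹ ∫ exp (-iuy - (σ|u|)^β) du` (this integral is real; `re` only changes the type). -/
def density (β σ y : ℝ) : ℝ :=
  (1 / (2 * Real.pi)) *
    (∫ u : ℝ, Complex.exp (-(Complex.I * u * y) - (((σ * |u|) ^ β : ℝ) : ℂ))).re

/-- `φ_β(y) = φ_β(y; 1)`. -/
def stdDensity (β y : ℝ) : ℝ := density β 1 y

/-- The integrand of `H_β`. -/
def integrandH (β y : ℝ) : ℝ :=
  (stdDensity β y + y * deriv (stdDensity β) y) ^ 2 * (stdDensity β y)⁻¹

/-- The integrand of `M_β`. -/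
def integrandM (β y : ℝ) : ℝ :=
  (deriv (stdDensity β) y) ^ 2 * (stdDensity β y)⁻¹

def constH (β : ℝ) : ℝ := ∫ y : ℝ, integrandH β y

def constM (β : ℝ) : ℝ := ∫ y : ℝ, integrandM β y

/-- A real-valued Lévy process under `P`: starts at zero, has independent and stationary
increments, and is continuous in probability. (A càdlàg version is not required.) -/
structure IsLevyProcess {Ω : Type*} [MeasurableSpace Ω] (X : ℝ≥0 → Ω → ℝ) (P : Measure Ω) :
    Prop where
  measurable : ∀ t, Measurable (X t)
  start_zero : ∀ᵐ ω ∂P, X 0 ω = 0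
  indep_increments : HasIndepIncrements X P
  stationary_increments : ∀ s t : ℝ≥0, IdentDistrib (X (s + t) - X s) (X t) P P
  continuous_in_probability : ∀ s : ℝ≥0, TendstoInMeasure P X (𝓝 s) (X s)

/-- Under `P`, `X` is a Lévy process with `X₁ ∼ S_β(σ, 0, γ)`, where `θ = (β, σ, γ)`. -/
structure IsSymStableLevy {Ω : Type*} [MeasurableSpace Ω] (X : ℝ≥0 → Ω → ℝ) (P : Measure Ω)
    (θ : Fin 3 → ℝ) : Prop extends IsLevyProcess X P where
  charFun_one : ∀ u : ℝ, charFun (P.map (X 1)) u =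
    Complex.exp (-(((θ 1 * |u|) ^ θ 0 : ℝ) : ℂ) + Complex.I * θ 2 * u)

/-- The increments `X_{(j+1)δ} - X_{jδ}`, `j = 0, 1, …`, of a path `x`. -/
def increment (x : ℝ≥0 → ℝ) (δ : ℝ≥0) (j : ℕ) : ℝ := x ((j + 1) * δ) - x (j * δ)

/-- The log-likelihood at `θ = (β, σ, γ)` of `n` increments of the path `x` with step `δ`. -/
def logLik (x : ℝ≥0 → ℝ) (δ : ℝ≥0) (n : ℕ) (θ : Fin 3 → ℝ) : ℝ :=
  ∑ j ∈ Finset.range n,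
    Real.log (density (θ 0) (θ 1 * (δ : ℝ) ^ (1 / θ 0)) (increment x δ j - θ 2 * δ))

/-- The gradient of the log-likelihood in `θ`. -/
def gradLogLik (x : ℝ≥0 → ℝ) (δ : ℝ≥0) (n : ℕ) (θ : Fin 3 → ℝ) : Fin 3 → ℝ :=
  fun k => deriv (fun t : ℝ => logLik x δ n (Function.update θ k t)) (θ k)

/-- The rate matrix `A_n(β)` for step `δ = h_n`. -/
def rate (δ : ℝ≥0) (n : ℕ) (β : ℝ) : Matrix (Fin 3) (Fin 3) ℝ :=
  Matrix.diagonal ![1 / (√(n : ℝ) * Real.log (1 / (δ : ℝ))), 1 / √(n : ℝ),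
    1 / (√(n : ℝ) * (δ : ℝ) ^ (1 - 1 / β))]

/-- The normalized score `A_n(β) ∂_θ ℓ_n(θ)`. -/
def score (x : ℝ≥0 → ℝ) (δ : ℝ≥0) (n : ℕ) (θ : Fin 3 → ℝ) : Fin 3 → ℝ :=
  (rate δ n (θ 0)).mulVec (gradLogLik x δ n θ)

/-- The Fisher information matrix at `θ = (β, σ, γ)`. -/
def fisherInfo (θ : Fin 3 → ℝ) : Matrix (Fin 3) (Fin 3) ℝ :=
  !![constH (θ 0) / θ 0 ^ 4, constH (θ 0) / (θ 1 * θ 0 ^ 2), 0;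
     constH (θ 0) / (θ 1 * θ 0 ^ 2), constH (θ 0) / θ 1 ^ 2, 0;
     0, 0, constM (θ 0) / θ 1 ^ 2]

end SymStable

end

noncomputable section

namespace SymStable

/-- The symbols `(log u)^k u^(pb+q) exp(-u^b)` obtained by differentiating `exp(-u^b)` in `b` and
its cosine transform in the space variable. -/
def sym (k p q : ℕ) (b u : ℝ) : ℝ :=
  Real.log u ^ k * u ^ ((p : ℝ) * b + q) * Real.exp (-u ^ b)

/-- The transform `∫₀^∞ sym(u) cos(uy + qπ/2) du`. -/
def stInt (k p q : ℕ) (b y : ℝ) : ℝ :=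
  ∫ u in Set.Ioi (0 : ℝ), sym k p q b u * Real.cos (u * y + q * (Real.pi / 2))

lemma abs_log_pow_le (k : ℕ) {ε : ℝ} (hε : 0 < ε) :
    ∃ C : ℝ, 0 ≤ C ∧ ∀ u : ℝ, 0 < u → |Real.log u| ^ k ≤ C * (u ^ (-ε) + u ^ ε) := by
  set η : ℝ := ε / (k + 1) with hη
  have hk : (0 : ℝ) < k + 1 := by positivity
  have hη0 : 0 < η := by positivity
  have key : ∀ u : ℝ, 1 ≤ u → |Real.log u| ^ k ≤ (1 / η) ^ k * u ^ ε := by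
    intro u hu
    have hu0 : 0 < u := by linarith
    have h1 : |Real.log u| ≤ 1 / η * u ^ η := by
      rw [abs_of_nonneg (Real.log_nonneg hu)]
      have := Real.log_le_rpow_div hu0.le hη0
      calc _ ≤ _ := this
        _ = _ := by ring
    calc |Real.log u| ^ k ≤ (1 / η * u ^ η) ^ k := pow_le_pow_left₀ (abs_nonneg _) h1 k
      _ = (1 / η) ^ k * u ^ (η * k) := by rw [mul_pow, ← Real.rpow_mul_natCast hu0.le]
      _ ≤ (1 / η) ^ k * u ^ ε := by
        have : η * k ≤ ε := by
          rw [hη, div_mul_eq_mul_div, div_le_iff₀ hk]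
          nlinarith
        gcongr
  refine ⟨(1 / η) ^ k, by positivity, fun u hu => ?_⟩
  rcases le_total 1 u with h | h
  · refine (key u h).trans ?_
    gcongr
    have : 0 < u ^ (-ε) := Real.rpow_pos_of_pos hu _
    linarith
  · have h' : 1 ≤ u⁻¹ := (one_le_inv₀ hu).2 h
    have := key u⁻¹ h'
    rw [Real.log_inv, abs_neg, Real.inv_rpow hu.le, ← Real.rpow_neg hu.le] at this
    refine this.trans ?_
    gcongr
    have : 0 < u ^ ε := Real.rpow_pos_of_pos hu _
    linarith

lemma rpow_mul_exp_neg_rpow_le (S : ℝ) {b₁ : ℝ} (hb₁ : 0 < b₁) :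
    ∃ C : ℝ, 0 ≤ C ∧ ∀ u : ℝ, 1 ≤ u → ∀ b, b₁ ≤ b → u ^ S * Real.exp (-u ^ b) ≤ C := by
  obtain ⟨N, hN⟩ := exists_nat_ge (S / b₁)
  refine ⟨(N.factorial : ℝ), by positivity, fun u hu b hb => ?_⟩
  have hu0 : 0 < u := by linarith
  have h1 : u ^ S ≤ (u ^ b₁) ^ N := by
    rw [← Real.rpow_mul_natCast hu0.le]
    apply Real.rpow_le_rpow_of_exponent_le hu
    rw [div_le_iff₀ hb₁] at hN
    linarith
  have h2 : (u ^ b₁) ^ N ≤ N.factorial * Real.exp (u ^ b₁) := by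
    have := Real.pow_div_factorial_le_exp (u ^ b₁) (by positivity) N
    rw [div_le_iff₀ (by positivity)] at this
    linarith
  have h3 : Real.exp (-u ^ b) ≤ Real.exp (-u ^ b₁) := by
    apply Real.exp_le_exp.2
    have := Real.rpow_le_rpow_of_exponent_le hu hb
    linarith
  calc u ^ S * Real.exp (-u ^ b) ≤ (N.factorial * Real.exp (u ^ b₁)) * Real.exp (-u ^ b₁) := by
        gcongr
        exact h1.trans h2
    _ = N.factorial := by rw [mul_assoc, ← Real.exp_add]; simp

lemma abs_sym (k p q : ℕ) (b : ℝ) {u : ℝ} (hu : 0 < u) :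
    |sym k p q b u| = |Real.log u| ^ k * u ^ ((p : ℝ) * b + q) * Real.exp (-u ^ b) := by
  rw [sym, abs_mul, abs_mul, abs_pow, abs_of_pos (Real.rpow_pos_of_pos hu _),
    abs_of_pos (Real.exp_pos _)]

lemma abs_sym_le (k p q : ℕ) {b₁ b₂ κ : ℝ} (hb₁ : 0 < b₁) (hκ : κ < p * b₁ + q) (hκ' : -2 ≤ κ) :
    ∃ C : ℝ, 0 ≤ C ∧ ∀ b, b₁ ≤ b → b ≤ b₂ → ∀ u : ℝ, 0 < u →
      |sym k p q b u| ≤ C * u ^ κ ∧ |sym k p q b u| ≤ C * u ^ (-2 : ℝ) := by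
  set ε := p * b₁ + q - κ with hε
  have hε0 : 0 < ε := by linarith
  obtain ⟨C₁, hC₁, h₁⟩ := abs_log_pow_le k hε0
  obtain ⟨C₂, hC₂, h₂⟩ := rpow_mul_exp_neg_rpow_le (ε + (p * b₂ + q) + 2) hb₁
  refine ⟨2 * C₁ + 2 * C₁ * C₂, by positivity, fun b hb hb' u hu => ?_⟩
  rw [abs_sym k p q b hu]
  rcases le_total u 1 with hu1 | hu1
  · have key : |Real.log u| ^ k * u ^ ((p : ℝ) * b + q) * Real.exp (-u ^ b) ≤ 2 * C₁ * u ^ κ := by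
      have e1 : u ^ ε ≤ u ^ (-ε) :=
        Real.rpow_le_rpow_of_exponent_ge hu hu1 (by linarith)
      have e2 : u ^ ((p : ℝ) * b + q) ≤ u ^ ((p : ℝ) * b₁ + q) :=
        Real.rpow_le_rpow_of_exponent_ge hu hu1 (by gcongr)
      have e3 : Real.exp (-u ^ b) ≤ 1 := by
        rw [Real.exp_le_one_iff]
        have := Real.rpow_nonneg hu.le b
        linarith
      calc |Real.log u| ^ k * u ^ ((p : ℝ) * b + q) * Real.exp (-u ^ b)
          ≤ (C₁ * (u ^ (-ε) + u ^ (-ε))) * u ^ ((p : ℝ) * b₁ + q) * 1 := by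
            gcongr
            refine (h₁ u hu).trans ?_
            gcongr
        _ = 2 * C₁ * (u ^ (-ε) * u ^ ((p : ℝ) * b₁ + q)) := by ring
        _ = 2 * C₁ * u ^ κ := by
            rw [← Real.rpow_add hu]
            congr 2
            rw [hε]; ring
    have hm : u ^ κ ≤ u ^ (-2 : ℝ) := Real.rpow_le_rpow_of_exponent_ge hu hu1 hκ'
    constructor
    · refine key.trans ?_
      gcongr
      nlinarith [mul_nonneg hC₁ hC₂]
    · refine key.trans ?_
      gcongr
      nlinarith [mul_nonneg hC₁ hC₂]
  · have key : |Real.log u| ^ k * u ^ ((p : ℝ) * b + q) * Real.exp (-u ^ b)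
        ≤ 2 * C₁ * C₂ * u ^ (-2 : ℝ) := by
      have e1 : u ^ (-ε) ≤ u ^ ε := Real.rpow_le_rpow_of_exponent_le hu1 (by linarith)
      have e2 : u ^ ((p : ℝ) * b + q) ≤ u ^ ((p : ℝ) * b₂ + q) :=
        Real.rpow_le_rpow_of_exponent_le hu1 (by gcongr)
      calc |Real.log u| ^ k * u ^ ((p : ℝ) * b + q) * Real.exp (-u ^ b)
          ≤ (C₁ * (u ^ ε + u ^ ε)) * u ^ ((p : ℝ) * b₂ + q) * Real.exp (-u ^ b) := by
            gcongr
            refine (h₁ u hu).trans ?_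
            gcongr
        _ = 2 * C₁ * (u ^ (ε + (p * b₂ + q) + 2) * Real.exp (-u ^ b)) * u ^ (-2 : ℝ) := by
            rw [show u ^ (ε + (p * b₂ + q) + 2) = u ^ ε * u ^ (p * b₂ + q) * u ^ (2 : ℝ) by
              rw [← Real.rpow_add hu, ← Real.rpow_add hu], Real.rpow_neg hu.le]
            have : u ^ (2 : ℝ) ≠ 0 := (Real.rpow_pos_of_pos hu _).ne'
            field_simp
            ring
        _ ≤ 2 * C₁ * C₂ * u ^ (-2 : ℝ) := by
            gcongr
            exact h₂ u hu1 b hb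
    have hm : u ^ (-2 : ℝ) ≤ u ^ κ := Real.rpow_le_rpow_of_exponent_le hu1 hκ'
    constructor
    · refine key.trans ?_
      gcongr
      nlinarith [mul_nonneg hC₁ hC₂]
    · refine key.trans ?_
      gcongr
      nlinarith [mul_nonneg hC₁ hC₂]

lemma integrableOn_min_rpow {κ : ℝ} (hκ : -1 < κ) :
    IntegrableOn (fun u : ℝ => min (u ^ κ) (u ^ (-2 : ℝ))) (Set.Ioi 0) := by
  rw [← Set.Ioc_union_Ioi_eq_Ioi (zero_le_one' ℝ)]
  have hm : Measurable (fun u : ℝ => min (u ^ κ) (u ^ (-2 : ℝ))) := by fun_prop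
  refine IntegrableOn.union ?_ ?_
  · have : IntegrableOn (fun u : ℝ => u ^ κ) (Set.Ioc 0 1) :=
      (intervalIntegral.integrableOn_Ioo_rpow_iff zero_lt_one |>.2 hκ).congr_set_ae
        Ioo_ae_eq_Ioc.symm
    refine this.mono' hm.aestronglyMeasurable ?_
    filter_upwards [ae_restrict_mem measurableSet_Ioc] with u hu
    have := Real.rpow_pos_of_pos hu.1
    rw [Real.norm_of_nonneg (le_min (this _).le (this _).le)]
    exact min_le_left _ _
  · have : IntegrableOn (fun u : ℝ => u ^ (-2 : ℝ)) (Set.Ioi 1) :=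
      integrableOn_Ioi_rpow_of_lt (by norm_num) zero_lt_one
    refine this.mono' hm.aestronglyMeasurable ?_
    filter_upwards [ae_restrict_mem measurableSet_Ioi] with u hu
    have := Real.rpow_pos_of_pos (lt_trans zero_lt_one hu)
    rw [Real.norm_of_nonneg (le_min (this _).le (this _).le)]
    exact min_le_right _ _

@[fun_prop]
lemma measurable_sym (k p q : ℕ) (b : ℝ) : Measurable (sym k p q b) := by
  unfold sym
  fun_prop

lemma exists_integrable_bound_sym (k p q : ℕ) {b₁ b₂ : ℝ} (hb₁ : 0 < b₁) :
    ∃ G : ℝ → ℝ, IntegrableOn G (Set.Ioi 0) ∧ ∀ b, b₁ ≤ b → b ≤ b₂ → ∀ u : ℝ, 0 < u →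
      |sym k p q b u| ≤ G u := by
  obtain ⟨C, hC, h⟩ := abs_sym_le k p q (b₂ := b₂) (κ := -1 / 2) hb₁
    (by have : (0 : ℝ) ≤ p * b₁ + q := by positivity
        linarith) (by norm_num)
  refine ⟨fun u => C * min (u ^ (-1 / 2 : ℝ)) (u ^ (-2 : ℝ)),
    (integrableOn_min_rpow (by norm_num)).const_mul C, fun b hb hb' u hu => ?_⟩
  show |sym k p q b u| ≤ C * min (u ^ (-1 / 2 : ℝ)) (u ^ (-2 : ℝ))
  rw [mul_min_of_nonneg _ _ hC]
  exact le_min (h b hb hb' u hu).1 (h b hb hb' u hu).2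

lemma integrableOn_sym (k p q : ℕ) {b : ℝ} (hb : 0 < b) :
    IntegrableOn (sym k p q b) (Set.Ioi 0) := by
  obtain ⟨G, hG, h⟩ := exists_integrable_bound_sym k p q (b₂ := b) hb
  refine hG.mono' (measurable_sym k p q b).aestronglyMeasurable ?_
  filter_upwards [ae_restrict_mem measurableSet_Ioi] with u hu
  exact h b le_rfl le_rfl u hu

lemma hasDerivAt_sym (k p q : ℕ) (b : ℝ) {u : ℝ} (hu : 0 < u) :
    HasDerivAt (sym k p q b)
      ((k * sym (k - 1) p q b u + (p * b + q) * sym k p q b u - b * sym k (p + 1) q b u) / u) u := by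
  have h1 : HasDerivAt (fun u => Real.log u ^ k) (k * Real.log u ^ (k - 1) * u⁻¹) u :=
    (Real.hasDerivAt_log hu.ne').pow k
  have h2 : HasDerivAt (fun u : ℝ => u ^ ((p : ℝ) * b + q)) (((p : ℝ) * b + q) *
      u ^ ((p : ℝ) * b + q - 1)) u := Real.hasDerivAt_rpow_const (Or.inl hu.ne')
  have h3 : HasDerivAt (fun u : ℝ => Real.exp (-u ^ b)) (Real.exp (-u ^ b) * -(b * u ^ (b - 1))) u :=
    (Real.hasDerivAt_rpow_const (Or.inl hu.ne')).neg.exp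
  have := (h1.mul h2).mul h3
  convert! this using 1
  rw [Real.rpow_sub_one hu.ne', Real.rpow_sub_one hu.ne']
  simp only [sym]
  rw [show ((p + 1 : ℕ) : ℝ) * b + q = (p * b + q) + b by push_cast; ring, Real.rpow_add hu _ b]
  field_simp
  simp
  ring

lemma hasDerivAt_sym_index (k p q : ℕ) (b : ℝ) {u : ℝ} (hu : 0 < u) :
    HasDerivAt (fun b => sym k p q b u) (p * sym (k + 1) p q b u - sym (k + 1) (p + 1) q b u) b := by
  have h2 : HasDerivAt (fun b : ℝ => u ^ ((p : ℝ) * b + q))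
      (Real.log u * (p * 1) * u ^ ((p : ℝ) * b + q)) b := by
    exact (((hasDerivAt_id b).const_mul (p : ℝ)).add_const (q : ℝ)).const_rpow hu
  have h3 : HasDerivAt (fun b : ℝ => Real.exp (-u ^ b))
      (Real.exp (-u ^ b) * -(Real.log u * 1 * u ^ b)) b :=
    ((hasDerivAt_id b).const_rpow hu).neg.exp
  have := (h2.const_mul (Real.log u ^ k)).mul h3
  convert! this using 1
  simp only [sym]
  rw [show ((p + 1 : ℕ) : ℝ) * b + q = (p * b + q) + b by push_cast; ring, Real.rpow_add hu _ b]
  ring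

lemma integrableOn_sym_mul_cos (k p q : ℕ) {b : ℝ} (hb : 0 < b) (y c : ℝ) :
    IntegrableOn (fun u => sym k p q b u * Real.cos (u * y + c)) (Set.Ioi 0) := by
  refine (integrableOn_sym k p q hb).norm.mono'
    (Measurable.aestronglyMeasurable (by fun_prop)) (ae_of_all _ fun u => ?_)
  rw [norm_mul]
  exact mul_le_of_le_one_right (norm_nonneg _) (Real.abs_cos_le_one _)

lemma sym_succ_mul (k p q : ℕ) (b : ℝ) {u : ℝ} (hu : 0 < u) :
    sym k p (q + 1) b u = sym k p q b u * u := by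
  simp only [sym]
  rw [show (p : ℝ) * b + (q + 1 : ℕ) = (p * b + q) + 1 by push_cast; ring, Real.rpow_add_one hu.ne']
  ring

lemma hasDerivAt_stInt (k p q : ℕ) {b : ℝ} (hb : 0 < b) (y : ℝ) :
    HasDerivAt (stInt k p q b) (stInt k p (q + 1) b y) y := by
  refine (hasDerivAt_integral_of_dominated_loc_of_deriv_le (μ := volume.restrict (Set.Ioi (0 : ℝ)))
    (F := fun y u => sym k p q b u * Real.cos (u * y + q * (Real.pi / 2)))
    (F' := fun y u => sym k p (q + 1) b u * Real.cos (u * y + (q + 1 : ℕ) * (Real.pi / 2)))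
    (bound := fun u => |sym k p (q + 1) b u|) (Filter.univ_mem) ?_ ?_ ?_ ?_ ?_ ?_).2
  · exact .of_forall fun x => Measurable.aestronglyMeasurable (by fun_prop)
  · exact integrableOn_sym_mul_cos k p q hb y _
  · exact Measurable.aestronglyMeasurable (by fun_prop)
  · refine ae_of_all _ fun u x _ => ?_
    rw [norm_mul]
    exact mul_le_of_le_one_right (norm_nonneg _) (Real.abs_cos_le_one _)
  · exact (integrableOn_sym k p (q + 1) hb).norm
  · filter_upwards [ae_restrict_mem measurableSet_Ioi] with u hu x _
    have h1 : HasDerivAt (fun y => u * y + q * (Real.pi / 2)) (u * 1) x :=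
      ((hasDerivAt_id x).const_mul u).add_const _
    have h2 := (h1.cos).const_mul (sym k p q b u)
    convert! h2 using 1
    rw [sym_succ_mul k p q b hu, show u * x + ((q + 1 : ℕ) : ℝ) * (Real.pi / 2) =
      (u * x + q * (Real.pi / 2)) + Real.pi / 2 by push_cast; ring, Real.cos_add_pi_div_two]
    ring

lemma hasDerivAt_stInt_index (k p q : ℕ) {b : ℝ} (hb : 0 < b) (y : ℝ) :
    HasDerivAt (fun b => stInt k p q b y)
      (p * stInt (k + 1) p q b y - stInt (k + 1) (p + 1) q b y) b := by
  obtain ⟨G₁, hG₁, h₁⟩ := exists_integrable_bound_sym (k + 1) p q (b₁ := b / 2) (b₂ := 2 * b)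
    (by positivity)
  obtain ⟨G₂, hG₂, h₂⟩ := exists_integrable_bound_sym (k + 1) (p + 1) q (b₁ := b / 2) (b₂ := 2 * b)
    (by positivity)
  have hs : Set.Ioo (b / 2) (2 * b) ∈ 𝓝 b := Ioo_mem_nhds (by linarith) (by linarith)
  have := (hasDerivAt_integral_of_dominated_loc_of_deriv_le (μ := volume.restrict (Set.Ioi (0 : ℝ)))
    (F := fun b u => sym k p q b u * Real.cos (u * y + q * (Real.pi / 2)))
    (F' := fun b u => (p * sym (k + 1) p q b u - sym (k + 1) (p + 1) q b u) *
      Real.cos (u * y + q * (Real.pi / 2)))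
    (bound := fun u => p * G₁ u + G₂ u) hs ?_ ?_ ?_ ?_ ?_ ?_).2
  · convert! this using 1
    simp only [stInt, sub_mul, mul_assoc]
    rw [integral_sub, integral_const_mul]
    · exact (integrableOn_sym_mul_cos (k + 1) p q hb y _).const_mul (p : ℝ)
    · exact integrableOn_sym_mul_cos (k + 1) (p + 1) q hb y _
  · exact .of_forall fun x => Measurable.aestronglyMeasurable (by fun_prop)
  · exact integrableOn_sym_mul_cos k p q hb y _
  · exact Measurable.aestronglyMeasurable (by fun_prop)
  · filter_upwards [ae_restrict_mem measurableSet_Ioi] with u hu x hx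
    rw [norm_mul]
    refine (mul_le_of_le_one_right (norm_nonneg _) (Real.abs_cos_le_one _)).trans ?_
    refine (norm_sub_le _ _).trans (add_le_add ?_ (h₂ x hx.1.le hx.2.le u hu))
    rw [norm_mul, Real.norm_of_nonneg (Nat.cast_nonneg p)]
    exact mul_le_mul_of_nonneg_left (h₁ x hx.1.le hx.2.le u hu) (Nat.cast_nonneg p)
  · exact (hG₁.const_mul (p : ℝ)).add hG₂
  · filter_upwards [ae_restrict_mem measurableSet_Ioi] with u hu x _
    exact (hasDerivAt_sym_index k p q x hu).mul_const _

lemma continuousAt_stInt (k p q : ℕ) {b : ℝ} (hb : 0 < b) (y : ℝ) :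
    ContinuousAt (fun v : ℝ × ℝ => stInt k p q v.1 v.2) (b, y) := by
  obtain ⟨G, hG, h⟩ := exists_integrable_bound_sym k p q (b₁ := b / 2) (b₂ := 2 * b)
    (by positivity)
  have hs : ∀ᶠ v : ℝ × ℝ in 𝓝 (b, y), v.1 ∈ Set.Ioo (b / 2) (2 * b) :=
    continuousAt_fst.eventually (Ioo_mem_nhds (show b / 2 < b by linarith)
      (show b < 2 * b by linarith))
  refine continuousAt_of_dominated (bound := G) ?_ ?_ hG ?_
  · exact .of_forall fun x => Measurable.aestronglyMeasurable (by fun_prop)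
  · filter_upwards [hs] with v hv
    filter_upwards [ae_restrict_mem measurableSet_Ioi] with u hu
    rw [norm_mul]
    exact (mul_le_of_le_one_right (norm_nonneg _) (Real.abs_cos_le_one _)).trans
      (h v.1 hv.1.le hv.2.le u hu)
  · filter_upwards [ae_restrict_mem measurableSet_Ioi] with u hu
    have h1 : ContinuousAt (fun b => sym k p q b u) b :=
      (hasDerivAt_sym_index k p q b hu).continuousAt
    have h2 : ContinuousAt (fun v : ℝ × ℝ => sym k p q v.1 u) (b, y) :=
      ContinuousAt.comp (g := fun b => sym k p q b u) (f := Prod.fst) h1 continuousAt_fst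
    refine h2.mul ?_
    fun_prop

lemma mul_stInt_succ (k p q : ℕ) {b : ℝ} (hb : 0 < b) (y : ℝ) :
    y * stInt k p (q + 1) b y = -((1 + q + p * b) * stInt k p q b y + k * stInt (k - 1) p q b y
      - b * stInt k (p + 1) q b y) := by
  set c : ℝ := q * (Real.pi / 2) with hc
  set f : ℝ → ℝ := fun u => u * sym k p q b u * Real.cos (u * y + c) with hf
  set f' : ℝ → ℝ := fun u => (1 + q + p * b) * (sym k p q b u * Real.cos (u * y + c))
    + k * (sym (k - 1) p q b u * Real.cos (u * y + c))
    - b * (sym k (p + 1) q b u * Real.cos (u * y + c))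
    + y * (sym k p (q + 1) b u * Real.cos (u * y + (q + 1 : ℕ) * (Real.pi / 2))) with hf'
  obtain ⟨C, hC, hS⟩ := abs_sym_le k p q (b₁ := b) (b₂ := b) (κ := -1 / 2) hb
    (by have : (0 : ℝ) ≤ p * b + q := by positivity
        linarith) (by norm_num)
  have hfb : ∀ u, 0 < u → |f u| ≤ u * |sym k p q b u| := by
    intro u hu
    rw [hf]
    simp only
    rw [abs_mul, abs_mul, abs_of_pos hu]
    exact mul_le_of_le_one_right (by positivity) (Real.abs_cos_le_one _)
  have hderiv : ∀ u ∈ Set.Ioi (0 : ℝ), HasDerivAt f (f' u) u := by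
    intro u hu
    have hu0 : u ≠ 0 := (Set.mem_Ioi.1 hu).ne'
    have h1 := (hasDerivAt_id u).mul (hasDerivAt_sym k p q b hu)
    have h2 : HasDerivAt (fun u => u * y + c) (1 * y) u :=
      ((hasDerivAt_id u).mul_const y).add_const _
    have h3 := h1.mul h2.cos
    convert! h3 using 1
    rw [hf']
    simp only [id, Pi.mul_apply]
    rw [sym_succ_mul k p q b hu, show u * y + ((q + 1 : ℕ) : ℝ) * (Real.pi / 2) =
      (u * y + c) + Real.pi / 2 by rw [hc]; push_cast; ring, Real.cos_add_pi_div_two]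
    field_simp
    ring
  have i1 := integrableOn_sym_mul_cos k p q hb y c
  have i2 := integrableOn_sym_mul_cos (k - 1) p q hb y c
  have i3 := integrableOn_sym_mul_cos k (p + 1) q hb y c
  have i4 := integrableOn_sym_mul_cos k p (q + 1) hb y ((q + 1 : ℕ) * (Real.pi / 2))
  have hint : IntegrableOn f' (Set.Ioi 0) :=
    (((i1.const_mul _).add (i2.const_mul _)).sub (i3.const_mul _)).add (i4.const_mul _)
  have h0 : f 0 = 0 := by simp [hf]
  have hcont : ContinuousWithinAt f (Set.Ici 0) 0 := by
    rw [ContinuousWithinAt, h0]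
    have hlim : Tendsto (fun u : ℝ => C * u ^ (1 / 2 : ℝ)) (𝓝[Set.Ici 0] 0) (𝓝 0) := by
      have : ContinuousAt (fun u : ℝ => C * u ^ (1 / 2 : ℝ)) 0 :=
        continuousAt_const.mul (Real.continuousAt_rpow_const _ _ (Or.inr (by norm_num)))
      have h := this.tendsto.mono_left (nhdsWithin_le_nhds (s := Set.Ici 0))
      simpa [Real.zero_rpow] using h
    refine squeeze_zero_norm' ?_ hlim
    filter_upwards [self_mem_nhdsWithin] with u hu
    rcases (Set.mem_Ici.1 hu).eq_or_lt with rfl | hu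
    · rw [h0]; simp [Real.zero_rpow]
    · refine (hfb u hu).trans ?_
      have := (hS b le_rfl le_rfl u hu).1
      calc u * |sym k p q b u| ≤ u * (C * u ^ (-1 / 2 : ℝ)) := by gcongr
        _ = C * (u ^ (-1 / 2 : ℝ) * u) := by ring
        _ = C * u ^ (1 / 2 : ℝ) := by
          rw [← Real.rpow_add_one hu.ne']; norm_num
  have hinf : Tendsto f atTop (𝓝 0) := by
    have hlim : Tendsto (fun u : ℝ => C * u ^ (-(1 : ℝ))) atTop (𝓝 0) := by
      simpa using (tendsto_rpow_neg_atTop zero_lt_one).const_mul C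
    refine squeeze_zero_norm' ?_ hlim
    filter_upwards [eventually_gt_atTop 0] with u hu
    refine (hfb u hu).trans ?_
    have := (hS b le_rfl le_rfl u hu).2
    calc u * |sym k p q b u| ≤ u * (C * u ^ (-2 : ℝ)) := by gcongr
      _ = C * (u ^ (-2 : ℝ) * u) := by ring
      _ = C * u ^ (-(1 : ℝ)) := by
        rw [← Real.rpow_add_one hu.ne']; norm_num
  have key := integral_Ioi_of_hasDerivAt_of_tendsto hcont hderiv hint hinf
  have e : f' = (((fun u => (1 + q + p * b) * (sym k p q b u * Real.cos (u * y + c)))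
    + fun u => k * (sym (k - 1) p q b u * Real.cos (u * y + c)))
    - fun u => b * (sym k (p + 1) q b u * Real.cos (u * y + c)))
    + fun u => y * (sym k p (q + 1) b u * Real.cos (u * y + (q + 1 : ℕ) * (Real.pi / 2))) := rfl
  rw [h0, sub_zero, e, integral_add' (((i1.const_mul _).add (i2.const_mul _)).sub
    (i3.const_mul _)) (i4.const_mul _), integral_sub' ((i1.const_mul _).add (i2.const_mul _))
    (i3.const_mul _), integral_add' (i1.const_mul _) (i2.const_mul _)] at key
  simp only [integral_const_mul] at key
  simp only [stInt]
  linarith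

/-- `EulerBound κ C n g`: on `(0,∞)` the function `g` and its first `n` images under the Euler
operator `u d/du` are bounded by `C u^κ` and by `C u^(-2)`. -/
def EulerBound (κ C : ℝ) : ℕ → (ℝ → ℝ) → Prop
  | 0, g => ∀ u : ℝ, 0 < u → |g u| ≤ C * u ^ κ ∧ |g u| ≤ C * u ^ (-2 : ℝ)
  | n + 1, g => (∀ u : ℝ, 0 < u → |g u| ≤ C * u ^ κ ∧ |g u| ≤ C * u ^ (-2 : ℝ)) ∧
      ∃ d : ℝ → ℝ, (∀ u : ℝ, 0 < u → HasDerivAt g (d u / u) u) ∧ EulerBound κ C n d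

lemma EulerBound.bound {κ C : ℝ} {n : ℕ} {g : ℝ → ℝ} (h : EulerBound κ C n g) :
    ∀ u : ℝ, 0 < u → |g u| ≤ C * u ^ κ ∧ |g u| ≤ C * u ^ (-2 : ℝ) := by
  cases n with
  | zero => exact h
  | succ n => exact h.1

lemma EulerBound.mono {κ C C' : ℝ} (hC : C ≤ C') {n : ℕ} :
    ∀ {g : ℝ → ℝ}, EulerBound κ C n g → EulerBound κ C' n g := by
  have key : ∀ {g : ℝ → ℝ}, (∀ u : ℝ, 0 < u → |g u| ≤ C * u ^ κ ∧ |g u| ≤ C * u ^ (-2 : ℝ)) →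
      ∀ u : ℝ, 0 < u → |g u| ≤ C' * u ^ κ ∧ |g u| ≤ C' * u ^ (-2 : ℝ) := by
    intro g h u hu
    exact ⟨(h u hu).1.trans (mul_le_mul_of_nonneg_right hC (Real.rpow_nonneg hu.le _)),
      (h u hu).2.trans (mul_le_mul_of_nonneg_right hC (Real.rpow_nonneg hu.le _))⟩
  induction n with
  | zero => intro g h; exact key h
  | succ n ih =>
    rintro g ⟨h, d, hd, hd'⟩
    exact ⟨key h, d, hd, ih hd'⟩

lemma EulerBound.add {κ C C' : ℝ} {n : ℕ} :
    ∀ {f g : ℝ → ℝ}, EulerBound κ C n f → EulerBound κ C' n g →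
      EulerBound κ (C + C') n (fun u => f u + g u) := by
  have key : ∀ {f g : ℝ → ℝ}, (∀ u : ℝ, 0 < u → |f u| ≤ C * u ^ κ ∧ |f u| ≤ C * u ^ (-2 : ℝ)) →
      (∀ u : ℝ, 0 < u → |g u| ≤ C' * u ^ κ ∧ |g u| ≤ C' * u ^ (-2 : ℝ)) →
      ∀ u : ℝ, 0 < u → |f u + g u| ≤ (C + C') * u ^ κ ∧ |f u + g u| ≤ (C + C') * u ^ (-2 : ℝ) := by
    intro f g h h' u hu
    rw [add_mul, add_mul]
    exact ⟨(abs_add_le _ _).trans (add_le_add (h u hu).1 (h' u hu).1),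
      (abs_add_le _ _).trans (add_le_add (h u hu).2 (h' u hu).2)⟩
  induction n with
  | zero => intro f g h h'; exact key h h'
  | succ n ih =>
    rintro f g ⟨h, d, hd, hd'⟩ ⟨h', e, he, he'⟩
    refine ⟨key h h', fun u => d u + e u, fun u hu => ?_, ih hd' he'⟩
    rw [add_div]
    exact (hd u hu).add (he u hu)

lemma EulerBound.const_mul {κ C a A : ℝ} (ha : |a| ≤ A) {n : ℕ} :
    ∀ {g : ℝ → ℝ}, EulerBound κ C n g → EulerBound κ (A * C) n (fun u => a * g u) := by
  have key : ∀ {g : ℝ → ℝ}, (∀ u : ℝ, 0 < u → |g u| ≤ C * u ^ κ ∧ |g u| ≤ C * u ^ (-2 : ℝ)) →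
      ∀ u : ℝ, 0 < u → |a * g u| ≤ A * C * u ^ κ ∧ |a * g u| ≤ A * C * u ^ (-2 : ℝ) := by
    intro g h u hu
    have hA : 0 ≤ A := (abs_nonneg a).trans ha
    rw [abs_mul, mul_assoc, mul_assoc]
    exact ⟨mul_le_mul ha (h u hu).1 (abs_nonneg _) hA, mul_le_mul ha (h u hu).2 (abs_nonneg _) hA⟩
  induction n with
  | zero => intro g h; exact key h
  | succ n ih =>
    rintro g ⟨h, d, hd, hd'⟩
    refine ⟨key h, fun u => a * d u, fun u hu => ?_, ih hd'⟩
    rw [mul_div_assoc]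
    exact (hd u hu).const_mul a

lemma eulerBound_sym {b₁ b₂ κ : ℝ} (hb₁ : 0 < b₁) (hκ' : -2 ≤ κ) (n : ℕ) :
    ∀ k p : ℕ, κ < p * b₁ →
      ∃ C : ℝ, 0 ≤ C ∧ ∀ b, b₁ ≤ b → b ≤ b₂ → EulerBound κ C n (sym k p 0 b) := by
  have key := fun (k p : ℕ) (h : κ < p * b₁) => abs_sym_le k p 0 (b₂ := b₂) hb₁
    (by simpa using h : κ < p * b₁ + (0 : ℕ)) hκ'
  induction n with
  | zero => exact key
  | succ n ih =>
    intro k p hp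
    obtain ⟨C₀, hC₀, h₀⟩ := key k p hp
    obtain ⟨C₁, hC₁, h₁⟩ := ih (k - 1) p hp
    obtain ⟨C₂, hC₂, h₂⟩ := ih k p hp
    obtain ⟨C₃, hC₃, h₃⟩ := ih k (p + 1) (by push_cast; nlinarith)
    refine ⟨C₀ + (k * C₁ + p * |b₂| * C₂ + |b₂| * C₃), by positivity, fun b hb hb' => ?_⟩
    have hbb : |b| ≤ |b₂| := by
      rw [abs_of_pos (by linarith), abs_of_pos (by linarith)]; exact hb'
    have hle : k * C₁ + p * |b₂| * C₂ + |b₂| * C₃ ≤ C₀ + (k * C₁ + p * |b₂| * C₂ + |b₂| * C₃) := by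
      linarith
    have e1 := (h₁ b hb hb').const_mul (a := (k : ℝ)) (A := k) (by simp)
    have e2 := (h₂ b hb hb').const_mul (a := p * b) (A := p * |b₂|)
      (by rw [abs_mul, Nat.abs_cast]; gcongr)
    have e3 := (h₃ b hb hb').const_mul (a := -b) (A := |b₂|) (by rwa [abs_neg])
    refine ⟨fun u hu => ?_, _, fun u hu => ?_, ((e1.add e2).add e3).mono hle⟩
    · have h4 : C₀ ≤ C₀ + (k * C₁ + p * |b₂| * C₂ + |b₂| * C₃) := by
        have : 0 ≤ k * C₁ + p * |b₂| * C₂ + |b₂| * C₃ := by positivity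
        linarith
      exact EulerBound.bound (n := 0) (EulerBound.mono (n := 0) h4 (h₀ b hb hb')) u hu
    · have := hasDerivAt_sym k p 0 b hu
      convert! this using 2
      simp
      ring

lemma EulerBound.continuousOn {κ C : ℝ} {n : ℕ} {g : ℝ → ℝ} (h : EulerBound κ C (n + 1) g) :
    ContinuousOn g (Set.Ioi 0) := by
  obtain ⟨_, d, hd, _⟩ := h
  exact fun u hu => (hd u hu).continuousAt.continuousWithinAt

/-- The constant in the decay estimate for cosine transforms. -/
def decayConst (κ : ℝ) : ℝ := 1 / κ + 3 + 6 / (2 - κ)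

lemma decayConst_pos {κ : ℝ} (h0 : 0 < κ) (h2 : κ < 2) : 0 < decayConst κ := by
  have : 0 < 2 - κ := by linarith
  unfold decayConst
  positivity

lemma abs_integral_sin_Ioi_le {κ C y : ℝ} (hκ : κ < 2) (hC : 0 ≤ C)
    {d : ℝ → ℝ} (hd : EulerBound κ C 3 d) (hy : 0 < y)
    (hint : IntegrableOn (fun u => d u / u * Real.sin (u * y)) (Set.Ioi y⁻¹)) :
    |∫ u in Set.Ioi y⁻¹, d u / u * Real.sin (u * y)| ≤ C * (3 + 6 / (2 - κ)) * y⁻¹ ^ κ := by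
  obtain ⟨hd0, d₂, hd₂, hd₂'⟩ := hd
  have hd₂0 := hd₂'.bound
  have hd₂c := hd₂'.continuousOn
  obtain ⟨-, d₃, hd₃, hd₃'⟩ := hd₂'
  have hd₃0 := hd₃'.bound
  have hd₃c := hd₃'.continuousOn
  set a := y⁻¹ with ha
  have ha0 : 0 < a := inv_pos.2 hy
  have hdc : ContinuousOn d (Set.Ioi 0) := fun u hu => (hd₂ u hu).continuousAt.continuousWithinAt
  set g₁ : ℝ → ℝ := fun u => d u / u with hg₁
  set g₂ : ℝ → ℝ := fun u => (d₂ u - d u) / u ^ 2 with hg₂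
  set g₃ : ℝ → ℝ := fun u => (d₃ u - 3 * d₂ u + 2 * d u) / u ^ 3 with hg₃
  have hg₁d : ∀ u, 0 < u → HasDerivAt g₁ (g₂ u) u := by
    intro u hu
    have hu0 := hu.ne'
    have := (hd₂ u hu).div (hasDerivAt_id u) hu0
    convert! this using 1
    simp only [hg₂, id]
    field_simp
  have hg₂d : ∀ u, 0 < u → HasDerivAt g₂ (g₃ u) u := by
    intro u hu
    have hu0 := hu.ne'
    have := ((hd₃ u hu).sub (hd₂ u hu)).div ((hasDerivAt_id u).pow 2) (pow_ne_zero 2 hu0)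
    convert! this using 1
    simp only [hg₃, id, Pi.sub_apply]
    field_simp
    norm_num
    ring
  have b₁ : ∀ u, 0 < u → |g₁ u| ≤ C * u ^ (κ - 1) := by
    intro u hu
    rw [hg₁]
    simp only
    rw [abs_div, abs_of_pos hu, div_le_iff₀ hu, mul_assoc, Real.rpow_sub_one hu.ne',
      div_mul_cancel₀ _ hu.ne']
    exact (hd0 u hu).1
  have e2 : ∀ u : ℝ, 0 < u → u ^ (κ - 2) * u ^ 2 = u ^ κ := by
    intro u hu
    rw [← Real.rpow_natCast, ← Real.rpow_add hu]; norm_num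
  have e3 : ∀ u : ℝ, 0 < u → u ^ (κ - 3) * u ^ 3 = u ^ κ := by
    intro u hu
    rw [← Real.rpow_natCast, ← Real.rpow_add hu]; norm_num
  have b₂ : ∀ u, 0 < u → |g₂ u| ≤ 2 * C * u ^ (κ - 2) := by
    intro u hu
    rw [hg₂]
    simp only
    rw [abs_div, abs_of_pos (pow_pos hu 2), div_le_iff₀ (pow_pos hu 2), mul_assoc, e2 u hu]
    refine (abs_sub _ _).trans ?_
    linarith [(hd0 u hu).1, (hd₂0 u hu).1]
  have b₃ : ∀ u, 0 < u → |g₃ u| ≤ 6 * C * u ^ (κ - 3) := by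
    intro u hu
    rw [hg₃]
    simp only
    rw [abs_div, abs_of_pos (pow_pos hu 3), div_le_iff₀ (pow_pos hu 3), mul_assoc, e3 u hu]
    have h1 := abs_le.1 (hd0 u hu).1
    have h2 := abs_le.1 (hd₂0 u hu).1
    have h3 := abs_le.1 (hd₃0 u hu).1
    rw [abs_le]
    constructor <;> linarith
  set F : ℝ → ℝ := fun u => -(g₁ u * Real.cos (u * y)) * y⁻¹ + g₂ u * Real.sin (u * y) * y⁻¹ ^ 2
  have hFd : ∀ u, 0 < u → HasDerivAt F
      (g₁ u * Real.sin (u * y) + y⁻¹ ^ 2 * (g₃ u * Real.sin (u * y))) u := by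
    intro u hu
    have hl : HasDerivAt (fun u => u * y) (1 * y) u := (hasDerivAt_id u).mul_const y
    have := (((hg₁d u hu).mul hl.cos).neg.mul_const y⁻¹).add
      (((hg₂d u hu).mul hl.sin).mul_const (y⁻¹ ^ 2))
    convert! this using 1
    field_simp
    ring
  have hg₃i : IntegrableOn (fun u => g₃ u * Real.sin (u * y)) (Set.Ioi a) := by
    have hi : IntegrableOn (fun u : ℝ => 6 * C * u ^ (κ - 3)) (Set.Ioi a) :=
      (integrableOn_Ioi_rpow_of_lt (by linarith) ha0).const_mul _
    refine hi.mono' ?_ ?_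
    · refine ContinuousOn.aestronglyMeasurable ?_ measurableSet_Ioi
      have hsub : Set.Ioi a ⊆ Set.Ioi 0 := Set.Ioi_subset_Ioi ha0.le
      refine ContinuousOn.mul (ContinuousOn.div ?_ (by fun_prop) ?_) (by fun_prop)
      · exact (((hd₃c.sub (hd₂c.const_mul 3)).add (hdc.const_mul 2))).mono hsub
      · exact fun u hu => pow_ne_zero 3 (hsub hu).ne'
    · filter_upwards [ae_restrict_mem measurableSet_Ioi] with u hu
      rw [norm_mul]
      exact (mul_le_of_le_one_right (norm_nonneg _) (Real.abs_sin_le_one _)).trans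
        (b₃ u (ha0.trans hu))
  have hint' : IntegrableOn (fun u => g₁ u * Real.sin (u * y)) (Set.Ioi a) := hint
  have hb1' : ∀ u, 0 < u → |g₁ u| ≤ C * u⁻¹ ^ 3 := by
    intro u hu
    rw [hg₁]
    simp only
    rw [abs_div, abs_of_pos hu, div_le_iff₀ hu]
    refine (hd0 u hu).2.trans (le_of_eq ?_)
    rw [Real.rpow_neg hu.le]
    have : u ^ (2 : ℝ) = u ^ 2 := by norm_cast
    rw [this]
    field_simp
  have hFinf : Tendsto F atTop (𝓝 0) := by
    have l1 : Tendsto (fun u : ℝ => C * u⁻¹ ^ 3 * y⁻¹ + 2 * C * u ^ (κ - 2) * y⁻¹ ^ 2) atTop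
        (𝓝 (C * 0 ^ 3 * y⁻¹ + 2 * C * 0 * y⁻¹ ^ 2)) := by
      have t1 : Tendsto (fun u : ℝ => u⁻¹) atTop (𝓝 0) := tendsto_inv_atTop_zero
      have t2 : Tendsto (fun u : ℝ => u ^ (κ - 2)) atTop (𝓝 0) := by
        have := tendsto_rpow_neg_atTop (y := 2 - κ) (by linarith)
        simpa using this
      exact (((t1.pow 3).const_mul C).mul_const _).add ((t2.const_mul (2 * C)).mul_const _)
    simp only [mul_zero, ne_eq, OfNat.ofNat_ne_zero, not_false_eq_true, zero_pow, zero_mul,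
      add_zero] at l1
    refine squeeze_zero_norm' ?_ l1
    filter_upwards [eventually_gt_atTop 0] with u hu
    refine (norm_add_le _ _).trans (add_le_add ?_ ?_)
    · rw [norm_mul, norm_neg, norm_mul, Real.norm_of_nonneg (inv_pos.2 hy).le]
      refine mul_le_mul_of_nonneg_right ?_ (by positivity)
      exact (mul_le_of_le_one_right (norm_nonneg _) (Real.abs_cos_le_one _)).trans (hb1' u hu)
    · rw [norm_mul, norm_mul, Real.norm_of_nonneg (by positivity : 0 ≤ y⁻¹ ^ 2)]
      refine mul_le_mul_of_nonneg_right ?_ (by positivity)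
      exact (mul_le_of_le_one_right (norm_nonneg _) (Real.abs_sin_le_one _)).trans (b₂ u hu)
  have key := integral_Ioi_of_hasDerivAt_of_tendsto (hFd a ha0).continuousAt.continuousWithinAt
    (fun u hu => hFd u (ha0.trans hu)) (hint'.add (hg₃i.const_mul (y⁻¹ ^ 2))) hFinf
  rw [integral_add hint' (hg₃i.const_mul (y⁻¹ ^ 2)), integral_const_mul] at key
  have hI : ∫ u in Set.Ioi a, g₁ u * Real.sin (u * y) =
      -F a - y⁻¹ ^ 2 * ∫ u in Set.Ioi a, g₃ u * Real.sin (u * y) := by linarith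
  have hFa : |F a| ≤ 3 * C * a ^ κ := by
    refine (abs_add_le _ _).trans ?_
    have t1 : |-(g₁ a * Real.cos (a * y)) * y⁻¹| ≤ C * a ^ κ := by
      rw [abs_mul, abs_neg, abs_mul, abs_of_pos (inv_pos.2 hy)]
      calc |g₁ a| * |Real.cos (a * y)| * y⁻¹ ≤ (C * a ^ (κ - 1)) * 1 * y⁻¹ := by
            gcongr
            · exact b₁ a ha0
            · exact Real.abs_cos_le_one _
        _ = C * a ^ κ := by
            rw [← ha, mul_one, mul_assoc, ← Real.rpow_add_one ha0.ne']; norm_num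
    have t2 : |g₂ a * Real.sin (a * y) * y⁻¹ ^ 2| ≤ 2 * C * a ^ κ := by
      rw [abs_mul, abs_mul, abs_of_pos (by positivity : 0 < y⁻¹ ^ 2)]
      calc |g₂ a| * |Real.sin (a * y)| * y⁻¹ ^ 2 ≤ (2 * C * a ^ (κ - 2)) * 1 * y⁻¹ ^ 2 := by
            gcongr
            · exact b₂ a ha0
            · exact Real.abs_sin_le_one _
        _ = 2 * C * a ^ κ := by
            rw [← ha, mul_one, mul_assoc, e2 a ha0]
    linarith
  have hI3 : |∫ u in Set.Ioi a, g₃ u * Real.sin (u * y)| ≤ 6 * C * (a ^ (κ - 2) / (2 - κ)) := by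
    have hi : IntegrableOn (fun u : ℝ => 6 * C * u ^ (κ - 3)) (Set.Ioi a) :=
      (integrableOn_Ioi_rpow_of_lt (by linarith) ha0).const_mul _
    have := norm_integral_le_of_norm_le (μ := volume.restrict (Set.Ioi a))
      (f := fun u => g₃ u * Real.sin (u * y)) hi (by
        filter_upwards [ae_restrict_mem measurableSet_Ioi] with u hu
        rw [norm_mul]
        exact (mul_le_of_le_one_right (norm_nonneg _) (Real.abs_sin_le_one _)).trans
          (b₃ u (ha0.trans hu)))
    rw [integral_const_mul, integral_Ioi_rpow_of_lt (by linarith) ha0] at this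
    refine this.trans (le_of_eq ?_)
    rw [show κ - 3 + 1 = κ - 2 by ring, show (2 - κ) = -(κ - 2) by ring, div_neg, neg_div]
  rw [hI]
  have : |-F a - y⁻¹ ^ 2 * ∫ u in Set.Ioi a, g₃ u * Real.sin (u * y)| ≤
      |F a| + y⁻¹ ^ 2 * |∫ u in Set.Ioi a, g₃ u * Real.sin (u * y)| := by
    refine (abs_sub _ _).trans ?_
    rw [abs_neg, abs_mul, abs_of_pos (by positivity : 0 < y⁻¹ ^ 2)]
  refine this.trans ?_
  calc |F a| + y⁻¹ ^ 2 * |∫ u in Set.Ioi a, g₃ u * Real.sin (u * y)|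
      ≤ 3 * C * a ^ κ + y⁻¹ ^ 2 * (6 * C * (a ^ (κ - 2) / (2 - κ))) := by gcongr
    _ = 3 * C * a ^ κ + 6 * C / (2 - κ) * (a ^ (κ - 2) * a ^ 2) := by rw [← ha]; ring
    _ = C * (3 + 6 / (2 - κ)) * a ^ κ := by rw [e2 a ha0]; ring

lemma abs_integral_mul_cos_le {κ C B y : ℝ} (hκ0 : 0 < κ) (hκ : κ < 2) (hC : 0 ≤ C)
    {g d : ℝ → ℝ} (hgd : ∀ u, 0 < u → HasDerivAt g (d u / u) u) (hd : EulerBound κ C 3 d)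
    (hB : ∀ u, 0 < u → |g u| ≤ B) (hint : IntegrableOn g (Set.Ioi 0))
    (hinf : Tendsto g atTop (𝓝 0)) (hy : 0 < y) :
    |∫ u in Set.Ioi (0 : ℝ), g u * Real.cos (u * y)| ≤ C * decayConst κ * y ^ (-1 - κ) := by
  have hd0 := hd.bound
  set a := y⁻¹ with ha
  have ha0 : 0 < a := inv_pos.2 hy
  have hdc : ContinuousOn d (Set.Ioi 0) := hd.continuousOn
  have b₁ : ∀ u, 0 < u → |d u / u| ≤ C * u ^ (κ - 1) := by
    intro u hu
    rw [abs_div, abs_of_pos hu, div_le_iff₀ hu, mul_assoc, Real.rpow_sub_one hu.ne',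
      div_mul_cancel₀ _ hu.ne']
    exact (hd0 u hu).1
  have b₂ : ∀ u, 0 < u → |d u / u| ≤ C * u ^ (-2 : ℝ) := by
    intro u hu
    rcases le_total u 1 with h1 | h1
    · refine (b₁ u hu).trans ?_
      gcongr ?_ * ?_
      exact Real.rpow_le_rpow_of_exponent_ge hu h1 (by linarith)
    · rw [abs_div, abs_of_pos hu, div_le_iff₀ hu]
      refine (hd0 u hu).2.trans ?_
      exact le_mul_of_one_le_right (by positivity) h1
  have hdi : IntegrableOn (fun u => d u / u * Real.sin (u * y)) (Set.Ioi 0) := by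
    refine ((integrableOn_min_rpow (κ := κ - 1) (by linarith)).const_mul C).mono' ?_ ?_
    · refine ContinuousOn.aestronglyMeasurable ?_ measurableSet_Ioi
      exact (hdc.div (by fun_prop) (fun u hu => (Set.mem_Ioi.1 hu).ne')).mul (by fun_prop)
    · filter_upwards [ae_restrict_mem measurableSet_Ioi] with u hu
      rw [norm_mul]
      refine (mul_le_of_le_one_right (norm_nonneg _) (Real.abs_sin_le_one _)).trans ?_
      rw [mul_min_of_nonneg _ _ hC]
      exact le_min (b₁ u hu) (b₂ u hu)
  have hgc : ContinuousOn g (Set.Ioi 0) := fun u hu => (hgd u hu).continuousAt.continuousWithinAt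
  have hgi : IntegrableOn (fun u => g u * Real.cos (u * y)) (Set.Ioi 0) := by
    refine hint.norm.mono' ?_ (ae_of_all _ fun u => ?_)
    · exact (hgc.mul (by fun_prop)).aestronglyMeasurable measurableSet_Ioi
    · rw [norm_mul]
      exact mul_le_of_le_one_right (norm_nonneg _) (Real.abs_cos_le_one _)
  set F : ℝ → ℝ := fun u => g u * Real.sin (u * y) with hF
  have hFd : ∀ u ∈ Set.Ioi (0 : ℝ), HasDerivAt F
      (d u / u * Real.sin (u * y) + y * (g u * Real.cos (u * y))) u := by
    intro u hu
    have hl : HasDerivAt (fun u => u * y) (1 * y) u := (hasDerivAt_id u).mul_const y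
    have := (hgd u hu).mul hl.sin
    convert! this using 1
    ring
  have hF0 : F 0 = 0 := by simp [hF]
  have hcont : ContinuousWithinAt F (Set.Ici 0) 0 := by
    rw [ContinuousWithinAt, hF0]
    have hlim : Tendsto (fun u : ℝ => B * |Real.sin (u * y)|) (𝓝[Set.Ici 0] 0) (𝓝 0) := by
      have : Continuous (fun u : ℝ => B * |Real.sin (u * y)|) := by fun_prop
      have h := (this.tendsto 0).mono_left (nhdsWithin_le_nhds (s := Set.Ici 0))
      simpa using h
    refine squeeze_zero_norm' ?_ hlim
    filter_upwards [self_mem_nhdsWithin] with u hu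
    rcases (Set.mem_Ici.1 hu).eq_or_lt with rfl | hu
    · simp [hF]
    · rw [hF]
      simp only [norm_mul, Real.norm_eq_abs]
      gcongr
      exact hB u hu
  have hFinf : Tendsto F atTop (𝓝 0) := by
    refine squeeze_zero_norm (fun u => ?_) (by simpa using hinf.norm)
    rw [norm_mul]
    exact mul_le_of_le_one_right (norm_nonneg _) (Real.abs_sin_le_one _)
  have key := integral_Ioi_of_hasDerivAt_of_tendsto hcont hFd (hdi.add (hgi.const_mul y)) hFinf
  rw [hF0, sub_zero, integral_add hdi (hgi.const_mul y), integral_const_mul] at key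
  have hsplit := setIntegral_union (Set.Ioc_disjoint_Ioi (le_refl a)) measurableSet_Ioi
    (hdi.mono_set (fun u (hu : u ∈ Set.Ioc 0 a) => hu.1))
    (hdi.mono_set (Set.Ioi_subset_Ioi ha0.le))
  rw [Set.Ioc_union_Ioi_eq_Ioi ha0.le] at hsplit
  have h1 : |∫ u in Set.Ioc 0 a, d u / u * Real.sin (u * y)| ≤ C * (a ^ κ / κ) := by
    have hi : IntegrableOn (fun u : ℝ => C * u ^ (κ - 1)) (Set.Ioc 0 a) :=
      ((intervalIntegral.intervalIntegrable_rpow' (a := 0) (b := a) (by linarith :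
        -1 < κ - 1)).1).const_mul C
    have := norm_integral_le_of_norm_le (μ := volume.restrict (Set.Ioc 0 a))
      (f := fun u => d u / u * Real.sin (u * y)) hi (by
        filter_upwards [ae_restrict_mem measurableSet_Ioc] with u hu
        rw [norm_mul]
        exact (mul_le_of_le_one_right (norm_nonneg _) (Real.abs_sin_le_one _)).trans (b₁ u hu.1))
    refine this.trans (le_of_eq ?_)
    rw [integral_const_mul, ← intervalIntegral.integral_of_le ha0.le,
      integral_rpow (Or.inl (by linarith)), sub_add_cancel, Real.zero_rpow hκ0.ne', sub_zero]
  have h2 := abs_integral_sin_Ioi_le hκ hC hd hy (hdi.mono_set (Set.Ioi_subset_Ioi ha0.le))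
  have h3 : |∫ u in Set.Ioi (0 : ℝ), d u / u * Real.sin (u * y)| ≤ C * decayConst κ * a ^ κ := by
    rw [hsplit]
    refine (abs_add_le _ _).trans ((add_le_add h1 h2).trans (le_of_eq ?_))
    unfold decayConst
    ring
  have h4 : ∫ u in Set.Ioi (0 : ℝ), g u * Real.cos (u * y) =
      -(y⁻¹ * ∫ u in Set.Ioi (0 : ℝ), d u / u * Real.sin (u * y)) := by
    rw [eq_neg_of_add_eq_zero_left key, mul_neg, neg_neg, inv_mul_cancel_left₀ hy.ne']
  rw [h4, abs_neg, abs_mul, abs_of_pos ha0]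
  calc a * |∫ u in Set.Ioi (0 : ℝ), d u / u * Real.sin (u * y)|
      ≤ a * (C * decayConst κ * a ^ κ) := by gcongr
    _ = C * decayConst κ * (a ^ κ * a) := by ring
    _ = C * decayConst κ * y ^ (-1 - κ) := by
      rw [← Real.rpow_add_one ha0.ne', ha, Real.inv_rpow hy.le, ← Real.rpow_neg hy.le]
      congr 2
      ring

lemma tendsto_sym_atTop (k p q : ℕ) {b : ℝ} (hb : 0 < b) :
    Tendsto (sym k p q b) atTop (𝓝 0) := by
  obtain ⟨C, hC, h⟩ := abs_sym_le k p q (b₁ := b) (b₂ := b) (κ := -1) hb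
    (by have : (0 : ℝ) ≤ p * b + q := by positivity
        linarith) (by norm_num)
  have h0 : Tendsto (fun u : ℝ => C * u ^ (-2 : ℝ)) atTop (𝓝 (C * 0)) :=
    (tendsto_rpow_neg_atTop two_pos).const_mul C
  rw [mul_zero] at h0
  refine squeeze_zero_norm' ?_ h0
  filter_upwards [eventually_gt_atTop 0] with u hu
  exact (h b le_rfl le_rfl u hu).2

lemma stInt_neg (k p q : ℕ) (b y : ℝ) : stInt k p q b (-y) = (-1) ^ q * stInt k p q b y := by
  have h : ∀ u : ℝ, Real.cos (u * -y + q * (Real.pi / 2)) =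
      (-1) ^ q * Real.cos (u * y + q * (Real.pi / 2)) := by
    intro u
    have h1 : u * -y + q * (Real.pi / 2) = -((u * y + q * (Real.pi / 2)) - q * Real.pi) := by ring
    rw [h1, Real.cos_neg, Real.cos_sub_nat_mul_pi]
  simp only [stInt]
  rw [← integral_const_mul]
  congr 1
  funext u
  rw [h]
  ring

lemma abs_stInt_neg (k p q : ℕ) (b y : ℝ) : |stInt k p q b (-y)| = |stInt k p q b y| := by
  rw [stInt_neg, abs_mul, abs_pow, abs_neg, abs_one, one_pow, one_mul]

lemma abs_stInt_bounded (k p q : ℕ) {b₁ b₂ : ℝ} (hb₁ : 0 < b₁) :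
    ∃ C : ℝ, 0 ≤ C ∧ ∀ b, b₁ ≤ b → b ≤ b₂ → ∀ y, |stInt k p q b y| ≤ C := by
  obtain ⟨G, hG, h⟩ := exists_integrable_bound_sym k p q (b₂ := b₂) hb₁
  refine ⟨|∫ u in Set.Ioi 0, G u|, abs_nonneg _, fun b hb hb' y => ?_⟩
  refine le_trans ?_ (le_abs_self _)
  refine norm_integral_le_of_norm_le (μ := volume.restrict (Set.Ioi (0 : ℝ)))
    (f := fun u => sym k p q b u * Real.cos (u * y + q * (Real.pi / 2))) hG ?_
  filter_upwards [ae_restrict_mem measurableSet_Ioi] with u hu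
  rw [norm_mul]
  exact (mul_le_of_le_one_right (norm_nonneg _) (Real.abs_cos_le_one _)).trans (h b hb hb' u hu)

lemma abs_stInt_zero_le (k p : ℕ) (hkp : 1 ≤ p ∨ k = 0 ∧ p = 0) {b₁ b₂ κ : ℝ} (hκ0 : 0 < κ)
    (hκ1 : κ < b₁) (hκ2 : κ < 2) :
    ∃ C : ℝ, 0 ≤ C ∧ ∀ b, b₁ ≤ b → b ≤ b₂ → ∀ y, 0 < y →
      |stInt k p 0 b y| ≤ C * y ^ (-1 - κ) := by
  have hb₁ : 0 < b₁ := hκ0.trans hκ1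
  have red : ∀ b y, stInt k p 0 b y = ∫ u in Set.Ioi (0 : ℝ), sym k p 0 b u * Real.cos (u * y) := by
    intro b y
    simp [stInt]
  have main : ∃ C : ℝ, 0 ≤ C ∧ ∀ b, b₁ ≤ b → b ≤ b₂ → ∃ d : ℝ → ℝ,
      (∀ u, 0 < u → HasDerivAt (sym k p 0 b) (d u / u) u) ∧ EulerBound κ C 3 d ∧
      ∃ B, ∀ u, 0 < u → |sym k p 0 b u| ≤ B := by
    rcases hkp with hp | ⟨rfl, rfl⟩
    · have hpb : κ < p * b₁ := by
        have : (1 : ℝ) ≤ p := by exact_mod_cast hp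
        nlinarith
      obtain ⟨C, hC, h⟩ := eulerBound_sym (b₂ := b₂) hb₁ (by linarith) 4 k p hpb
      refine ⟨C, hC, fun b hb hb' => ?_⟩
      have h1 := h b hb hb'
      have h2 := h1.bound
      obtain ⟨-, d, hd, hd'⟩ := h1
      refine ⟨d, hd, hd', C, fun u hu => ?_⟩
      rcases le_total u 1 with h3 | h3
      · exact (h2 u hu).1.trans (mul_le_of_le_one_right hC (Real.rpow_le_one hu.le h3 hκ0.le))
      · exact (h2 u hu).2.trans (mul_le_of_le_one_right hC
          (Real.rpow_le_one_of_one_le_of_nonpos h3 (by norm_num)))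
    · obtain ⟨C, hC, h⟩ := eulerBound_sym (b₂ := b₂) (κ := κ) hb₁ (by linarith) 3 0 1
        (by simpa using hκ1)
      refine ⟨|b₂| * C, by positivity, fun b hb hb' => ?_⟩
      have hbb : |-b| ≤ |b₂| := by
        rw [abs_neg, abs_of_pos (by linarith), abs_of_pos (by linarith)]; exact hb'
      refine ⟨_, fun u hu => ?_, (h b hb hb').const_mul hbb, 1, fun u hu => ?_⟩
      · have := hasDerivAt_sym 0 0 0 b hu
        convert! this using 2
        simp
      · rw [abs_sym 0 0 0 b hu]
        have := Real.rpow_nonneg hu.le b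
        simpa using this
  obtain ⟨C, hC, h⟩ := main
  refine ⟨C * decayConst κ, mul_nonneg hC (decayConst_pos hκ0 hκ2).le, fun b hb hb' y hy => ?_⟩
  obtain ⟨d, hd, hd', B, hB⟩ := h b hb hb'
  have hb0 : 0 < b := hb₁.trans_le hb
  rw [red]
  exact abs_integral_mul_cos_le hκ0 hκ2 hC hd hd' hB (integrableOn_sym k p 0 hb0)
    (tendsto_sym_atTop k p 0 hb0) hy

/-- Uniform polynomial decay of the transforms and of their space derivatives. -/
lemma abs_stInt_le {b₁ b₂ κ : ℝ} (hκ0 : 0 < κ) (hκ1 : κ < b₁) (hκ2 : κ < 2) (q : ℕ) :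
    ∀ k p : ℕ, (1 ≤ p ∨ k = 0 ∧ p = 0) → ∃ C : ℝ, 0 ≤ C ∧ ∀ b, b₁ ≤ b → b ≤ b₂ → ∀ y,
      (1 + |y|) ^ q * |stInt k p q b y| ≤ C * (1 + |y|) ^ (-1 - κ) := by
  have hb₁ : 0 < b₁ := hκ0.trans hκ1
  have tail : ∀ k p : ℕ, (1 ≤ p ∨ k = 0 ∧ p = 0) → ∃ C : ℝ, 0 ≤ C ∧ ∀ b, b₁ ≤ b → b ≤ b₂ → ∀ y,
      0 < y → y ^ q * |stInt k p q b y| ≤ C * y ^ (-1 - κ) := by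
    induction q with
    | zero =>
      intro k p hkp
      obtain ⟨C, hC, h⟩ := abs_stInt_zero_le (b₂ := b₂) k p hkp hκ0 hκ1 hκ2
      exact ⟨C, hC, fun b hb hb' y hy => by simpa using h b hb hb' y hy⟩
    | succ q ih =>
      intro k p hkp
      obtain ⟨C₁, hC₁, h₁⟩ := ih k p hkp
      obtain ⟨C₂, hC₂, h₂⟩ := ih (k - 1) p (by omega)
      obtain ⟨C₃, hC₃, h₃⟩ := ih k (p + 1) (by omega)
      refine ⟨(1 + q + p * |b₂|) * C₁ + k * C₂ + |b₂| * C₃, by positivity, fun b hb hb' y hy => ?_⟩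
      have hb0 : 0 < b := hb₁.trans_le hb
      have hbb : b ≤ |b₂| := hb'.trans (le_abs_self _)
      have hrec : y * |stInt k p (q + 1) b y| ≤ (1 + q + p * |b₂|) * |stInt k p q b y|
          + k * |stInt (k - 1) p q b y| + |b₂| * |stInt k (p + 1) q b y| := by
        rw [← abs_of_pos hy, ← abs_mul, abs_of_pos hy, mul_stInt_succ k p q hb0 y, abs_neg]
        refine (abs_sub _ _).trans (add_le_add ((abs_add_le _ _).trans (add_le_add ?_ ?_)) ?_)
        · rw [abs_mul, abs_of_pos (by positivity)]
          gcongr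
        · rw [abs_mul, Nat.abs_cast]
        · rw [abs_mul, abs_of_pos hb0]
          gcongr
      have e1 := h₁ b hb hb' y hy
      have e2 := h₂ b hb hb' y hy
      have e3 := h₃ b hb hb' y hy
      calc y ^ (q + 1) * |stInt k p (q + 1) b y| = y ^ q * (y * |stInt k p (q + 1) b y|) := by ring
        _ ≤ y ^ q * ((1 + q + p * |b₂|) * |stInt k p q b y|
          + k * |stInt (k - 1) p q b y| + |b₂| * |stInt k (p + 1) q b y|) := by gcongr
        _ = (1 + q + p * |b₂|) * (y ^ q * |stInt k p q b y|)
          + k * (y ^ q * |stInt (k - 1) p q b y|)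
          + |b₂| * (y ^ q * |stInt k (p + 1) q b y|) := by ring
        _ ≤ (1 + q + p * |b₂|) * (C₁ * y ^ (-1 - κ)) + k * (C₂ * y ^ (-1 - κ))
          + |b₂| * (C₃ * y ^ (-1 - κ)) := by gcongr
        _ = _ := by ring
  intro k p hkp
  obtain ⟨C₁, hC₁, h₁⟩ := tail k p hkp
  obtain ⟨C₂, hC₂, h₂⟩ := abs_stInt_bounded k p q (b₂ := b₂) hb₁
  set E : ℝ := 2 ^ q * 2 ^ (1 + κ) with hE
  have hE0 : 0 < E := by positivity
  refine ⟨E * (C₁ + C₂), by positivity, ?_⟩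
  have pos : ∀ b, b₁ ≤ b → b ≤ b₂ → ∀ y, 0 ≤ y →
      (1 + y) ^ q * |stInt k p q b y| ≤ E * (C₁ + C₂) * (1 + y) ^ (-1 - κ) := by
    intro b hb hb' y hy
    have h1y : 0 < 1 + y := by linarith
    rcases le_total y 1 with hy1 | hy1
    · have a1 : (1 + y) ^ q ≤ 2 ^ q := pow_le_pow_left₀ h1y.le (by linarith) q
      have a2 : 1 ≤ 2 ^ (1 + κ) * (1 + y) ^ (-1 - κ) := by
        rw [show (-1 - κ) = -(1 + κ) by ring, Real.rpow_neg h1y.le, ← div_eq_mul_inv,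
          one_le_div (Real.rpow_pos_of_pos h1y _)]
        exact Real.rpow_le_rpow h1y.le (by linarith) (by linarith)
      calc (1 + y) ^ q * |stInt k p q b y| ≤ 2 ^ q * C₂ * 1 := by
            rw [mul_one]
            gcongr
            exact h₂ b hb hb' y
        _ ≤ 2 ^ q * C₂ * (2 ^ (1 + κ) * (1 + y) ^ (-1 - κ)) := by gcongr
        _ = E * C₂ * (1 + y) ^ (-1 - κ) := by rw [hE]; ring
        _ ≤ E * (C₁ + C₂) * (1 + y) ^ (-1 - κ) := by
            gcongr
            linarith
    · have hy0 : 0 < y := by linarith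
      have a1 : (1 + y) ^ q ≤ 2 ^ q * y ^ q := by
        rw [← mul_pow]
        exact pow_le_pow_left₀ h1y.le (by linarith) q
      have a2 : y ^ (-1 - κ) ≤ 2 ^ (1 + κ) * (1 + y) ^ (-1 - κ) := by
        rw [show (-1 - κ) = -(1 + κ) by ring, Real.rpow_neg h1y.le, Real.rpow_neg hy0.le,
          ← div_eq_mul_inv, inv_le_comm₀ (by positivity) (by positivity), inv_div,
          div_le_iff₀ (by positivity), ← Real.mul_rpow hy0.le (by norm_num)]
        exact Real.rpow_le_rpow h1y.le (by linarith) (by linarith)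
      calc (1 + y) ^ q * |stInt k p q b y| ≤ 2 ^ q * y ^ q * |stInt k p q b y| := by gcongr
        _ = 2 ^ q * (y ^ q * |stInt k p q b y|) := by ring
        _ ≤ 2 ^ q * (C₁ * (2 ^ (1 + κ) * (1 + y) ^ (-1 - κ))) := by
            refine mul_le_mul_of_nonneg_left ?_ (by positivity)
            exact (h₁ b hb hb' y hy0).trans (mul_le_mul_of_nonneg_left a2 hC₁)
        _ = E * C₁ * (1 + y) ^ (-1 - κ) := by rw [hE]; ring
        _ ≤ E * (C₁ + C₂) * (1 + y) ^ (-1 - κ) := by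
            gcongr
            linarith
  intro b hb hb' y
  rcases le_total 0 y with hy | hy
  · rw [abs_of_nonneg hy]
    exact pos b hb hb' y hy
  · rw [abs_of_nonpos hy, ← abs_stInt_neg]
    exact pos b hb hb' (-y) (by linarith)

lemma integrable_comp_abs {f : ℝ → ℝ} (hf : IntegrableOn f (Set.Ioi 0)) :
    Integrable (fun x : ℝ => f |x|) := by
  rw [← integrableOn_univ, ← Set.Iic_union_Ioi (a := (0 : ℝ))]
  refine IntegrableOn.union ?_ ?_
  · rw [integrableOn_Iic_iff_integrableOn_Iio]
    have h := ((Measure.measurePreserving_neg (volume : Measure ℝ)).integrableOn_comp_preimage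
      (Homeomorph.neg ℝ).measurableEmbedding (f := f) (s := Set.Ioi 0)).2 hf
    have hs : (Neg.neg ⁻¹' Set.Ioi (0 : ℝ)) = Set.Iio 0 := by ext; simp
    rw [hs] at h
    refine h.congr_fun (fun x hx => ?_) measurableSet_Iio
    simp [abs_of_neg (Set.mem_Iio.1 hx)]
  · refine hf.congr_fun (fun x hx => ?_) measurableSet_Ioi
    simp [abs_of_pos (Set.mem_Ioi.1 hx)]

lemma integrable_exp_neg_rpow_abs {b τ : ℝ} (hb : 0 < b) (hτ : 0 < τ) :
    Integrable (fun u : ℝ => Real.exp (-(τ * |u|) ^ b)) := by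
  have h1 : IntegrableOn (fun u : ℝ => Real.exp (-u ^ b)) (Set.Ioi 0) := by
    have := integrableOn_sym 0 0 0 hb
    refine this.congr_fun (fun u hu => ?_) measurableSet_Ioi
    simp [sym]
  have h2 := (integrableOn_Ioi_comp_mul_left_iff (fun u : ℝ => Real.exp (-u ^ b)) 0 hτ).2
    (by simpa using h1)
  exact integrable_comp_abs h2

/-- The integrand in the definition of the stable density. -/
def fourierIntegrand (b τ y u : ℝ) : ℂ :=
  Complex.exp (-(Complex.I * u * y) - (((τ * |u|) ^ b : ℝ) : ℂ))

lemma fourierIntegrand_eq (b τ y u : ℝ) : fourierIntegrand b τ y u =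
    (Real.exp (-(τ * |u|) ^ b) * Real.cos (u * y) : ℝ)
      - (Real.exp (-(τ * |u|) ^ b) * Real.sin (u * y) : ℝ) * Complex.I := by
  have : -(Complex.I * u * y) - (((τ * |u|) ^ b : ℝ) : ℂ) =
      ((-(τ * |u|) ^ b : ℝ) : ℂ) + ((-(u * y) : ℝ) : ℂ) * Complex.I := by push_cast; ring
  rw [fourierIntegrand, this, Complex.exp_add, Complex.exp_mul_I, ← Complex.ofReal_exp,
    ← Complex.ofReal_cos, ← Complex.ofReal_sin, Real.cos_neg, Real.sin_neg]
  push_cast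
  ring

lemma measurable_fourierIntegrand (b τ y : ℝ) : Measurable (fourierIntegrand b τ y) := by
  unfold fourierIntegrand
  fun_prop

lemma integrable_fourierIntegrand {b τ : ℝ} (hb : 0 < b) (hτ : 0 < τ) (y : ℝ) :
    Integrable (fourierIntegrand b τ y) := by
  refine (integrable_exp_neg_rpow_abs hb hτ).mono'
    (measurable_fourierIntegrand b τ y).aestronglyMeasurable (ae_of_all _ fun u => ?_)
  rw [fourierIntegrand, Complex.norm_exp]
  simp

lemma density_eq_integral {b τ : ℝ} (hb : 0 < b) (hτ : 0 < τ) (y : ℝ) :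
    density b τ y = (1 / Real.pi) *
      ∫ u in Set.Ioi (0 : ℝ), Real.exp (-(τ * u) ^ b) * Real.cos (u * y) := by
  have h1 : (∫ u : ℝ, fourierIntegrand b τ y u).re
      = ∫ u : ℝ, Real.exp (-(τ * |u|) ^ b) * Real.cos (|u| * y) := by
    have := integral_re (integrable_fourierIntegrand hb hτ y)
    simp only [RCLike.re_to_complex] at this
    rw [← this]
    congr 1
    funext u
    rw [fourierIntegrand_eq]
    simp only [Complex.sub_re, Complex.ofReal_re, Complex.mul_re, Complex.ofReal_im,
      Complex.I_re, Complex.I_im]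
    rcases abs_choice u with h | h <;> rw [h] <;> simp
  have h2 := integral_comp_abs (f := fun u : ℝ => Real.exp (-(τ * u) ^ b) * Real.cos (u * y))
  have h3 : density b τ y = (1 / (2 * Real.pi)) * (∫ u : ℝ, fourierIntegrand b τ y u).re := rfl
  rw [h3, h1, h2, ← mul_assoc]
  congr 1
  have := Real.pi_pos
  field_simp

lemma stdDensity_eq {b : ℝ} (hb : 0 < b) (y : ℝ) :
    stdDensity b y = (1 / Real.pi) * stInt 0 0 0 b y := by
  rw [stdDensity, density_eq_integral hb one_pos]
  simp [stInt, sym]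

lemma density_eq {b τ : ℝ} (hb : 0 < b) (hτ : 0 < τ) (y : ℝ) :
    density b τ y = τ⁻¹ * stdDensity b (y / τ) := by
  have := integral_comp_mul_left_Ioi
    (fun u : ℝ => Real.exp (-(1 * u) ^ b) * Real.cos (u * (y / τ))) 0 hτ
  rw [density_eq_integral hb hτ, stdDensity, density_eq_integral hb one_pos]
  simp only [mul_zero, smul_eq_mul] at this
  rw [mul_left_comm, ← this]
  congr 2
  funext u
  rw [one_mul]
  congr 2
  field_simp

lemma integral_fourierIntegrand_im {b τ : ℝ} (hb : 0 < b) (hτ : 0 < τ) (y : ℝ) :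
    (∫ u : ℝ, fourierIntegrand b τ y u).im = 0 := by
  have h1 := integral_im (integrable_fourierIntegrand hb hτ y)
  simp only [RCLike.im_to_complex] at h1
  rw [← h1]
  have h2 : ∀ u : ℝ, (fourierIntegrand b τ y (-u)).im = -(fourierIntegrand b τ y u).im := by
    intro u
    simp only [fourierIntegrand_eq, Complex.sub_im, Complex.ofReal_im, Complex.mul_im,
      Complex.ofReal_re, Complex.I_re, Complex.I_im, abs_neg, neg_mul, Real.sin_neg]
    ring
  have h3 := integral_neg_eq_self (fun u => (fourierIntegrand b τ y u).im) volume
  simp only [h2, integral_neg] at h3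
  linarith

lemma integral_fourierIntegrand {b : ℝ} (hb : 0 < b) (y : ℝ) :
    ∫ u : ℝ, fourierIntegrand b 1 y u = ((2 * Real.pi * stdDensity b y : ℝ) : ℂ) := by
  apply Complex.ext
  · rw [Complex.ofReal_re]
    show _ = 2 * Real.pi * ((1 / (2 * Real.pi)) * (∫ u : ℝ, fourierIntegrand b 1 y u).re)
    have := Real.pi_pos
    field_simp
  · rw [integral_fourierIntegrand_im hb one_pos, Complex.ofReal_im]

lemma hasDerivAt_stdDensity {b : ℝ} (hb : 0 < b) (y : ℝ) :
    HasDerivAt (stdDensity b) ((1 / Real.pi) * stInt 0 0 1 b y) y := by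
  have : stdDensity b = fun y => (1 / Real.pi) * stInt 0 0 0 b y := funext (stdDensity_eq hb)
  rw [this]
  exact (hasDerivAt_stInt 0 0 0 hb y).const_mul _

lemma continuous_stdDensity {b : ℝ} (hb : 0 < b) : Continuous (stdDensity b) :=
  continuous_iff_continuousAt.2 fun y => (hasDerivAt_stdDensity hb y).continuousAt

lemma continuous_stInt (k p q : ℕ) {b : ℝ} (hb : 0 < b) : Continuous (stInt k p q b) :=
  continuous_iff_continuousAt.2 fun y => (hasDerivAt_stInt k p q hb y).continuousAt

lemma integrable_one_add_abs_rpow {r : ℝ} (hr : r < -1) :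
    Integrable (fun y : ℝ => (1 + |y|) ^ r) := by
  have := integrable_one_add_norm (E := ℝ) (μ := volume) (r := -r) (by simp; linarith)
  simpa using this

lemma integrable_stInt (k p : ℕ) (hkp : 1 ≤ p ∨ k = 0 ∧ p = 0) {b : ℝ} (hb : 0 < b) :
    Integrable (stInt k p 0 b) := by
  set κ := min (b / 2) 1 with hκ
  have h0 : 0 < κ := lt_min (by positivity) one_pos
  obtain ⟨C, hC, h⟩ := abs_stInt_le (b₁ := b) (b₂ := b) (κ := κ) h0
    ((min_le_left _ _).trans_lt (by linarith)) ((min_le_right _ _).trans_lt (by norm_num)) 0 k p hkp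
  refine ((integrable_one_add_abs_rpow (r := -1 - κ) (by linarith)).const_mul C).mono'
    (continuous_stInt k p 0 hb).aestronglyMeasurable (ae_of_all _ fun y => ?_)
  simpa using h b le_rfl le_rfl y

lemma integrable_stdDensity {b : ℝ} (hb : 0 < b) : Integrable (stdDensity b) := by
  have : stdDensity b = fun y => (1 / Real.pi) * stInt 0 0 0 b y := funext (stdDensity_eq hb)
  rw [this]
  exact (integrable_stInt 0 0 (Or.inr ⟨rfl, rfl⟩) hb).const_mul _

open FourierTransform in
/-- Fourier inversion for the stable density. -/
lemma integral_exp_mul_stdDensity {b : ℝ} (hb : 0 < b) (t : ℝ) :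
    ∫ y : ℝ, Complex.exp (t * y * Complex.I) * (stdDensity b y : ℂ) =
      Complex.exp (-((|t| ^ b : ℝ) : ℂ)) := by
  set f : ℝ → ℂ := fun u => Complex.exp (-((|u| ^ b : ℝ) : ℂ)) with hf
  have hfc : Continuous f := by
    have : Continuous (fun u : ℝ => |u| ^ b) := continuous_abs.rpow_const fun _ => Or.inr hb.le
    fun_prop
  have hfi : Integrable f := by
    have := integrable_fourierIntegrand hb one_pos 0
    refine this.congr (ae_of_all _ fun u => ?_)
    simp [fourierIntegrand, hf]
  have hF : 𝓕 f = fun w => ((2 * Real.pi * stdDensity b (2 * Real.pi * w) : ℝ) : ℂ) := by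
    funext w
    rw [Real.fourier_real_eq_integral_exp_smul, ← integral_fourierIntegrand hb]
    congr 1
    funext v
    rw [hf, fourierIntegrand, smul_eq_mul, ← Complex.exp_add]
    congr 1
    push_cast
    ring_nf
  have hFi : Integrable (𝓕 f) := by
    rw [hF]
    have h1 := (integrable_stdDensity hb).comp_mul_left' (R := 2 * Real.pi) (by positivity)
    exact (h1.const_mul (2 * Real.pi)).ofReal
  have key := congrFun (hfc.fourierInv_fourier_eq hfi hFi) t
  rw [Real.fourierInv_eq'] at key
  have h2 := Measure.integral_comp_mul_left
    (fun y : ℝ => Complex.exp (t * y * Complex.I) * (stdDensity b y : ℂ)) (2 * Real.pi)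
  have hpi : (0 : ℝ) < 2 * Real.pi := by positivity
  rw [abs_of_pos (inv_pos.2 hpi)] at h2
  have h3 : ∫ y : ℝ, Complex.exp (t * y * Complex.I) * (stdDensity b y : ℂ) =
      (2 * Real.pi) • ∫ x : ℝ, Complex.exp (t * ((2 * Real.pi * x : ℝ) : ℂ) * Complex.I) *
        (stdDensity b (2 * Real.pi * x) : ℂ) := by
    rw [h2, smul_smul, mul_inv_cancel₀ hpi.ne', one_smul]
  rw [h3, ← integral_smul]
  refine Eq.trans ?_ key
  congr 1
  funext x
  rw [hF]
  simp only [RCLike.inner_apply, conj_trivial, smul_eq_mul, Complex.real_smul]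
  push_cast
  ring_nf

lemma integral_stdDensity {b : ℝ} (hb : 0 < b) : ∫ y, stdDensity b y = 1 := by
  have := integral_exp_mul_stdDensity hb 0
  simp only [Complex.ofReal_zero, zero_mul, Complex.exp_zero, one_mul, abs_zero,
    Real.zero_rpow hb.ne', neg_zero] at this
  rw [integral_complex_ofReal] at this
  exact_mod_cast this

lemma charFun_withDensity {f : ℝ → ℝ} (hf : Measurable f) (hf0 : ∀ x, 0 ≤ f x) (t : ℝ) :
    charFun (volume.withDensity fun x => ENNReal.ofReal (f x)) t =
      ∫ y : ℝ, Complex.exp (t * y * Complex.I) * (f y : ℂ) := by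
  rw [charFun_apply_real, integral_withDensity_eq_integral_toReal_smul (by fun_prop) (by simp)]
  congr 1
  funext x
  rw [ENNReal.toReal_ofReal (hf0 x), Complex.real_smul, mul_comm]

lemma charFun_add_measure (μ ν : Measure ℝ) [IsFiniteMeasure μ] [IsFiniteMeasure ν] (t : ℝ) :
    charFun (μ + ν) t = charFun μ t + charFun ν t := by
  have h : ∀ (ρ : Measure ℝ) [IsFiniteMeasure ρ],
      Integrable (fun x : ℝ => Complex.exp (t * x * Complex.I)) ρ := by
    intro ρ _
    refine (integrable_const (1 : ℝ)).mono' (Measurable.aestronglyMeasurable (by fun_prop))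
      (ae_of_all _ fun x => ?_)
    rw [show (t * x * Complex.I : ℂ) = ((t * x : ℝ) : ℂ) * Complex.I by push_cast; ring,
      Complex.norm_exp_ofReal_mul_I]
  simp only [charFun_apply_real]
  exact integral_add_measure (h μ) (h ν)

/-- A probability measure with characteristic function `exp(-|t|^b)` has density `stdDensity b`,
which is therefore nonnegative. -/
lemma eq_withDensity_of_charFun {b : ℝ} (hb : 0 < b) (μ : Measure ℝ) [IsProbabilityMeasure μ]
    (hμ : ∀ t : ℝ, charFun μ t = Complex.exp (-((|t| ^ b : ℝ) : ℂ))) :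
    (∀ y, 0 ≤ stdDensity b y) ∧
      μ = volume.withDensity fun y => ENNReal.ofReal (stdDensity b y) := by
  set φ := stdDensity b with hφ
  have hc : Continuous φ := continuous_stdDensity hb
  have hi : Integrable φ := integrable_stdDensity hb
  set φp : ℝ → ℝ := fun y => max (φ y) 0
  set φm : ℝ → ℝ := fun y => max (-φ y) 0
  have hpc : Continuous φp := hc.max continuous_const
  have hmc : Continuous φm := hc.neg.max continuous_const
  have hpi : Integrable φp := hi.pos_part
  have hmi : Integrable φm := hi.neg_part
  set νp := volume.withDensity fun y => ENNReal.ofReal (φp y) with hνp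
  set νm := volume.withDensity fun y => ENNReal.ofReal (φm y) with hνm
  have : IsFiniteMeasure νp := isFiniteMeasure_withDensity_ofReal hpi.2
  have : IsFiniteMeasure νm := isFiniteMeasure_withDensity_ofReal hmi.2
  have hexp : ∀ {g : ℝ → ℝ}, Integrable g → ∀ t : ℝ,
      Integrable (fun y : ℝ => Complex.exp (t * y * Complex.I) * (g y : ℂ)) := by
    intro g hg t
    refine hg.norm.mono' ?_ (ae_of_all _ fun x => ?_)
    · exact (Measurable.aestronglyMeasurable (by fun_prop)).mul hg.ofReal.aestronglyMeasurable
    · rw [norm_mul, show (t * x * Complex.I : ℂ) = ((t * x : ℝ) : ℂ) * Complex.I by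
        push_cast; ring, Complex.norm_exp_ofReal_mul_I, one_mul, Complex.norm_real]
  have heq : μ + νm = νp := by
    apply Measure.ext_of_charFun
    funext t
    rw [charFun_add_measure, hμ, ← integral_exp_mul_stdDensity hb,
      charFun_withDensity hmc.measurable (fun _ => le_max_right _ _),
      charFun_withDensity hpc.measurable (fun _ => le_max_right _ _),
      ← integral_add (hexp hi t) (hexp hmi t)]
    congr 1
    funext y
    rw [← mul_add, ← Complex.ofReal_add]
    congr 2
    show φ y + max (-φ y) 0 = max (φ y) 0
    rcases le_total (φ y) 0 with h | h
    · rw [max_eq_left (by linarith), max_eq_right h]; ring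
    · rw [max_eq_right (by linarith), max_eq_left h]; ring
  have hnn : ∀ y, 0 ≤ φ y := by
    by_contra! hneg
    obtain ⟨y₀, hy₀⟩ := hneg
    set S := {y | φ y < 0} with hS
    have hSo : IsOpen S := isOpen_lt hc continuous_const
    have hSm : MeasurableSet S := hSo.measurableSet
    have h1 : νp S = 0 := by
      rw [hνp, withDensity_apply _ hSm, lintegral_eq_zero_iff (by fun_prop)]
      filter_upwards [ae_restrict_mem hSm] with y hy
      show ENNReal.ofReal (max (φ y) 0) = 0
      rw [max_eq_right (le_of_lt hy), ENNReal.ofReal_zero]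
    have h2 : νm S = 0 := by
      rw [← heq] at h1
      simp only [Measure.coe_add, Pi.add_apply, add_eq_zero] at h1
      exact h1.2
    rw [hνm, withDensity_apply _ hSm, lintegral_eq_zero_iff (by fun_prop)] at h2
    have h3 : ∀ᵐ y ∂(volume.restrict S), False := by
      filter_upwards [h2, ae_restrict_mem hSm] with y hy hy'
      have : ENNReal.ofReal (max (-φ y) 0) = 0 := hy
      rw [ENNReal.ofReal_eq_zero] at this
      have := (le_max_left _ _).trans this
      have hy'' : φ y < 0 := hy'
      linarith
    have h4 : volume S = 0 := by
      rw [ae_iff] at h3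
      simpa using h3
    exact (hSo.measure_pos volume ⟨y₀, hy₀⟩).ne' h4
  refine ⟨hnn, ?_⟩
  have hm0 : νm = 0 := by
    rw [hνm]
    have : (fun y => ENNReal.ofReal (φm y)) = 0 := by
      funext y
      show ENNReal.ofReal (max (-φ y) 0) = 0
      rw [max_eq_right (by linarith [hnn y]), ENNReal.ofReal_zero]
    rw [this, withDensity_zero]
  rw [hm0, add_zero] at heq
  rw [heq, hνp]
  congr 1
  funext y
  show ENNReal.ofReal (max (φ y) 0) = _
  rw [max_eq_left (hnn y)]

lemma eulerBound_rpow_mul_exp_neg {κ : ℝ} (hκ : -2 ≤ κ) (n : ℕ) :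
    ∀ s : ℝ, κ ≤ s → ∃ C : ℝ, 0 ≤ C ∧ EulerBound κ C n (fun u => u ^ s * Real.exp (-u)) := by
  have key : ∀ s : ℝ, κ ≤ s → ∃ C : ℝ, 0 ≤ C ∧ ∀ u : ℝ, 0 < u →
      |u ^ s * Real.exp (-u)| ≤ C * u ^ κ ∧ |u ^ s * Real.exp (-u)| ≤ C * u ^ (-2 : ℝ) := by
    intro s hs
    obtain ⟨C, hC, h⟩ := rpow_mul_exp_neg_rpow_le (s + 2) one_pos
    refine ⟨1 + C, by positivity, fun u hu => ?_⟩
    have hu0 : 0 < u ^ s := Real.rpow_pos_of_pos hu _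
    have hk0 : 0 < u ^ κ := Real.rpow_pos_of_pos hu _
    have h20 : 0 < u ^ (-2 : ℝ) := Real.rpow_pos_of_pos hu _
    rw [abs_of_nonneg (by positivity)]
    rcases le_total u 1 with h1 | h1
    · have a1 : u ^ s * Real.exp (-u) ≤ u ^ κ := by
        have : Real.exp (-u) ≤ 1 := Real.exp_le_one_iff.2 (by linarith)
        calc u ^ s * Real.exp (-u) ≤ u ^ s * 1 := by gcongr
          _ ≤ u ^ κ := by
            rw [mul_one]; exact Real.rpow_le_rpow_of_exponent_ge hu h1 hs
      have a2 : u ^ κ ≤ u ^ (-2 : ℝ) := Real.rpow_le_rpow_of_exponent_ge hu h1 hκ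
      constructor <;> nlinarith [mul_nonneg hC hk0.le, mul_nonneg hC h20.le]
    · have a1 : u ^ s * Real.exp (-u) ≤ C * u ^ (-2 : ℝ) := by
        have := h u h1 1 le_rfl
        rw [Real.rpow_one, Real.rpow_add hu] at this
        rw [Real.rpow_neg hu.le, ← div_eq_mul_inv, le_div_iff₀ (by positivity)]
        linarith
      have a2 : u ^ (-2 : ℝ) ≤ u ^ κ := Real.rpow_le_rpow_of_exponent_le h1 hκ
      have a3 : C * u ^ (-2 : ℝ) ≤ C * u ^ κ := by gcongr
      constructor <;> nlinarith
  induction n with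
  | zero => exact key
  | succ n ih =>
    intro s hs
    obtain ⟨C₀, hC₀, h₀⟩ := key s hs
    obtain ⟨C₁, hC₁, h₁⟩ := ih s hs
    obtain ⟨C₂, hC₂, h₂⟩ := ih (s + 1) (by linarith)
    have e1 := h₁.const_mul (a := s) (A := |s|) le_rfl
    have e2 := h₂.const_mul (a := -1) (A := 1) (by simp)
    have hle1 : C₀ ≤ C₀ + (|s| * C₁ + 1 * C₂) := by
      have : 0 ≤ |s| * C₁ + 1 * C₂ := by positivity
      linarith
    refine ⟨C₀ + (|s| * C₁ + 1 * C₂), by positivity, ?_, _, fun u hu => ?_,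
      (e1.add e2).mono (by linarith)⟩
    · exact EulerBound.bound (n := 0) (EulerBound.mono (n := 0) hle1 h₀)
    · have := (Real.hasDerivAt_rpow_const (p := s) (Or.inl hu.ne')).mul (hasDerivAt_neg u).exp
      convert! this using 1
      rw [Real.rpow_sub_one hu.ne', Real.rpow_add_one hu.ne']
      field_simp

/-- The difference `u^b (exp(-u) - exp(-u^b))`. -/
def expGap (b u : ℝ) : ℝ := u ^ b * (Real.exp (-u) - Real.exp (-u ^ b))

lemma hasDerivAt_expGap (b : ℝ) {u : ℝ} (hu : 0 < u) :
    HasDerivAt (expGap b) ((b * expGap b u + b * sym 0 2 0 b u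
      + -1 * (u ^ (b + 1) * Real.exp (-u))) / u) u := by
  have h1 : HasDerivAt (fun u : ℝ => Real.exp (-u ^ b)) (Real.exp (-u ^ b) * -(b * u ^ (b - 1))) u :=
    (Real.hasDerivAt_rpow_const (Or.inl hu.ne')).neg.exp
  have := (Real.hasDerivAt_rpow_const (p := b) (Or.inl hu.ne')).mul ((hasDerivAt_neg u).exp.sub h1)
  convert! this using 1
  simp only [expGap, sym, Pi.sub_apply]
  rw [Real.rpow_sub_one hu.ne', Real.rpow_add_one hu.ne',
    show ((2 : ℕ) : ℝ) * b + ((0 : ℕ) : ℝ) = b + b by push_cast; ring, Real.rpow_add hu]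
  field_simp
  ring

lemma eulerBound_expGap {b κ : ℝ} (hb : 0 < b) (hκ : -2 ≤ κ) (hκ1 : κ ≤ b + 1) (hκ2 : κ < 2 * b)
    (n : ℕ) : ∃ C : ℝ, 0 ≤ C ∧ EulerBound κ C n (expGap b) := by
  have key : ∃ C : ℝ, 0 ≤ C ∧ ∀ u : ℝ, 0 < u →
      |expGap b u| ≤ C * u ^ κ ∧ |expGap b u| ≤ C * u ^ (-2 : ℝ) := by
    obtain ⟨C₁, hC₁, h₁⟩ := rpow_mul_exp_neg_rpow_le (b + 2) one_pos
    obtain ⟨C₂, hC₂, h₂⟩ := rpow_mul_exp_neg_rpow_le (b + 2) hb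
    refine ⟨2 + (C₁ + C₂), by positivity, fun u hu => ?_⟩
    have hk0 : 0 < u ^ κ := Real.rpow_pos_of_pos hu _
    have h20 : 0 < u ^ (-2 : ℝ) := Real.rpow_pos_of_pos hu _
    have hb0 : 0 < u ^ b := Real.rpow_pos_of_pos hu _
    rw [expGap, abs_mul, abs_of_pos hb0]
    rcases le_total u 1 with h1 | h1
    · have a0 : |Real.exp (-u) - Real.exp (-u ^ b)| ≤ u + u ^ b := by
        have e1 : Real.exp (-u) ≤ 1 := Real.exp_le_one_iff.2 (by linarith)
        have e2 : Real.exp (-u ^ b) ≤ 1 := Real.exp_le_one_iff.2 (by linarith)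
        have e3 := Real.add_one_le_exp (-u)
        have e4 := Real.add_one_le_exp (-u ^ b)
        rw [abs_le]
        constructor <;> linarith
      have a1 : u ^ b * |Real.exp (-u) - Real.exp (-u ^ b)| ≤ 2 * u ^ κ := by
        calc u ^ b * |Real.exp (-u) - Real.exp (-u ^ b)| ≤ u ^ b * (u + u ^ b) := by gcongr
          _ = u ^ (b + 1) + u ^ (2 * b) := by
            rw [Real.rpow_add_one hu.ne', two_mul, Real.rpow_add hu]; ring
          _ ≤ u ^ κ + u ^ κ := add_le_add (Real.rpow_le_rpow_of_exponent_ge hu h1 hκ1)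
            (Real.rpow_le_rpow_of_exponent_ge hu h1 hκ2.le)
          _ = 2 * u ^ κ := by ring
      have a2 : u ^ κ ≤ u ^ (-2 : ℝ) := Real.rpow_le_rpow_of_exponent_ge hu h1 hκ
      constructor <;> nlinarith [mul_nonneg hC₁ hk0.le, mul_nonneg hC₁ h20.le,
        mul_nonneg hC₂ hk0.le, mul_nonneg hC₂ h20.le]
    · have a1 : u ^ b * |Real.exp (-u) - Real.exp (-u ^ b)| ≤ (C₁ + C₂) * u ^ (-2 : ℝ) := by
        have q1 := h₁ u h1 1 le_rfl
        have q2 := h₂ u h1 b le_rfl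
        rw [Real.rpow_one, Real.rpow_add hu] at q1
        rw [Real.rpow_add hu] at q2
        rw [Real.rpow_neg hu.le, ← div_eq_mul_inv, le_div_iff₀ (by positivity)]
        have q3 : |Real.exp (-u) - Real.exp (-u ^ b)| ≤ Real.exp (-u) + Real.exp (-u ^ b) := by
          refine (abs_sub _ _).trans ?_
          rw [abs_of_pos (Real.exp_pos _), abs_of_pos (Real.exp_pos _)]
        calc u ^ b * |Real.exp (-u) - Real.exp (-u ^ b)| * u ^ (2 : ℝ)
            ≤ u ^ b * (Real.exp (-u) + Real.exp (-u ^ b)) * u ^ (2 : ℝ) := by gcongr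
          _ ≤ C₁ + C₂ := by linarith
      have a2 : u ^ (-2 : ℝ) ≤ u ^ κ := Real.rpow_le_rpow_of_exponent_le h1 hκ
      have a3 : (C₁ + C₂) * u ^ (-2 : ℝ) ≤ (C₁ + C₂) * u ^ κ := by gcongr
      constructor <;> linarith
  induction n with
  | zero => exact key
  | succ n ih =>
    obtain ⟨C₀, hC₀, h₀⟩ := key
    obtain ⟨C₁, hC₁, h₁⟩ := ih
    obtain ⟨C₂, hC₂, h₂⟩ := eulerBound_sym (b₁ := b) (b₂ := b) (κ := κ) hb hκ n 0 2
      (by push_cast; exact hκ2)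
    obtain ⟨C₃, hC₃, h₃⟩ := eulerBound_rpow_mul_exp_neg hκ n (b + 1) hκ1
    have e1 := h₁.const_mul (a := b) (A := |b|) le_rfl
    have e2 := (h₂ b le_rfl le_rfl).const_mul (a := b) (A := |b|) le_rfl
    have e3 := h₃.const_mul (a := -1) (A := 1) (by simp)
    have hle : C₀ ≤ C₀ + (|b| * C₁ + |b| * C₂ + 1 * C₃) := by
      have : 0 ≤ |b| * C₁ + |b| * C₂ + 1 * C₃ := by positivity
      linarith
    refine ⟨C₀ + (|b| * C₁ + |b| * C₂ + 1 * C₃), by positivity, ?_, _,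
      fun u hu => hasDerivAt_expGap b hu, ((e1.add e2).add e3).mono (by linarith)⟩
    exact EulerBound.bound (n := 0) (EulerBound.mono (n := 0) hle h₀)

/-- The remainder of `exp(-u^b)` after subtraction of a model with explicit cosine transform. -/
def modelRemainder (b u : ℝ) : ℝ := Real.exp (-u ^ b) - Real.exp (-u) * (1 + u - u ^ b)

lemma integrableOn_rpow_mul_exp_neg {s : ℝ} (hs : -1 < s) :
    IntegrableOn (fun u : ℝ => u ^ s * Real.exp (-u)) (Set.Ioi 0) := by
  have := integrableOn_rpow_mul_exp_neg_rpow hs one_pos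
  simpa using this

lemma modelRemainder_eq (b u : ℝ) : modelRemainder b u = sym 0 0 0 b u -
    (u ^ (0 : ℝ) * Real.exp (-u) + u ^ (1 : ℝ) * Real.exp (-u) - u ^ b * Real.exp (-u)) := by
  simp [modelRemainder, sym]
  ring

lemma exists_abs_integral_modelRemainder_le {b : ℝ} (hb : 0 < b) (hb2 : b < 2) :
    ∃ κ C : ℝ, b < κ ∧ 0 ≤ C ∧ ∀ y, 0 < y →
      |∫ u in Set.Ioi (0 : ℝ), modelRemainder b u * Real.cos (u * y)| ≤ C * y ^ (-1 - κ) := by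
  obtain ⟨κ, hκb, hκ⟩ := exists_between (lt_min (lt_min (by linarith : b < 2 * b)
    (by linarith : b < b + 1)) hb2)
  have hκ2 : κ < 2 := hκ.trans_le (min_le_right _ _)
  have hκ2b : κ < 2 * b := hκ.trans_le ((min_le_left _ _).trans (min_le_left _ _))
  have hκb1 : κ < b + 1 := hκ.trans_le ((min_le_left _ _).trans (min_le_right _ _))
  obtain ⟨C₁, hC₁, h₁⟩ := eulerBound_expGap hb (by linarith) hκb1.le hκ2b 3
  obtain ⟨C₂, hC₂, h₂⟩ := eulerBound_rpow_mul_exp_neg (κ := κ) (by linarith) 3 2 hκ2.le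
  obtain ⟨C₃, hC₃, h₃⟩ := eulerBound_rpow_mul_exp_neg (κ := κ) (by linarith) 3 (b + 1) hκb1.le
  have e1 := h₁.const_mul (a := b) (A := |b|) le_rfl
  have e3 := h₃.const_mul (a := -1) (A := 1) (by simp)
  have hd := (e1.add h₂).add e3
  have hgd : ∀ u, 0 < u → HasDerivAt (modelRemainder b) ((b * expGap b u + u ^ (2 : ℝ) *
      Real.exp (-u) + -1 * (u ^ (b + 1) * Real.exp (-u))) / u) u := by
    intro u hu
    have q1 : HasDerivAt (fun u : ℝ => Real.exp (-u ^ b))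
        (Real.exp (-u ^ b) * -(b * u ^ (b - 1))) u :=
      (Real.hasDerivAt_rpow_const (Or.inl hu.ne')).neg.exp
    have q2 : HasDerivAt (fun u : ℝ => 1 + u - u ^ b) (1 - b * u ^ (b - 1)) u :=
      ((hasDerivAt_id u).const_add 1).sub (Real.hasDerivAt_rpow_const (Or.inl hu.ne'))
    have := q1.sub ((hasDerivAt_neg u).exp.mul q2)
    convert! this using 1
    simp only [expGap]
    rw [Real.rpow_sub_one hu.ne', Real.rpow_add_one hu.ne', Real.rpow_two]
    field_simp
    ring
  have hi : IntegrableOn (modelRemainder b) (Set.Ioi 0) := by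
    have := (integrableOn_sym 0 0 0 hb).sub
      (((integrableOn_rpow_mul_exp_neg (s := 0) (by norm_num)).add
      (integrableOn_rpow_mul_exp_neg (s := 1) (by norm_num))).sub
      (integrableOn_rpow_mul_exp_neg (s := b) (by linarith)))
    exact this.congr_fun (fun u _ => (modelRemainder_eq b u).symm) measurableSet_Ioi
  have hlim : ∀ s : ℝ, Tendsto (fun u : ℝ => u ^ s * Real.exp (-u)) atTop (𝓝 0) :=
    fun s => tendsto_rpow_mul_exp_neg_mul_atTop_nhds_zero s 1 one_pos |>.congr (by simp)
  have hinf : Tendsto (modelRemainder b) atTop (𝓝 0) := by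
    have := (tendsto_sym_atTop 0 0 0 hb).sub (((hlim 0).add (hlim 1)).sub (hlim b))
    simp only [add_zero, sub_zero] at this
    exact this.congr fun u => (modelRemainder_eq b u).symm
  have hB : ∃ B, ∀ u, 0 < u → |modelRemainder b u| ≤ B := by
    obtain ⟨c0, _, q0⟩ := eulerBound_rpow_mul_exp_neg (κ := 0) (by linarith) 0 0 le_rfl
    obtain ⟨c1, _, q1⟩ := eulerBound_rpow_mul_exp_neg (κ := 0) (by linarith) 0 1 (by norm_num)
    obtain ⟨c2, _, q2⟩ := eulerBound_rpow_mul_exp_neg (κ := 0) (by linarith) 0 b hb.le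
    refine ⟨1 + (c0 + c1 + c2), fun u hu => ?_⟩
    have a0 := (q0 u hu).1
    have a1 := (q1 u hu).1
    have a2 := (q2 u hu).1
    simp only [Real.rpow_zero u, mul_one] at a0 a1 a2
    have a3 : |sym 0 0 0 b u| ≤ 1 := by
      rw [abs_sym 0 0 0 b hu]
      have := Real.rpow_nonneg hu.le b
      simpa using this
    rw [modelRemainder_eq b u, Real.rpow_zero]
    rw [abs_le] at *
    constructor <;> linarith [a0.1, a0.2, a1.1, a1.2, a2.1, a2.2, a3.1, a3.2]
  obtain ⟨B, hB⟩ := hB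
  have hC : 0 ≤ |b| * C₁ + C₂ + 1 * C₃ := by positivity
  exact ⟨κ, (|b| * C₁ + C₂ + 1 * C₃) * decayConst κ, hκb,
    mul_nonneg hC (decayConst_pos (hb.trans hκb) hκ2).le, fun y hy =>
    abs_integral_mul_cos_le (hb.trans hκb) hκ2 hC hgd hd hB hi hinf hy⟩

/-- `∫₀^∞ u^s exp(-u + iuy) du`. -/
def gammaFourier (s y : ℝ) : ℂ :=
  ∫ u in Set.Ioi (0 : ℝ), ((u ^ s * Real.exp (-u) : ℝ) : ℂ) * Complex.exp (u * y * Complex.I)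

lemma norm_exp_mul_mul_I (u y : ℝ) : ‖Complex.exp (u * y * Complex.I)‖ = 1 := by
  rw [show (u * y * Complex.I : ℂ) = ((u * y : ℝ) : ℂ) * Complex.I by push_cast; ring,
    Complex.norm_exp_ofReal_mul_I]

lemma integrableOn_gammaFourier {s : ℝ} (hs : -1 < s) (y : ℝ) :
    IntegrableOn (fun u : ℝ => ((u ^ s * Real.exp (-u) : ℝ) : ℂ) *
      Complex.exp (u * y * Complex.I)) (Set.Ioi 0) := by
  refine (integrableOn_rpow_mul_exp_neg hs).norm.mono'
    (Measurable.aestronglyMeasurable (by fun_prop)) (ae_of_all _ fun u => ?_)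
  rw [norm_mul, norm_exp_mul_mul_I, mul_one, Complex.norm_real]

lemma hasDerivAt_gammaFourier {s : ℝ} (hs : -1 < s) (y : ℝ) :
    HasDerivAt (gammaFourier s) (Complex.I * gammaFourier (s + 1) y) y := by
  have := (hasDerivAt_integral_of_dominated_loc_of_deriv_le
    (μ := volume.restrict (Set.Ioi (0 : ℝ)))
    (F := fun (y u : ℝ) => ((u ^ s * Real.exp (-u) : ℝ) : ℂ) * Complex.exp (u * y * Complex.I))
    (F' := fun (y u : ℝ) => Complex.I * (((u ^ (s + 1) * Real.exp (-u) : ℝ) : ℂ) *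
      Complex.exp (u * y * Complex.I)))
    (bound := fun u => ‖u ^ (s + 1) * Real.exp (-u)‖) (x₀ := y) (Filter.univ_mem) ?_ ?_ ?_ ?_ ?_ ?_).2
  · rw [integral_const_mul] at this
    exact this
  · exact .of_forall fun x => Measurable.aestronglyMeasurable (by fun_prop)
  · exact integrableOn_gammaFourier hs y
  · exact Measurable.aestronglyMeasurable (by fun_prop)
  · refine ae_of_all _ fun u x _ => ?_
    rw [norm_mul, norm_mul, norm_exp_mul_mul_I, Complex.norm_I, one_mul, mul_one, Complex.norm_real]
  · exact (integrableOn_rpow_mul_exp_neg (by linarith)).norm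
  · filter_upwards [ae_restrict_mem measurableSet_Ioi] with u hu x _
    have h1 : HasDerivAt (fun y : ℝ => (u * y * Complex.I : ℂ)) (u * 1 * Complex.I) x :=
      ((hasDerivAt_id x).ofReal_comp.const_mul (u : ℂ)).mul_const _
    have h2 := (h1.cexp).const_mul ((u ^ s * Real.exp (-u) : ℝ) : ℂ)
    convert! h2 using 1
    rw [Real.rpow_add_one (ne_of_gt hu)]
    push_cast
    ring

lemma gammaFourier_succ {s : ℝ} (hs : -1 < s) (y : ℝ) :
    (1 - y * Complex.I) * gammaFourier (s + 1) y = (s + 1) * gammaFourier s y := by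
  set f : ℝ → ℂ := fun u => ((u ^ (s + 1) * Real.exp (-u) : ℝ) : ℂ) *
    Complex.exp (u * y * Complex.I) with hf
  have hderiv : ∀ u ∈ Set.Ioi (0 : ℝ), HasDerivAt f
      ((s + 1) * (((u ^ s * Real.exp (-u) : ℝ) : ℂ) * Complex.exp (u * y * Complex.I))
        - (1 - y * Complex.I) * (((u ^ (s + 1) * Real.exp (-u) : ℝ) : ℂ) *
          Complex.exp (u * y * Complex.I))) u := by
    intro u hu
    have h1 := ((Real.hasDerivAt_rpow_const (p := s + 1) (Or.inl (ne_of_gt hu))).mul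
      (hasDerivAt_neg u).exp).ofReal_comp
    have h2 : HasDerivAt (fun u : ℝ => (u * y * Complex.I : ℂ)) (1 * y * Complex.I) u :=
      ((hasDerivAt_id u).ofReal_comp.mul_const (y : ℂ)).mul_const _
    have h3 := h1.mul h2.cexp
    convert! h3 using 1
    simp only [Pi.mul_apply]
    rw [add_sub_cancel_right]
    push_cast
    ring
  have hnorm : ∀ u, ‖f u‖ = ‖u ^ (s + 1) * Real.exp (-u)‖ := by
    intro u
    rw [hf]
    simp only
    rw [norm_mul, norm_exp_mul_mul_I, mul_one, Complex.norm_real]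
  have h0 : f 0 = 0 := by simp [hf, Real.zero_rpow (by linarith : s + 1 ≠ 0)]
  have hcont : ContinuousWithinAt f (Set.Ici 0) 0 := by
    have : Continuous f := by
      have : Continuous (fun u : ℝ => u ^ (s + 1)) :=
        continuous_id.rpow_const fun _ => Or.inr (by linarith)
      fun_prop
    exact this.continuousWithinAt
  have hinf : Tendsto f atTop (𝓝 0) := by
    rw [tendsto_zero_iff_norm_tendsto_zero]
    simp only [hnorm]
    rw [← tendsto_zero_iff_norm_tendsto_zero]
    exact tendsto_rpow_mul_exp_neg_mul_atTop_nhds_zero (s + 1) 1 one_pos |>.congr (by simp)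
  have i1 := (integrableOn_gammaFourier hs y).const_mul ((s : ℂ) + 1)
  have i2 := (integrableOn_gammaFourier (s := s + 1) (by linarith) y).const_mul
    (1 - y * Complex.I : ℂ)
  have key := integral_Ioi_of_hasDerivAt_of_tendsto hcont hderiv (i1.sub i2) hinf
  rw [integral_sub i1 i2, integral_const_mul, integral_const_mul, h0, sub_zero, sub_eq_zero] at key
  exact key.symm

lemma one_sub_mul_I_mem_slitPlane (y : ℝ) : (1 - y * Complex.I : ℂ) ∈ Complex.slitPlane := by
  left
  simp

lemma gammaFourier_eq {s : ℝ} (hs : -1 < s) (y : ℝ) :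
    gammaFourier s y = Real.Gamma (s + 1) * Complex.exp (-(s + 1) *
      Complex.log (1 - y * Complex.I)) := by
  set G : ℝ → ℂ := fun y => Complex.exp ((s + 1) * Complex.log (1 - y * Complex.I)) *
    gammaFourier s y with hG
  have hd : ∀ y, HasDerivAt G 0 y := by
    intro y
    have h1 : HasDerivAt (fun y : ℝ => (1 - y * Complex.I : ℂ)) (-(1 * Complex.I)) y :=
      ((hasDerivAt_id y).ofReal_comp.mul_const Complex.I).const_sub 1
    have h2 := ((h1.clog_real (one_sub_mul_I_mem_slitPlane y)).const_mul ((s : ℂ) + 1)).cexp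
    have h3 := h2.mul (hasDerivAt_gammaFourier hs y)
    convert! h3 using 1
    have hne : (1 - y * Complex.I : ℂ) ≠ 0 :=
      Complex.slitPlane_ne_zero (one_sub_mul_I_mem_slitPlane y)
    have h4 := gammaFourier_succ hs y
    have h5 : gammaFourier (s + 1) y = (s + 1) * gammaFourier s y / (1 - y * Complex.I) := by
      rw [eq_div_iff hne, mul_comm, h4]
    rw [h5]
    field_simp
    ring
  have hconst : G y = G 0 :=
    is_const_of_deriv_eq_zero (fun y => (hd y).differentiableAt) (fun y => (hd y).deriv) y 0
  have h0 : G 0 = Real.Gamma (s + 1) := by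
    simp only [hG, Complex.ofReal_zero, zero_mul, sub_zero, Complex.log_one, mul_zero,
      Complex.exp_zero, one_mul]
    rw [gammaFourier, Real.Gamma_eq_integral (by linarith)]
    simp only [Complex.ofReal_zero, mul_zero, zero_mul, Complex.exp_zero, mul_one]
    rw [integral_complex_ofReal]
    congr 2
    funext u
    rw [add_sub_cancel_right, mul_comm]
  rw [h0] at hconst
  rw [← hconst, hG]
  simp only
  rw [mul_comm (Complex.exp _) (gammaFourier s y), mul_assoc, ← Complex.exp_add,
    neg_mul, add_neg_cancel, Complex.exp_zero, mul_one]

lemma gammaFourier_re {s : ℝ} (hs : -1 < s) (y : ℝ) : (gammaFourier s y).re =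
    ∫ u in Set.Ioi (0 : ℝ), u ^ s * Real.exp (-u) * Real.cos (u * y) := by
  have := integral_re (integrableOn_gammaFourier hs y)
  simp only [RCLike.re_to_complex] at this
  rw [gammaFourier, ← this]
  congr 1
  funext u
  rw [Complex.re_ofReal_mul, show (u * y * Complex.I : ℂ) = ((u * y : ℝ) : ℂ) * Complex.I by
    push_cast; ring, Complex.exp_ofReal_mul_I_re]

lemma gammaFourier_zero_add_one_re_nonneg (y : ℝ) :
    0 ≤ (gammaFourier 0 y).re + (gammaFourier 1 y).re := by
  have hne : (1 - y * Complex.I : ℂ) ≠ 0 :=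
    Complex.slitPlane_ne_zero (one_sub_mul_I_mem_slitPlane y)
  have h0 : gammaFourier 0 y = (1 - y * Complex.I)⁻¹ := by
    rw [gammaFourier_eq (by norm_num)]
    simp only [zero_add, Real.Gamma_one, Complex.ofReal_one, one_mul, Complex.ofReal_zero, neg_mul,
      Complex.exp_neg, Complex.exp_log hne]
  have h1 : gammaFourier 1 y = (1 - y * Complex.I)⁻¹ ^ 2 := by
    rw [gammaFourier_eq (by norm_num)]
    rw [show (1 : ℝ) + 1 = 2 by norm_num, Real.Gamma_two,
      show -(((1 : ℝ) : ℂ) + 1) * Complex.log (1 - y * Complex.I) =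
        -(2 * Complex.log (1 - y * Complex.I)) by push_cast; ring,
      Complex.exp_neg, two_mul, Complex.exp_add, Complex.exp_log hne]
    simp only [Complex.ofReal_one, one_mul]
    rw [inv_pow, sq]
  have h2 : (1 - y * Complex.I : ℂ)⁻¹ = (((1 + y ^ 2)⁻¹ : ℝ) : ℂ) * (1 + y * Complex.I) := by
    have h3 : (1 - y * Complex.I : ℂ) * (1 + y * Complex.I) = ((1 + y ^ 2 : ℝ) : ℂ) := by
      push_cast
      linear_combination (-(y : ℂ) ^ 2) * Complex.I_sq
    have hpos : (1 + y ^ 2 : ℝ) ≠ 0 := by positivity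
    have hpos' : ((1 + y ^ 2 : ℝ) : ℂ) ≠ 0 := by exact_mod_cast hpos
    rw [inv_eq_iff_eq_inv, eq_comm, inv_eq_of_mul_eq_one_left]
    rw [mul_left_comm, h3, Complex.ofReal_inv, inv_mul_cancel₀ hpos']
  have hpos : 0 < (1 + y ^ 2 : ℝ) := by positivity
  rw [h0, h1, h2, mul_pow, ← Complex.ofReal_pow, Complex.re_ofReal_mul, Complex.re_ofReal_mul]
  have r1 : (1 + y * Complex.I : ℂ).re = 1 := by simp
  have r2 : ((1 + y * Complex.I : ℂ) ^ 2).re = 1 - y ^ 2 := by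
    rw [sq, Complex.mul_re]
    simp
    ring
  rw [r1, r2]
  have : (1 + y ^ 2)⁻¹ * 1 + ((1 + y ^ 2)⁻¹) ^ 2 * (1 - y ^ 2) = 2 * ((1 + y ^ 2)⁻¹) ^ 2 := by
    field_simp
    ring
  rw [this]
  positivity

lemma tendsto_rpow_mul_gammaFourier {b : ℝ} (hb : 0 < b) :
    Tendsto (fun y : ℝ => y ^ (1 + b) * (gammaFourier b y).re) atTop
      (𝓝 (Real.Gamma (b + 1) * Real.cos ((b + 1) * (Real.pi / 2)))) := by
  have h1 : Tendsto (fun y : ℝ => ((Real.Gamma (b + 1) : ℂ) * Complex.exp (-(b + 1) *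
      Complex.log ((y⁻¹ : ℝ) - Complex.I))).re) atTop
      (𝓝 ((Real.Gamma (b + 1) : ℂ) * Complex.exp (-(b + 1) * Complex.log (-Complex.I))).re) := by
    have hI : (-Complex.I) ∈ Complex.slitPlane := by
      right; simp
    have t1 : Tendsto (fun y : ℝ => ((y⁻¹ : ℝ) : ℂ) - Complex.I) atTop (𝓝 (-Complex.I)) := by
      have t0 : Tendsto (fun y : ℝ => ((y⁻¹ : ℝ) : ℂ)) atTop (𝓝 ((0 : ℝ) : ℂ)) :=
        (Complex.continuous_ofReal.tendsto 0).comp tendsto_inv_atTop_zero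
      simpa using t0.sub_const Complex.I
    have t2 := t1.clog hI
    exact (Complex.continuous_re.tendsto _).comp
      (((t2.const_mul (-((b : ℂ) + 1))).cexp).const_mul _)
  have hlim : ((Real.Gamma (b + 1) : ℂ) * Complex.exp (-(b + 1) * Complex.log (-Complex.I))).re
      = Real.Gamma (b + 1) * Real.cos ((b + 1) * (Real.pi / 2)) := by
    rw [Complex.re_ofReal_mul, Complex.log_neg_I,
      show -((b : ℂ) + 1) * (-(Real.pi / 2) * Complex.I) =
        (((b + 1) * (Real.pi / 2) : ℝ) : ℂ) * Complex.I by push_cast; ring,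
      Complex.exp_ofReal_mul_I_re]
  rw [hlim] at h1
  refine h1.congr' ?_
  filter_upwards [eventually_gt_atTop 0] with y hy
  have hne : ((y⁻¹ : ℝ) : ℂ) - Complex.I ≠ 0 := by
    intro h
    have := congrArg Complex.im h
    simp at this
  have h2 : (1 - y * Complex.I : ℂ) = (y : ℂ) * (((y⁻¹ : ℝ) : ℂ) - Complex.I) := by
    rw [mul_sub, ← Complex.ofReal_mul, mul_inv_cancel₀ hy.ne', Complex.ofReal_one]
  rw [gammaFourier_eq (by linarith), ← Complex.re_ofReal_mul, h2, Complex.log_ofReal_mul hy hne,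
    mul_add, Complex.exp_add]
  congr 1
  have h3 : ((y ^ (1 + b) : ℝ) : ℂ) * Complex.exp (-(b + 1) * (Real.log y : ℂ)) = 1 := by
    rw [Real.rpow_def_of_pos hy, Complex.ofReal_exp, ← Complex.exp_add]
    rw [show (((Real.log y * (1 + b) : ℝ) : ℂ) + -((b : ℂ) + 1) * (Real.log y : ℂ)) = 0 by
      push_cast; ring, Complex.exp_zero]
  linear_combination (-(Real.Gamma (b + 1) : ℂ) * Complex.exp (-(b + 1) *
      Complex.log ((y⁻¹ : ℝ) - Complex.I))) * h3

/-- Lower bound for the tail of the stable density. -/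
lemma exists_tail_lower_bound {b : ℝ} (hb : 0 < b) (hb2 : b < 2) :
    ∃ c Y : ℝ, 0 < c ∧ 0 < Y ∧ ∀ y, Y ≤ y → c * y ^ (-1 - b) ≤ stInt 0 0 0 b y := by
  obtain ⟨κ, C, hκ, hC, hrem⟩ := exists_abs_integral_modelRemainder_le hb hb2
  have hdecomp : ∀ y, stInt 0 0 0 b y =
      (∫ u in Set.Ioi (0 : ℝ), modelRemainder b u * Real.cos (u * y)) +
        ((gammaFourier 0 y).re + (gammaFourier 1 y).re - (gammaFourier b y).re) := by
    intro y
    have hcos : ∀ {f : ℝ → ℝ}, IntegrableOn f (Set.Ioi 0) →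
        IntegrableOn (fun u => f u * Real.cos (u * y)) (Set.Ioi 0) := by
      intro f hf
      refine hf.norm.mono' (hf.aestronglyMeasurable.mul
        (Measurable.aestronglyMeasurable (by fun_prop))) (ae_of_all _ fun u => ?_)
      rw [norm_mul]
      exact mul_le_of_le_one_right (norm_nonneg _) (Real.abs_cos_le_one _)
    have i0 := hcos (integrableOn_rpow_mul_exp_neg (s := 0) (by norm_num))
    have i1 := hcos (integrableOn_rpow_mul_exp_neg (s := 1) (by norm_num))
    have ib := hcos (integrableOn_rpow_mul_exp_neg (s := b) (by linarith))
    have is := hcos (integrableOn_sym 0 0 0 hb)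
    have hmod : (fun u => modelRemainder b u * Real.cos (u * y)) =
        (fun u => sym 0 0 0 b u * Real.cos (u * y)) -
          (((fun u => u ^ (0 : ℝ) * Real.exp (-u) * Real.cos (u * y)) +
            fun u => u ^ (1 : ℝ) * Real.exp (-u) * Real.cos (u * y)) -
            fun u => u ^ b * Real.exp (-u) * Real.cos (u * y)) := by
      funext u
      simp only [Pi.sub_apply, Pi.add_apply]
      rw [modelRemainder_eq]
      ring
    have i01 := i0.add i1
    have i01b := i01.sub ib
    rw [hmod, integral_sub' is i01b, integral_sub' i01 ib, integral_add' i0 i1,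
      gammaFourier_re (by norm_num), gammaFourier_re (by norm_num), gammaFourier_re (by linarith)]
    simp only [stInt]
    simp
  set L := -(Real.Gamma (b + 1) * Real.cos ((b + 1) * (Real.pi / 2))) with hL
  have hLpos : 0 < L := by
    have hG : 0 < Real.Gamma (b + 1) := Real.Gamma_pos_of_pos (by linarith)
    have hpi := Real.pi_pos
    have hcos : Real.cos ((b + 1) * (Real.pi / 2)) < 0 :=
      Real.cos_neg_of_pi_div_two_lt_of_lt (by nlinarith) (by nlinarith)
    rw [hL]
    nlinarith
  have t1 := (tendsto_rpow_mul_gammaFourier hb).neg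
  have t2 : Tendsto (fun y : ℝ => C * y ^ (b - κ)) atTop (𝓝 0) := by
    have := (tendsto_rpow_neg_atTop (y := κ - b) (by linarith)).const_mul C
    simpa using this
  have t3 := (t1.sub t2)
  rw [sub_zero, ← hL] at t3
  obtain ⟨Y, hY⟩ := eventually_atTop.1 (t3.eventually (lt_mem_nhds (half_lt_self hLpos)))
  refine ⟨L / 2, max Y 1, by positivity, by positivity, fun y hy => ?_⟩
  have hy0 : 0 < y := lt_of_lt_of_le one_pos ((le_max_right _ _).trans hy)
  have h1 := hY y ((le_max_left _ _).trans hy)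
  have h2 := (abs_le.1 (hrem y hy0)).1
  have h3 := gammaFourier_zero_add_one_re_nonneg y
  rw [hdecomp]
  have hpow : 0 < y ^ (-1 - b) := Real.rpow_pos_of_pos hy0 _
  have h4 : L / 2 * y ^ (-1 - b) ≤ (-(y ^ (1 + b) * (gammaFourier b y).re) -
      C * y ^ (b - κ)) * y ^ (-1 - b) := mul_le_mul_of_nonneg_right h1.le hpow.le
  have h5 : y ^ (1 + b) * y ^ (-1 - b) = 1 := by
    rw [← Real.rpow_add hy0]; norm_num
  have h6 : y ^ (b - κ) * y ^ (-1 - b) = y ^ (-1 - κ) := by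
    rw [← Real.rpow_add hy0]; congr 1; ring
  have h7 : (-(y ^ (1 + b) * (gammaFourier b y).re) - C * y ^ (b - κ)) * y ^ (-1 - b) =
      -(gammaFourier b y).re - C * y ^ (-1 - κ) := by
    linear_combination (-(gammaFourier b y).re) * h5 - C * h6
  linarith

lemma stdDensity_neg {b : ℝ} (hb : 0 < b) (y : ℝ) : stdDensity b (-y) = stdDensity b y := by
  rw [stdDensity_eq hb, stdDensity_eq hb, stInt_neg]
  simp

lemma stdDensity_le {b : ℝ} (hb : 0 < b) : ∃ C, ∀ y, |stdDensity b y| ≤ C := by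
  obtain ⟨C, hC, h⟩ := abs_stInt_bounded 0 0 0 (b₁ := b) (b₂ := b) hb
  refine ⟨1 / Real.pi * C, fun y => ?_⟩
  rw [stdDensity_eq hb, abs_mul, abs_of_pos (by positivity)]
  have := h b le_rfl le_rfl y
  gcongr

/-- The convolution identity expressing stability. -/
lemma stdDensity_eq_integral {b : ℝ} (hb : 0 < b) (μ : Measure ℝ) [IsProbabilityMeasure μ]
    (hμ : ∀ t : ℝ, charFun μ t = Complex.exp (-((|t| ^ b : ℝ) : ℂ))) {s : ℝ} (hs : 0 < s)
    (hs2 : s ^ b + s ^ b = 1) (y : ℝ) :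
    stdDensity b y = ∫ x, density b s (y - s * x) ∂μ := by
  set f : ℝ → ℝ → ℂ := fun u x => fourierIntegrand b s (y - s * x) u with hf
  have hfm : Measurable (Function.uncurry f) := by
    simp only [hf, fourierIntegrand, Function.uncurry_def]
    fun_prop
  have hfi : Integrable (Function.uncurry f) (volume.prod μ) := by
    refine ((integrable_exp_neg_rpow_abs hb hs).comp_fst μ).mono' hfm.aestronglyMeasurable
      (ae_of_all _ fun z => ?_)
    simp only [Function.uncurry_def, hf, fourierIntegrand, Complex.norm_exp]
    simp
  have hswap := integral_integral_swap hfi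
  have hL : ∀ u : ℝ, ∫ x, f u x ∂μ = fourierIntegrand b 1 y u := by
    intro u
    have h1 : ∀ x : ℝ, f u x = fourierIntegrand b s y u *
        Complex.exp (((s * u : ℝ) : ℂ) * x * Complex.I) := by
      intro x
      rw [hf]
      simp only [fourierIntegrand]
      rw [← Complex.exp_add]
      congr 1
      push_cast
      ring
    simp only [h1]
    rw [integral_const_mul, ← charFun_apply_real, hμ, fourierIntegrand, fourierIntegrand,
      ← Complex.exp_add]
    congr 1
    have h2 : (s * |u|) ^ b + |s * u| ^ b = (1 * |u|) ^ b := by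
      rw [abs_mul, abs_of_pos hs, one_mul, Real.mul_rpow hs.le (abs_nonneg u), ← add_mul, hs2,
        one_mul]
    rw [← h2]
    push_cast
    ring
  have hR : ∀ x : ℝ, ∫ u : ℝ, f u x = ((2 * Real.pi * density b s (y - s * x) : ℝ) : ℂ) := by
    intro x
    apply Complex.ext
    · rw [Complex.ofReal_re]
      show _ = 2 * Real.pi * ((1 / (2 * Real.pi)) *
        (∫ u : ℝ, fourierIntegrand b s (y - s * x) u).re)
      have := Real.pi_pos
      field_simp
      rfl
    · rw [Complex.ofReal_im]
      exact integral_fourierIntegrand_im hb hs _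
  simp only [hL, hR] at hswap
  rw [integral_fourierIntegrand hb, integral_complex_ofReal, integral_const_mul] at hswap
  have h3 : 2 * Real.pi * stdDensity b y = 2 * Real.pi * ∫ x, density b s (y - s * x) ∂μ := by
    exact_mod_cast hswap
  exact mul_left_cancel₀ (by positivity) h3

lemma stdDensity_pos {b : ℝ} (hb : 0 < b) (hb2 : b < 2) (μ : Measure ℝ) [IsProbabilityMeasure μ]
    (hμ : ∀ t : ℝ, charFun μ t = Complex.exp (-((|t| ^ b : ℝ) : ℂ))) (y : ℝ) :
    0 < stdDensity b y := by
  obtain ⟨hnn, hμd⟩ := eq_withDensity_of_charFun hb μ hμ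
  refine lt_of_le_of_ne (hnn y) fun h0 => ?_
  obtain ⟨c, Y, hc, hY, htail⟩ := exists_tail_lower_bound hb hb2
  have hpos : ∀ x, Y ≤ x → 0 < stdDensity b x := by
    intro x hx
    have hx0 : 0 < x := hY.trans_le hx
    rw [stdDensity_eq hb]
    have := htail x hx
    have h2 : 0 < c * x ^ (-1 - b) := by positivity
    have := h2.trans_le this
    positivity
  set s : ℝ := (1 / 2 : ℝ) ^ (1 / b) with hs
  have hs0 : 0 < s := by positivity
  have hsb : s ^ b = 1 / 2 := by
    rw [hs, ← Real.rpow_mul (by norm_num), one_div_mul_cancel hb.ne', Real.rpow_one]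
  have hconv := stdDensity_eq_integral hb μ hμ hs0 (by rw [hsb]; norm_num) y
  have hdens : ∀ x, density b s (y - s * x) = s⁻¹ * stdDensity b ((y - s * x) / s) :=
    fun x => density_eq hb hs0 _
  have hdnn : ∀ x, 0 ≤ density b s (y - s * x) := fun x => by
    rw [hdens]
    have := hnn ((y - s * x) / s)
    positivity
  have hdc : Continuous fun x => density b s (y - s * x) := by
    simp only [hdens]
    have := continuous_stdDensity hb
    fun_prop
  have hdi : Integrable (fun x => density b s (y - s * x)) μ := by
    obtain ⟨C, hC⟩ := stdDensity_le hb
    refine (integrable_const (s⁻¹ * C)).mono' hdc.aestronglyMeasurable (ae_of_all _ fun x => ?_)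
    rw [hdens, norm_mul, Real.norm_of_nonneg (inv_pos.2 hs0).le]
    exact mul_le_mul_of_nonneg_left (hC _) (inv_pos.2 hs0).le
  rw [← h0, eq_comm, integral_eq_zero_iff_of_nonneg hdnn hdi] at hconv
  set S := Set.Iio (-(Y + |y / s|)) with hS
  have hμS : μ S = 0 := by
    refine measure_mono_null (fun x hx => ?_) (ae_iff.1 hconv)
    have hx' : x < -(Y + |y / s|) := hx
    have h1 : Y ≤ (y - s * x) / s := by
      rw [sub_div, mul_div_cancel_left₀ _ hs0.ne']
      linarith [neg_abs_le (y / s)]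
    have h2 : 0 < density b s (y - s * x) := by
      rw [hdens]
      have := hpos _ h1
      positivity
    exact h2.ne'
  rw [hμd, withDensity_apply _ measurableSet_Iio, lintegral_eq_zero_iff
    (by have := (continuous_stdDensity hb).measurable; fun_prop)] at hμS
  have h3 : ∀ᵐ x ∂(volume.restrict S), False := by
    filter_upwards [hμS, ae_restrict_mem measurableSet_Iio] with x hx hx'
    have h4 : stdDensity b x ≤ 0 := ENNReal.ofReal_eq_zero.1 hx
    have hx'' : x < -(Y + |y / s|) := hx'
    have h5 := hpos (-x) (by linarith [abs_nonneg (y / s)])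
    rw [stdDensity_neg hb] at h5
    linarith
  have h4 : volume S = 0 := by
    rw [ae_iff] at h3
    simpa using h3
  exact (isOpen_Iio.measure_pos volume (Set.nonempty_Iio)).ne' h4

/-- Polynomial lower bound for the stable density. -/
lemma exists_stdDensity_lower_bound {b : ℝ} (hb : 0 < b) (hb2 : b < 2) (μ : Measure ℝ)
    [IsProbabilityMeasure μ]
    (hμ : ∀ t : ℝ, charFun μ t = Complex.exp (-((|t| ^ b : ℝ) : ℂ))) :
    ∃ c, 0 < c ∧ ∀ y, c * (1 + |y|) ^ (-1 - b) ≤ stdDensity b y := by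
  obtain ⟨c, Y, hc, hY, htail⟩ := exists_tail_lower_bound hb hb2
  have hposd := stdDensity_pos hb hb2 μ hμ
  obtain ⟨y₀, -, hy₀⟩ := (isCompact_Icc (a := -Y) (b := Y)).exists_isMinOn
    (Set.nonempty_Icc.2 (by linarith)) (continuous_stdDensity hb).continuousOn
  set m := stdDensity b y₀ with hm
  have hm0 : 0 < m := hposd y₀
  refine ⟨min m (1 / Real.pi * c), lt_min hm0 (by positivity), ?_⟩
  have htail' : ∀ y, Y ≤ y → 1 / Real.pi * c * (1 + |y|) ^ (-1 - b) ≤ stdDensity b y := by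
    intro y hy
    have hy0 : 0 < y := hY.trans_le hy
    rw [stdDensity_eq hb, mul_assoc]
    refine mul_le_mul_of_nonneg_left (le_trans ?_ (htail y hy)) (by positivity)
    refine mul_le_mul_of_nonneg_left ?_ hc.le
    refine Real.rpow_le_rpow_of_nonpos hy0 ?_ (by linarith)
    rw [abs_of_pos hy0]
    linarith
  intro y
  have h1y : (1 : ℝ) ≤ 1 + |y| := by linarith [abs_nonneg y]
  have hp : 0 < (1 + |y|) ^ (-1 - b) := Real.rpow_pos_of_pos (by linarith) _
  rcases le_total |y| Y with h | h
  · have h1 : m ≤ stdDensity b y := hy₀ (abs_le.1 h)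
    have h2 : (1 + |y|) ^ (-1 - b) ≤ 1 := Real.rpow_le_one_of_one_le_of_nonpos h1y (by linarith)
    calc min m (1 / Real.pi * c) * (1 + |y|) ^ (-1 - b) ≤ m * 1 := by
          gcongr
          exact min_le_left _ _
      _ ≤ stdDensity b y := by rw [mul_one]; exact h1
  · have h1 : stdDensity b |y| = stdDensity b y := by
      rcases abs_choice y with h' | h' <;> rw [h']
      exact stdDensity_neg hb y
    have h2 := htail' |y| h
    rw [abs_abs, h1] at h2
    refine le_trans ?_ h2
    gcongr
    exact min_le_right _ _

lemma hasDerivAt_stInt_comp (k p q : ℕ) {b z : ℝ → ℝ} {b' z' t : ℝ} (hb : 0 < b t)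
    (hbd : HasDerivAt b b' t) (hzd : HasDerivAt z z' t) :
    HasDerivAt (fun t => stInt k p q (b t) (z t))
      ((p * stInt (k + 1) p q (b t) (z t) - stInt (k + 1) (p + 1) q (b t) (z t)) * b'
        + stInt k p (q + 1) (b t) (z t) * z') t := by
  have hev : ∀ᶠ v : ℝ × ℝ in 𝓝 (b t, z t), 0 < v.1 := continuousAt_fst.eventually (lt_mem_nhds hb)
  have hF := hasStrictFDerivAt_uncurry_coprod (𝕜 := ℝ) (u := (b t, z t)) (f := stInt k p q)
    (f₁ := fun b y => ContinuousLinearMap.toSpanSingleton ℝ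
      (p * stInt (k + 1) p q b y - stInt (k + 1) (p + 1) q b y))
    (f₂ := fun b y => ContinuousLinearMap.toSpanSingleton ℝ (stInt k p (q + 1) b y))
    (by
      filter_upwards [hev] with v hv
      exact (hasDerivAt_stInt_index k p q hv v.2).hasFDerivAt)
    (by
      filter_upwards [hev] with v hv
      exact (hasDerivAt_stInt k p q hv v.2).hasFDerivAt)
    (by
      have h : ContinuousAt (fun v : ℝ × ℝ => p * stInt (k + 1) p q v.1 v.2
          - stInt (k + 1) (p + 1) q v.1 v.2) (b t, z t) :=
        (continuousAt_const.mul (continuousAt_stInt (k + 1) p q hb (z t))).sub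
          (continuousAt_stInt (k + 1) (p + 1) q hb (z t))
      exact ((ContinuousLinearMap.toSpanSingletonCLE (𝕜 := ℝ) (E := ℝ)).continuous.continuousAt).comp h)
    (by
      have h := continuousAt_stInt k p (q + 1) hb (z t)
      exact ((ContinuousLinearMap.toSpanSingletonCLE (𝕜 := ℝ) (E := ℝ)).continuous.continuousAt).comp h)
  have hc := hF.hasFDerivAt.comp_hasDerivAt t (hbd.prodMk hzd)
  convert! hc using 1
  simp [Function.HasUncurry.uncurry]
  ring

lemma abs_second_derivative_le {δ₁ δ₂ δ₃ ε s b M J₁ J₂ J₃ J₄ J₅ J₆ J₇ w₁ w₂ w₃ : ℝ}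
    (h₁ : |δ₁| ≤ ε) (h₂ : |δ₂| ≤ ε) (h₃ : |δ₃| ≤ ε) (hs : |s| ≤ 2) (hb : |b| ≤ 2)
    (j₁ : |J₁| ≤ M) (j₂ : |J₂| ≤ M) (j₃ : |J₃| ≤ M) (j₄ : |J₄| ≤ M) (j₅ : |J₅| ≤ M)
    (j₆ : |J₆| ≤ M) (j₇ : |J₇| ≤ M) (k₁ : |w₁| ≤ 2 * ε * M) (k₂ : |w₂| ≤ 2 * ε * M)
    (k₃ : |w₃| ≤ 2 * ε * M) :
    |(δ₁ * δ₂ * s ^ 2 * J₁ + -(δ₁ * s * ((J₂ - J₃) * δ₁ + w₁))) + (-(δ₁ * δ₂ * s ^ 2 * J₄)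
      + 2 * δ₂ ^ 2 * b * s ^ 3 * J₄ + -(δ₂ * b * s ^ 2 * ((J₁ - J₅) * δ₁ + w₂)))
      + (2 * δ₃ * δ₂ * s ^ 3 * J₆ + -(δ₃ * s ^ 2 * (-J₇ * δ₁ + w₃)))| ≤ 108 * M * ε ^ 2 := by
  have hε : 0 ≤ ε := (abs_nonneg _).trans h₁
  have hM : 0 ≤ M := (abs_nonneg _).trans j₁
  have p1 : |δ₁ * δ₂ * s ^ 2 * J₁| ≤ ε * ε * 2 ^ 2 * M := by
    rw [abs_mul, abs_mul, abs_mul, abs_pow]; gcongr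
  have q2 : |(J₂ - J₃) * δ₁ + w₁| ≤ 4 * ε * M := by
    have : |(J₂ - J₃) * δ₁| ≤ (M + M) * ε := by
      rw [abs_mul]
      have := (abs_sub J₂ J₃).trans (add_le_add j₂ j₃)
      gcongr
    calc _ ≤ _ := abs_add_le _ _
      _ ≤ (M + M) * ε + 2 * ε * M := add_le_add this k₁
      _ = _ := by ring
  have p2 : |-(δ₁ * s * ((J₂ - J₃) * δ₁ + w₁))| ≤ ε * 2 * (4 * ε * M) := by
    rw [abs_neg, abs_mul, abs_mul]; gcongr
  have p3 : |-(δ₁ * δ₂ * s ^ 2 * J₄)| ≤ ε * ε * 2 ^ 2 * M := by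
    rw [abs_neg, abs_mul, abs_mul, abs_mul, abs_pow]; gcongr
  have p4 : |2 * δ₂ ^ 2 * b * s ^ 3 * J₄| ≤ 2 * ε ^ 2 * 2 * 2 ^ 3 * M := by
    rw [abs_mul, abs_mul, abs_mul, abs_mul, abs_pow, abs_pow, abs_two]; gcongr
  have q5 : |(J₁ - J₅) * δ₁ + w₂| ≤ 4 * ε * M := by
    have : |(J₁ - J₅) * δ₁| ≤ (M + M) * ε := by
      rw [abs_mul]
      have := (abs_sub J₁ J₅).trans (add_le_add j₁ j₅)
      gcongr
    calc _ ≤ _ := abs_add_le _ _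
      _ ≤ (M + M) * ε + 2 * ε * M := add_le_add this k₂
      _ = _ := by ring
  have p5 : |-(δ₂ * b * s ^ 2 * ((J₁ - J₅) * δ₁ + w₂))| ≤ ε * 2 * 2 ^ 2 * (4 * ε * M) := by
    rw [abs_neg, abs_mul, abs_mul, abs_mul, abs_pow]; gcongr
  have p6 : |2 * δ₃ * δ₂ * s ^ 3 * J₆| ≤ 2 * ε * ε * 2 ^ 3 * M := by
    rw [abs_mul, abs_mul, abs_mul, abs_mul, abs_pow, abs_two]; gcongr
  have q7 : |-J₇ * δ₁ + w₃| ≤ 3 * ε * M := by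
    have : |-J₇ * δ₁| ≤ M * ε := by
      rw [abs_mul, abs_neg]
      gcongr
    calc _ ≤ _ := abs_add_le _ _
      _ ≤ M * ε + 2 * ε * M := add_le_add this k₃
      _ = _ := by ring
  have p7 : |-(δ₃ * s ^ 2 * (-J₇ * δ₁ + w₃))| ≤ ε * 2 ^ 2 * (3 * ε * M) := by
    rw [abs_neg, abs_mul, abs_mul, abs_pow]; gcongr
  calc _ ≤ _ := abs_add_three _ _ _
    _ ≤ (ε * ε * 2 ^ 2 * M + ε * 2 * (4 * ε * M)) + (ε * ε * 2 ^ 2 * M + 2 * ε ^ 2 * 2 * 2 ^ 3 * M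
      + ε * 2 * 2 ^ 2 * (4 * ε * M)) + (2 * ε * ε * 2 ^ 3 * M + ε * 2 ^ 2 * (3 * ε * M)) := by
        refine add_le_add (add_le_add ?_ ?_) ?_
        · exact (abs_add_le _ _).trans (add_le_add p1 p2)
        · exact (abs_add_three _ _ _).trans (add_le_add (add_le_add p3 p4) p5)
        · exact (abs_add_le _ _).trans (add_le_add p6 p7)
    _ = 108 * M * ε ^ 2 := by ring

lemma abs_sub_sub_le_of_second_derivative {f f₁ f₂ : ℝ → ℝ} {M : ℝ}
    (h₁ : ∀ t ∈ Set.Icc (0 : ℝ) 1, HasDerivAt f (f₁ t) t)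
    (h₂ : ∀ t ∈ Set.Icc (0 : ℝ) 1, HasDerivAt f₁ (f₂ t) t)
    (hM : ∀ t ∈ Set.Icc (0 : ℝ) 1, |f₂ t| ≤ M) : |f 1 - f 0 - f₁ 0| ≤ M := by
  have h0 : (0 : ℝ) ∈ Set.Icc (0 : ℝ) 1 := by simp
  have hM0 : 0 ≤ M := (abs_nonneg _).trans (hM 0 h0)
  have a : ∀ t ∈ Set.Icc (0 : ℝ) 1, |f₁ t - f₁ 0| ≤ M := by
    intro t ht
    have := (convex_Icc (0 : ℝ) 1).norm_image_sub_le_of_norm_hasDerivWithin_le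
      (fun t ht => (h₂ t ht).hasDerivWithinAt) hM h0 ht
    rw [Real.norm_eq_abs, Real.norm_eq_abs, sub_zero, abs_of_nonneg ht.1] at this
    nlinarith [ht.2]
  have b := (convex_Icc (0 : ℝ) 1).norm_image_sub_le_of_norm_hasDerivWithin_le
    (f := fun t => f t - t * f₁ 0) (f' := fun t => f₁ t - 1 * f₁ 0) (C := M)
    (fun t ht => ((h₁ t ht).sub ((hasDerivAt_id t).mul_const (f₁ 0))).hasDerivWithinAt)
    (fun t ht => by simpa using a t ht) h0 (by simp : (1 : ℝ) ∈ Set.Icc (0 : ℝ) 1)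
  simp only [one_mul, zero_mul, sub_zero, Real.norm_eq_abs, abs_one, mul_one] at b
  rwa [sub_right_comm]

/-- The density of `(1+δ₂)Y + δ₃` where `Y` has the standard stable density of index `β+δ₁`. -/
def shiftedDensity (β δ₁ δ₂ δ₃ y : ℝ) : ℝ :=
  (1 + δ₂)⁻¹ * stdDensity (β + δ₁) ((y - δ₃) / (1 + δ₂))

/-- The differential of `shiftedDensity` at `δ = 0`. -/
def densityDifferential (β δ₁ δ₂ δ₃ y : ℝ) : ℝ :=
  1 / Real.pi * (-(δ₁ * stInt 1 1 0 β y) + -(δ₂ * β * stInt 0 1 0 β y) + -(δ₃ * stInt 0 0 1 β y))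

/-- Second-order expansion of the location-scale-index family of stable densities. -/
lemma exists_abs_shiftedDensity_sub_le {β κ : ℝ} (hκ0 : 0 < κ) (hκ : κ < β) (hβ2 : β < 2) :
    ∃ ρ K : ℝ, 0 < ρ ∧ ρ ≤ 1 / 2 ∧ ρ < β ∧ 0 ≤ K ∧ ∀ ε δ₁ δ₂ δ₃ : ℝ, ε ≤ ρ → |δ₁| ≤ ε →
      |δ₂| ≤ ε → |δ₃| ≤ ε → ∀ y, |shiftedDensity β δ₁ δ₂ δ₃ y - stdDensity β y
        - densityDifferential β δ₁ δ₂ δ₃ y| ≤ K * ε ^ 2 * (1 + |y|) ^ (-1 - κ) := by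
  have hβ : 0 < β := hκ0.trans hκ
  set b₁ := (β + κ) / 2 with hb₁
  have hκb : κ < b₁ := by rw [hb₁]; linarith
  have hκ2 : κ < 2 := hκ.trans hβ2
  set ρ := min (min (1 / 2) ((β - κ) / 2)) (2 - β) with hρ
  have hρ0 : 0 < ρ := lt_min (lt_min (by norm_num) (by linarith)) (by linarith)
  have hρ1 : ρ ≤ 1 / 2 := (min_le_left _ _).trans (min_le_left _ _)
  have hρ2 : ρ ≤ (β - κ) / 2 := (min_le_left _ _).trans (min_le_right _ _)
  have hρ3 : ρ ≤ 2 - β := min_le_right _ _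
  obtain ⟨C₁, hC₁, c₁⟩ := abs_stInt_le (b₂ := 2) hκ0 hκb hκ2 0 1 1 (by omega)
  obtain ⟨C₂, hC₂, c₂⟩ := abs_stInt_le (b₂ := 2) hκ0 hκb hκ2 0 2 1 (by omega)
  obtain ⟨C₃, hC₃, c₃⟩ := abs_stInt_le (b₂ := 2) hκ0 hκb hκ2 0 2 2 (by omega)
  obtain ⟨C₄, hC₄, c₄⟩ := abs_stInt_le (b₂ := 2) hκ0 hκb hκ2 0 0 1 (by omega)
  obtain ⟨C₅, hC₅, c₅⟩ := abs_stInt_le (b₂ := 2) hκ0 hκb hκ2 0 1 2 (by omega)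
  obtain ⟨C₆, hC₆, c₆⟩ := abs_stInt_le (b₂ := 2) hκ0 hκb hκ2 1 0 0 (by omega)
  obtain ⟨C₇, hC₇, c₇⟩ := abs_stInt_le (b₂ := 2) hκ0 hκb hκ2 1 1 1 (by omega)
  obtain ⟨C₈, hC₈, c₈⟩ := abs_stInt_le (b₂ := 2) hκ0 hκb hκ2 1 0 1 (by omega)
  obtain ⟨C₉, hC₉, c₉⟩ := abs_stInt_le (b₂ := 2) hκ0 hκb hκ2 2 0 0 (by omega)
  set K := C₁ + C₂ + C₃ + C₄ + C₅ + C₆ + C₇ + C₈ + C₉ with hK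
  have hK0 : 0 ≤ K := by positivity
  refine ⟨ρ, 1 / Real.pi * (108 * K * 2 ^ (1 + κ)), hρ0, hρ1, by linarith, by positivity, ?_⟩
  intro ε δ₁ δ₂ δ₃ hε hδ₁ hδ₂ hδ₃ y
  have hε0 : 0 ≤ ε := (abs_nonneg _).trans hδ₁
  set b : ℝ → ℝ := fun t => β + t * δ₁ with hb
  set s : ℝ → ℝ := fun t => 1 + t * δ₂ with hs
  set z : ℝ → ℝ := fun t => (y - t * δ₃) / s t with hz
  have hmul : ∀ t ∈ Set.Icc (0 : ℝ) 1, ∀ δ : ℝ, |δ| ≤ ε → |t * δ| ≤ ε := by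
    intro t ht δ hδ
    rw [abs_mul, abs_of_nonneg ht.1]
    exact (mul_le_of_le_one_left (abs_nonneg _) ht.2).trans hδ
  have hbt : ∀ t ∈ Set.Icc (0 : ℝ) 1, b₁ ≤ b t ∧ b t ≤ 2 := by
    intro t ht
    have := abs_le.1 (hmul t ht δ₁ hδ₁)
    simp only [hb, hb₁]
    constructor <;> linarith
  have hst : ∀ t ∈ Set.Icc (0 : ℝ) 1, 1 / 2 ≤ s t ∧ s t ≤ 3 / 2 := by
    intro t ht
    have := abs_le.1 (hmul t ht δ₂ hδ₂)
    simp only [hs]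
    constructor <;> linarith
  have hb0 : ∀ t ∈ Set.Icc (0 : ℝ) 1, 0 < b t := fun t ht => by
    have := (hbt t ht).1
    linarith
  have hs0 : ∀ t ∈ Set.Icc (0 : ℝ) 1, 0 < s t := fun t ht => by
    have := (hst t ht).1
    linarith
  set z' : ℝ → ℝ := fun t => -((δ₃ + δ₂ * z t) * (s t)⁻¹) with hz'
  have hbd : ∀ t, HasDerivAt b δ₁ t := fun t => by
    have h : HasDerivAt b (1 * δ₁) t := ((hasDerivAt_id t).mul_const δ₁).const_add β
    rwa [one_mul] at h
  have hsd : ∀ t, HasDerivAt s δ₂ t := fun t => by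
    have h : HasDerivAt s (1 * δ₂) t := ((hasDerivAt_id t).mul_const δ₂).const_add 1
    rwa [one_mul] at h
  have hsid : ∀ t ∈ Set.Icc (0 : ℝ) 1, HasDerivAt (fun t => (s t)⁻¹) (-(δ₂ * (s t)⁻¹ ^ 2)) t := by
    intro t ht
    have := (hsd t).inv (hs0 t ht).ne'
    convert! this using 1
    rw [inv_pow]
    ring
  have hzd : ∀ t ∈ Set.Icc (0 : ℝ) 1, HasDerivAt z (z' t) t := by
    intro t ht
    have hne := (hs0 t ht).ne'
    have h1 : HasDerivAt (fun t => y - t * δ₃) (-(1 * δ₃)) t :=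
      ((hasDerivAt_id t).mul_const δ₃).const_sub y
    have := h1.div (hsd t) hne
    convert! this using 1
    simp only [hz', hz]
    field_simp
    ring
  set f : ℝ → ℝ := fun t => (s t)⁻¹ * stInt 0 0 0 (b t) (z t) with hf
  set f₁ : ℝ → ℝ := fun t => -(δ₁ * (s t)⁻¹ * stInt 1 1 0 (b t) (z t))
    + -(δ₂ * b t * (s t)⁻¹ ^ 2 * stInt 0 1 0 (b t) (z t))
    + -(δ₃ * (s t)⁻¹ ^ 2 * stInt 0 0 1 (b t) (z t)) with hf₁
  have hd₁ : ∀ t ∈ Set.Icc (0 : ℝ) 1, HasDerivAt f (f₁ t) t := by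
    intro t ht
    have h1 := (hsid t ht).mul (hasDerivAt_stInt_comp 0 0 0 (hb0 t ht) (hbd t) (hzd t ht))
    convert! h1 using 1
    have hrec := mul_stInt_succ 0 0 0 (hb0 t ht) (z t)
    simp only [hf₁, hz', zero_add] at hrec ⊢
    simp only [Nat.cast_zero] at hrec ⊢
    linear_combination (δ₂ * (s t)⁻¹ ^ 2) * hrec
  set f₂ : ℝ → ℝ := fun t => (δ₁ * δ₂ * (s t)⁻¹ ^ 2 * stInt 1 1 0 (b t) (z t)
      + -(δ₁ * (s t)⁻¹ * ((stInt 2 1 0 (b t) (z t) - stInt 2 2 0 (b t) (z t)) * δ₁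
        + stInt 1 1 1 (b t) (z t) * z' t)))
    + (-(δ₁ * δ₂ * (s t)⁻¹ ^ 2 * stInt 0 1 0 (b t) (z t))
      + 2 * δ₂ ^ 2 * b t * (s t)⁻¹ ^ 3 * stInt 0 1 0 (b t) (z t)
      + -(δ₂ * b t * (s t)⁻¹ ^ 2 * ((stInt 1 1 0 (b t) (z t) - stInt 1 2 0 (b t) (z t)) * δ₁
        + stInt 0 1 1 (b t) (z t) * z' t)))
    + (2 * δ₃ * δ₂ * (s t)⁻¹ ^ 3 * stInt 0 0 1 (b t) (z t)
      + -(δ₃ * (s t)⁻¹ ^ 2 * (-stInt 1 1 1 (b t) (z t) * δ₁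
        + stInt 0 0 2 (b t) (z t) * z' t))) with hf₂
  have hd₂ : ∀ t ∈ Set.Icc (0 : ℝ) 1, HasDerivAt f₁ (f₂ t) t := by
    intro t ht
    have g1 := hasDerivAt_stInt_comp 1 1 0 (hb0 t ht) (hbd t) (hzd t ht)
    have g2 := hasDerivAt_stInt_comp 0 1 0 (hb0 t ht) (hbd t) (hzd t ht)
    have g3 := hasDerivAt_stInt_comp 0 0 1 (hb0 t ht) (hbd t) (hzd t ht)
    have a1 := (((hsid t ht).const_mul δ₁).mul g1).neg
    have a2 := ((((hbd t).const_mul δ₂).mul ((hsid t ht).pow 2)).mul g2).neg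
    have a3 := ((((hsid t ht).pow 2).const_mul δ₃).mul g3).neg
    have := (a1.add a2).add a3
    convert! this using 1
    simp only [hf₂, Pi.mul_apply, Pi.pow_apply]
    push_cast
    ring
  have hM : ∀ t ∈ Set.Icc (0 : ℝ) 1,
      |f₂ t| ≤ 108 * (K * 2 ^ (1 + κ) * (1 + |y|) ^ (-1 - κ)) * ε ^ 2 := by
    intro t ht
    obtain ⟨hl, hr⟩ := hbt t ht
    have hs1 := (hst t ht).1
    have hs2 := (hst t ht).2
    have hsp := hs0 t ht
    have hz0 : 0 < 1 + |z t| := by linarith [abs_nonneg (z t)]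
    have hz1 : 1 ≤ 1 + |z t| := by linarith [abs_nonneg (z t)]
    set B := (1 + |z t|) ^ (-1 - κ) with hB
    have hB0 : 0 < B := Real.rpow_pos_of_pos hz0 _
    have hinv : |(s t)⁻¹| ≤ 2 := by
      rw [abs_of_pos (inv_pos.2 hsp), inv_le_comm₀ hsp two_pos]
      linarith
    have hyz : 1 + |y| ≤ 2 * (1 + |z t|) := by
      have e1 : y = s t * z t + t * δ₃ := by
        simp only [hz]
        field_simp
        ring
      have e2 : |y| ≤ s t * |z t| + |t * δ₃| := by
        calc |y| = |s t * z t + t * δ₃| := by rw [← e1]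
          _ ≤ |s t * z t| + |t * δ₃| := abs_add_le _ _
          _ = s t * |z t| + |t * δ₃| := by rw [abs_mul, abs_of_pos hsp]
      have e3 := hmul t ht δ₃ hδ₃
      nlinarith [abs_nonneg (z t)]
    have hBy : B ≤ 2 ^ (1 + κ) * (1 + |y|) ^ (-1 - κ) := by
      have hy0 : 0 < 1 + |y| := by linarith [abs_nonneg y]
      have e1 : (2 * (1 + |z t|)) ^ (-1 - κ) ≤ (1 + |y|) ^ (-1 - κ) :=
        Real.rpow_le_rpow_of_nonpos hy0 hyz (by linarith)
      rw [Real.mul_rpow two_pos.le hz0.le] at e1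
      calc B = 2 ^ (1 + κ) * (2 ^ (-1 - κ) * B) := by
            rw [← mul_assoc, ← Real.rpow_add two_pos]; norm_num
        _ ≤ _ := by gcongr
    have hz'b : |z' t| ≤ 2 * ε * (1 + |z t|) := by
      simp only [hz']
      rw [abs_neg, abs_mul]
      have e1 : |δ₃ + δ₂ * z t| ≤ ε * (1 + |z t|) := by
        calc |δ₃ + δ₂ * z t| ≤ |δ₃| + |δ₂ * z t| := abs_add_le _ _
          _ = |δ₃| + |δ₂| * |z t| := by rw [abs_mul]
          _ ≤ ε + ε * |z t| := by gcongr
          _ = _ := by ring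
      calc |δ₃ + δ₂ * z t| * |(s t)⁻¹| ≤ (ε * (1 + |z t|)) * 2 := by gcongr
        _ = _ := by ring
    have lift0 : ∀ {C x : ℝ}, C ≤ K → (1 + |z t|) ^ 0 * |x| ≤ C * B → |x| ≤ K * B := by
      intro C x hC hx
      rw [pow_zero, one_mul] at hx
      exact hx.trans (by gcongr)
    have lift1 : ∀ {C x : ℝ} (n : ℕ), 1 ≤ n → C ≤ K → (1 + |z t|) ^ n * |x| ≤ C * B →
        (1 + |z t|) * |x| ≤ K * B := by
      intro C x n hn hC hx
      refine le_trans ?_ (hx.trans (by gcongr))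
      gcongr
      exact le_self_pow₀ hz1 (by omega)
    have lift2 : ∀ {x : ℝ}, (1 + |z t|) * |x| ≤ K * B → |x| ≤ K * B := fun hx =>
      (le_mul_of_one_le_left (abs_nonneg _) hz1).trans hx
    have lift3 : ∀ {x : ℝ}, (1 + |z t|) * |x| ≤ K * B → |x * z' t| ≤ 2 * ε * (K * B) := by
      intro x hx
      rw [abs_mul]
      calc |x| * |z' t| ≤ |x| * (2 * ε * (1 + |z t|)) := by gcongr
        _ = 2 * ε * ((1 + |z t|) * |x|) := by ring
        _ ≤ 2 * ε * (K * B) := by gcongr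
    have d1 := lift0 (by linarith) (c₁ (b t) hl hr (z t))
    have d2 := lift0 (by linarith) (c₂ (b t) hl hr (z t))
    have d3 := lift0 (by linarith) (c₃ (b t) hl hr (z t))
    have d4 := lift0 (by linarith) (c₄ (b t) hl hr (z t))
    have d5 := lift0 (by linarith) (c₅ (b t) hl hr (z t))
    have d6 := lift1 1 le_rfl (by linarith) (c₆ (b t) hl hr (z t))
    have d7 := lift1 1 le_rfl (by linarith) (c₇ (b t) hl hr (z t))
    have d8 := lift1 1 le_rfl (by linarith) (c₈ (b t) hl hr (z t))
    have d9 := lift1 2 (by omega) (by linarith) (c₉ (b t) hl hr (z t))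
    have main := abs_second_derivative_le hδ₁ hδ₂ hδ₃ hinv
      (by rw [abs_of_pos (hb0 t ht)]; exact hr : |b t| ≤ 2) d1 d2 d3 d4 d5 (lift2 d6) (lift2 d7)
      (lift3 d7) (lift3 d8) (lift3 d9)
    calc |f₂ t| ≤ 108 * (K * B) * ε ^ 2 := main
      _ ≤ 108 * (K * (2 ^ (1 + κ) * (1 + |y|) ^ (-1 - κ))) * ε ^ 2 := by gcongr
      _ = _ := by ring
  have key := abs_sub_sub_le_of_second_derivative hd₁ hd₂ hM
  have hβδ : 0 < β + δ₁ := by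
    have := (abs_le.1 hδ₁).1
    linarith
  have e1 : shiftedDensity β δ₁ δ₂ δ₃ y = 1 / Real.pi * f 1 := by
    simp only [shiftedDensity, hf, hb, hs, hz, one_mul]
    rw [stdDensity_eq hβδ]
    ring
  have e0 : stdDensity β y = 1 / Real.pi * f 0 := by
    simp only [hf, hb, hs, hz, zero_mul, add_zero, sub_zero, div_one, inv_one, one_mul]
    rw [stdDensity_eq hβ]
  have e2 : densityDifferential β δ₁ δ₂ δ₃ y = 1 / Real.pi * f₁ 0 := by
    simp only [densityDifferential, hf₁, hb, hs, hz, zero_mul, add_zero, sub_zero, div_one,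
      inv_one, one_pow, mul_one]
  rw [e1, e0, e2, ← mul_sub, ← mul_sub, abs_mul, abs_of_pos (by positivity)]
  calc 1 / Real.pi * |f 1 - f 0 - f₁ 0|
      ≤ 1 / Real.pi * (108 * (K * 2 ^ (1 + κ) * (1 + |y|) ^ (-1 - κ)) * ε ^ 2) := by gcongr
    _ = _ := by ring

/-- `μ` is the law with characteristic function `exp(-|t|^β)`, `0 < β < 2`. -/
structure IsStdStable (β : ℝ) (μ : Measure ℝ) : Prop where
  pos : 0 < β
  lt_two : β < 2
  prob : IsProbabilityMeasure μ
  charFun_eq : ∀ t : ℝ, charFun μ t = Complex.exp (-((|t| ^ β : ℝ) : ℂ))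

/-- The score for the index. -/
def scoreIndex (β y : ℝ) : ℝ := -(1 / Real.pi * stInt 1 1 0 β y) / stdDensity β y

/-- The score for the scale. -/
def scoreScale (β y : ℝ) : ℝ := -(1 / Real.pi * (β * stInt 0 1 0 β y)) / stdDensity β y

/-- The score for the location. -/
def scoreLoc (β y : ℝ) : ℝ := -(1 / Real.pi * stInt 0 0 1 β y) / stdDensity β y

/-- A linear combination of the scores. -/
def scoreComb (β c₁ c₂ c₃ y : ℝ) : ℝ :=
  c₁ * scoreIndex β y + c₂ * scoreScale β y + c₃ * scoreLoc β y

/-- The relative density increment. -/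
def ratioIncr (β δ₁ δ₂ δ₃ y : ℝ) : ℝ := shiftedDensity β δ₁ δ₂ δ₃ y / stdDensity β y - 1

lemma measurable_shiftedDensity {β δ₁ : ℝ} (hδ : 0 < β + δ₁) (δ₂ δ₃ : ℝ) :
    Measurable (shiftedDensity β δ₁ δ₂ δ₃) := by
  have h1 := (continuous_stdDensity hδ).measurable
  unfold shiftedDensity
  fun_prop

namespace IsStdStable

variable {β : ℝ} {μ : Measure ℝ} (h : IsStdStable β μ)
include h

lemma density_pos (y : ℝ) : 0 < stdDensity β y := by
  have := h.prob
  exact stdDensity_pos h.pos h.lt_two μ h.charFun_eq y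

lemma eq_withDensity : μ = volume.withDensity fun y => ENNReal.ofReal (stdDensity β y) := by
  have := h.prob
  exact (eq_withDensity_of_charFun h.pos μ h.charFun_eq).2

lemma integral_eq (g : ℝ → ℝ) : ∫ y, g y ∂μ = ∫ y, g y * stdDensity β y := by
  have hm := (continuous_stdDensity h.pos).measurable
  rw [h.eq_withDensity, integral_withDensity_eq_integral_toReal_smul (by fun_prop) (by simp)]
  congr 1
  funext y
  rw [ENNReal.toReal_ofReal (h.density_pos y).le, smul_eq_mul, mul_comm]

lemma integrable_iff {g : ℝ → ℝ} :
    Integrable g μ ↔ Integrable (fun y => g y * stdDensity β y) := by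
  have hm := (continuous_stdDensity h.pos).measurable
  rw [h.eq_withDensity, integrable_withDensity_iff_integrable_smul' (by fun_prop) (by simp)]
  refine integrable_congr (ae_of_all _ fun y => ?_)
  simp only [smul_eq_mul]
  rw [ENNReal.toReal_ofReal (h.density_pos y).le, mul_comm]

lemma measurable_scoreIndex : Measurable (scoreIndex β) := by
  have h1 := (continuous_stdDensity h.pos).measurable
  have h2 := (continuous_stInt 1 1 0 h.pos).measurable
  unfold scoreIndex
  fun_prop

lemma measurable_scoreScale : Measurable (scoreScale β) := by
  have h1 := (continuous_stdDensity h.pos).measurable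
  have h2 := (continuous_stInt 0 1 0 h.pos).measurable
  unfold scoreScale
  fun_prop

lemma measurable_scoreLoc : Measurable (scoreLoc β) := by
  have h1 := (continuous_stdDensity h.pos).measurable
  have h2 := (continuous_stInt 0 0 1 h.pos).measurable
  unfold scoreLoc
  fun_prop

lemma measurable_scoreComb (c₁ c₂ c₃ : ℝ) : Measurable (scoreComb β c₁ c₂ c₃) := by
  have h1 := h.measurable_scoreIndex
  have h2 := h.measurable_scoreScale
  have h3 := h.measurable_scoreLoc
  unfold scoreComb
  fun_prop

lemma measurable_ratioIncr {δ₁ : ℝ} (hδ : 0 < β + δ₁) (δ₂ δ₃ : ℝ) :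
    Measurable (ratioIncr β δ₁ δ₂ δ₃) := by
  have h1 := measurable_shiftedDensity hδ δ₂ δ₃
  have h2 := (continuous_stdDensity h.pos).measurable
  unfold ratioIncr
  fun_prop

lemma integrable_one_add_abs_rpow {r : ℝ} (hr : r ≤ β / 4) :
    Integrable (fun y : ℝ => (1 + |y|) ^ r) μ := by
  rw [h.integrable_iff]
  have hβ := h.pos
  have hβ2 := h.lt_two
  obtain ⟨C, hC, hb⟩ := abs_stInt_le (b₁ := β) (b₂ := β) (κ := β / 2) (by linarith) (by linarith)
    (by linarith) 0 0 0 (by omega)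
  refine ((SymStable.integrable_one_add_abs_rpow (r := -1 - β / 4) (by linarith)).const_mul
    (1 / Real.pi * C)).mono' ?_ (ae_of_all _ fun y => ?_)
  · have hm := (continuous_stdDensity h.pos).measurable
    exact Measurable.aestronglyMeasurable (by fun_prop)
  · have h1 : 1 ≤ 1 + |y| := by linarith [abs_nonneg y]
    have h0 : 0 < 1 + |y| := by linarith
    have h2 := hb β le_rfl le_rfl y
    rw [pow_zero, one_mul] at h2
    rw [norm_mul, Real.norm_of_nonneg (Real.rpow_nonneg h0.le _), stdDensity_eq hβ, norm_mul,
      Real.norm_of_nonneg (by positivity)]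
    calc (1 + |y|) ^ r * (1 / Real.pi * ‖stInt 0 0 0 β y‖)
        ≤ (1 + |y|) ^ (β / 4) * (1 / Real.pi * (C * (1 + |y|) ^ (-1 - β / 2))) := by
          gcongr
          exact h2
      _ = 1 / Real.pi * C * ((1 + |y|) ^ (β / 4) * (1 + |y|) ^ (-1 - β / 2)) := by ring
      _ = 1 / Real.pi * C * (1 + |y|) ^ (-1 - β / 4) := by
          rw [← Real.rpow_add h0]
          congr 2
          ring

/-- An envelope with finite fourth moment dominates the scores and the remainders. -/
lemma exists_envelope : ∃ (G : ℝ → ℝ) (ρ : ℝ), 0 < ρ ∧ ρ < β ∧ ρ ≤ 1 / 2 ∧ Measurable G ∧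
    (∀ y, 1 ≤ G y) ∧ Integrable (fun y => G y ^ 4) μ ∧ (∀ y, |scoreIndex β y| ≤ G y) ∧
    (∀ y, |scoreScale β y| ≤ G y) ∧ (∀ y, |scoreLoc β y| ≤ G y) ∧
    ∀ ε δ₁ δ₂ δ₃ : ℝ, ε ≤ ρ → |δ₁| ≤ ε → |δ₂| ≤ ε → |δ₃| ≤ ε → ∀ y,
      |ratioIncr β δ₁ δ₂ δ₃ y - scoreComb β δ₁ δ₂ δ₃ y| ≤ ε ^ 2 * G y := by
  have hβ := h.pos
  have hβ2 := h.lt_two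
  have := h.prob
  set κ := 15 * β / 16 with hκ
  have hκ0 : 0 < κ := by positivity
  have hκβ : κ < β := by rw [hκ]; linarith
  obtain ⟨c, hc, hlow⟩ := exists_stdDensity_lower_bound hβ hβ2 μ h.charFun_eq
  obtain ⟨ρ, K, hρ0, hρ1, hρβ, hK, hexp⟩ := exists_abs_shiftedDensity_sub_le hκ0 hκβ hβ2
  obtain ⟨C₁, hC₁, c₁⟩ := abs_stInt_le (b₁ := β) (b₂ := β) hκ0 hκβ (hκβ.trans hβ2) 0 1 1 (by omega)
  obtain ⟨C₂, hC₂, c₂⟩ := abs_stInt_le (b₁ := β) (b₂ := β) hκ0 hκβ (hκβ.trans hβ2) 0 0 1 (by omega)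
  obtain ⟨C₃, hC₃, c₃⟩ := abs_stInt_le (b₁ := β) (b₂ := β) hκ0 hκβ (hκβ.trans hβ2) 1 0 0 (by omega)
  set A := 1 / Real.pi * C₁ + 1 / Real.pi * (β * C₂) + 1 / Real.pi * C₃ + K with hA
  have hA0 : 0 ≤ A := by positivity
  have key : ∀ {x y : ℝ}, |x| ≤ A * (1 + |y|) ^ (-1 - κ) →
      |x / stdDensity β y| ≤ (1 + A / c) * (1 + |y|) ^ (β / 16) := by
    intro x y hx
    have h0 : 0 < 1 + |y| := by linarith [abs_nonneg y]
    have hφ := h.density_pos y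
    rw [abs_div, abs_of_pos hφ, div_le_iff₀ hφ]
    have hp : 0 < (1 + |y|) ^ (β / 16) := Real.rpow_pos_of_pos h0 _
    calc |x| ≤ A * (1 + |y|) ^ (-1 - κ) := hx
      _ = A / c * (1 + |y|) ^ (β / 16) * (c * (1 + |y|) ^ (-1 - β)) := by
          have e : (1 + |y|) ^ (-1 - κ) = (1 + |y|) ^ (β / 16) * (1 + |y|) ^ (-1 - β) := by
            rw [← Real.rpow_add h0]
            congr 1
            rw [hκ]
            ring
          rw [e]
          field_simp
      _ ≤ (1 + A / c) * (1 + |y|) ^ (β / 16) * stdDensity β y := by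
          gcongr
          · linarith
          · exact hlow y
  refine ⟨fun y => (1 + A / c) * (1 + |y|) ^ (β / 16), ρ, hρ0, hρβ, hρ1, by fun_prop, ?_, ?_, ?_,
    ?_, ?_, ?_⟩
  · intro y
    have h1 : 1 ≤ (1 + |y|) ^ (β / 16) :=
      Real.one_le_rpow (by linarith [abs_nonneg y]) (by positivity)
    have h2 : 0 ≤ A / c := by positivity
    nlinarith
  · have := (h.integrable_one_add_abs_rpow (r := β / 4) le_rfl).const_mul ((1 + A / c) ^ 4)
    refine this.congr (ae_of_all _ fun y => ?_)
    have h0 : 0 ≤ 1 + |y| := by linarith [abs_nonneg y]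
    simp only
    rw [mul_pow, ← Real.rpow_mul_natCast h0]
    congr 2
    push_cast
    ring
  · intro y
    refine key ?_
    have e := c₁ β le_rfl le_rfl y
    rw [pow_zero, one_mul] at e
    rw [abs_neg, abs_mul, abs_of_pos (by positivity : 0 < 1 / Real.pi)]
    have h0 : 0 ≤ (1 + |y|) ^ (-1 - κ) := Real.rpow_nonneg (by linarith [abs_nonneg y]) _
    calc 1 / Real.pi * |stInt 1 1 0 β y| ≤ 1 / Real.pi * (C₁ * (1 + |y|) ^ (-1 - κ)) := by gcongr
      _ = 1 / Real.pi * C₁ * (1 + |y|) ^ (-1 - κ) := by ring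
      _ ≤ A * (1 + |y|) ^ (-1 - κ) := by
        refine mul_le_mul_of_nonneg_right ?_ h0
        have : 0 ≤ 1 / Real.pi * (β * C₂) + 1 / Real.pi * C₃ + K := by positivity
        linarith
  · intro y
    refine key ?_
    have e := c₂ β le_rfl le_rfl y
    rw [pow_zero, one_mul] at e
    rw [abs_neg, abs_mul, abs_mul, abs_of_pos (by positivity : 0 < 1 / Real.pi), abs_of_pos hβ]
    have h0 : 0 ≤ (1 + |y|) ^ (-1 - κ) := Real.rpow_nonneg (by linarith [abs_nonneg y]) _
    calc 1 / Real.pi * (β * |stInt 0 1 0 β y|)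
        ≤ 1 / Real.pi * (β * (C₂ * (1 + |y|) ^ (-1 - κ))) := by gcongr
      _ = 1 / Real.pi * (β * C₂) * (1 + |y|) ^ (-1 - κ) := by ring
      _ ≤ A * (1 + |y|) ^ (-1 - κ) := by
        refine mul_le_mul_of_nonneg_right ?_ h0
        have : 0 ≤ 1 / Real.pi * C₁ + 1 / Real.pi * C₃ + K := by positivity
        linarith
  · intro y
    refine key ?_
    have e := c₃ β le_rfl le_rfl y
    rw [pow_one] at e
    have e' : |stInt 0 0 1 β y| ≤ C₃ * (1 + |y|) ^ (-1 - κ) :=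
      (le_mul_of_one_le_left (abs_nonneg _) (by linarith [abs_nonneg y])).trans e
    rw [abs_neg, abs_mul, abs_of_pos (by positivity : 0 < 1 / Real.pi)]
    have h0 : 0 ≤ (1 + |y|) ^ (-1 - κ) := Real.rpow_nonneg (by linarith [abs_nonneg y]) _
    calc 1 / Real.pi * |stInt 0 0 1 β y| ≤ 1 / Real.pi * (C₃ * (1 + |y|) ^ (-1 - κ)) := by gcongr
      _ = 1 / Real.pi * C₃ * (1 + |y|) ^ (-1 - κ) := by ring
      _ ≤ A * (1 + |y|) ^ (-1 - κ) := by
        refine mul_le_mul_of_nonneg_right ?_ h0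
        have : 0 ≤ 1 / Real.pi * C₁ + 1 / Real.pi * (β * C₂) + K := by positivity
        linarith
  · intro ε δ₁ δ₂ δ₃ hε h1 h2 h3 y
    have hφ := (h.density_pos y).ne'
    have h0 : 0 ≤ (1 + |y|) ^ (-1 - κ) := Real.rpow_nonneg (by linarith [abs_nonneg y]) _
    have e := hexp ε δ₁ δ₂ δ₃ hε h1 h2 h3 y
    have hε0 : 0 ≤ ε := (abs_nonneg _).trans h1
    rcases hε0.eq_or_lt with he | he
    · subst he
      have a1 : δ₁ = 0 := abs_nonpos_iff.1 h1
      have a2 : δ₂ = 0 := abs_nonpos_iff.1 h2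
      have a3 : δ₃ = 0 := abs_nonpos_iff.1 h3
      subst a1 a2 a3
      simp [ratioIncr, shiftedDensity, scoreComb, hφ]
    · have e2 : ratioIncr β δ₁ δ₂ δ₃ y - scoreComb β δ₁ δ₂ δ₃ y = ε ^ 2 *
          ((shiftedDensity β δ₁ δ₂ δ₃ y - stdDensity β y - densityDifferential β δ₁ δ₂ δ₃ y)
            / ε ^ 2 / stdDensity β y) := by
        simp only [ratioIncr, scoreComb, scoreIndex, scoreScale, scoreLoc, densityDifferential]
        field_simp
      rw [e2, abs_mul, abs_of_pos (by positivity : 0 < ε ^ 2)]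
      refine mul_le_mul_of_nonneg_left (key ?_) (by positivity)
      rw [abs_div, abs_of_pos (by positivity : 0 < ε ^ 2), div_le_iff₀ (by positivity)]
      refine e.trans ?_
      have : K ≤ A := by
        have : 0 ≤ 1 / Real.pi * C₁ + 1 / Real.pi * (β * C₂) + 1 / Real.pi * C₃ := by positivity
        linarith
      calc K * ε ^ 2 * (1 + |y|) ^ (-1 - κ) ≤ A * ε ^ 2 * (1 + |y|) ^ (-1 - κ) := by gcongr
        _ = _ := by ring

end IsStdStable

lemma integrable_shiftedDensity {β δ₁ δ₂ : ℝ} (h₁ : 0 < β + δ₁) (h₂ : 0 < 1 + δ₂) (δ₃ : ℝ) :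
    Integrable (shiftedDensity β δ₁ δ₂ δ₃) := by
  have h := ((integrable_stdDensity h₁).comp_div h₂.ne').comp_sub_right δ₃
  exact h.const_mul _

lemma integral_shiftedDensity {β δ₁ δ₂ : ℝ} (h₁ : 0 < β + δ₁) (h₂ : 0 < 1 + δ₂) (δ₃ : ℝ) :
    ∫ y, shiftedDensity β δ₁ δ₂ δ₃ y = 1 := by
  unfold shiftedDensity
  rw [integral_const_mul,
    integral_sub_right_eq_self (fun y => stdDensity (β + δ₁) (y / (1 + δ₂))) δ₃,
    Measure.integral_comp_div (stdDensity (β + δ₁)), integral_stdDensity h₁, abs_of_pos h₂]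
  simp [h₂.ne']

lemma integrable_mul_of_envelope {μ : Measure ℝ} {G f g : ℝ → ℝ} (hG : ∀ y, 1 ≤ G y)
    (hG4 : Integrable (fun y => G y ^ 4) μ) (hf : Measurable f) (hg : Measurable g)
    (hfG : ∀ y, |f y| ≤ G y) (hgG : ∀ y, |g y| ≤ G y) : Integrable (fun y => f y * g y) μ := by
  refine hG4.mono' (hf.mul hg).aestronglyMeasurable (ae_of_all _ fun y => ?_)
  have h1 := hG y
  calc ‖f y * g y‖ = |f y| * |g y| := by rw [norm_mul]; rfl
    _ ≤ G y * G y := mul_le_mul (hfG y) (hgG y) (abs_nonneg _) (by linarith)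
    _ = G y ^ 2 := by ring
    _ ≤ G y ^ 4 := pow_le_pow_right₀ h1 (by norm_num)

namespace IsStdStable

variable {β : ℝ} {μ : Measure ℝ} (h : IsStdStable β μ)
include h

lemma integral_ratioIncr {δ₁ δ₂ : ℝ} (h₁ : 0 < β + δ₁) (h₂ : 0 < 1 + δ₂) (δ₃ : ℝ) :
    ∫ y, ratioIncr β δ₁ δ₂ δ₃ y ∂μ = 0 := by
  rw [h.integral_eq]
  have e : ∀ y, ratioIncr β δ₁ δ₂ δ₃ y * stdDensity β y =
      shiftedDensity β δ₁ δ₂ δ₃ y - stdDensity β y := by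
    intro y
    have := (h.density_pos y).ne'
    unfold ratioIncr
    field_simp
  simp_rw [e]
  rw [integral_sub (integrable_shiftedDensity h₁ h₂ δ₃) (integrable_stdDensity h.pos),
    integral_shiftedDensity h₁ h₂, integral_stdDensity h.pos, sub_self]

lemma integrandH_eq (y : ℝ) : integrandH β y = scoreScale β y ^ 2 * stdDensity β y := by
  have hφ := (h.density_pos y).ne'
  have e := mul_stInt_succ 0 0 0 h.pos y
  have e2 : stdDensity β y + y * deriv (stdDensity β) y =
      1 / Real.pi * (β * stInt 0 1 0 β y) := by
    rw [(hasDerivAt_stdDensity h.pos y).deriv, mul_left_comm]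
    simp only [zero_add, Nat.cast_zero, zero_mul, add_zero, one_mul] at e
    rw [e, stdDensity_eq h.pos]
    ring
  rw [integrandH, e2, scoreScale]
  field_simp

lemma integrandM_eq (y : ℝ) : integrandM β y = scoreLoc β y ^ 2 * stdDensity β y := by
  have hφ := (h.density_pos y).ne'
  rw [integrandM, (hasDerivAt_stdDensity h.pos y).deriv, scoreLoc]
  field_simp

lemma integrable_scoreScale_sq : Integrable (fun y => scoreScale β y ^ 2) μ := by
  obtain ⟨G, ρ, -, -, -, -, h1, h4, -, hS, -, -⟩ := h.exists_envelope
  simpa only [sq] using integrable_mul_of_envelope h1 h4 h.measurable_scoreScale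
    h.measurable_scoreScale hS hS

lemma integrable_scoreLoc_sq : Integrable (fun y => scoreLoc β y ^ 2) μ := by
  obtain ⟨G, ρ, -, -, -, -, h1, h4, -, -, hL, -⟩ := h.exists_envelope
  simpa only [sq] using integrable_mul_of_envelope h1 h4 h.measurable_scoreLoc
    h.measurable_scoreLoc hL hL

lemma integrable_integrandH : Integrable (integrandH β) := by
  rw [funext h.integrandH_eq]
  exact h.integrable_iff.1 h.integrable_scoreScale_sq

lemma integrable_integrandM : Integrable (integrandM β) := by
  rw [funext h.integrandM_eq]
  exact h.integrable_iff.1 h.integrable_scoreLoc_sq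

lemma integral_scoreScale_sq : ∫ y, scoreScale β y ^ 2 ∂μ = constH β := by
  rw [h.integral_eq, constH, funext h.integrandH_eq]

lemma integral_scoreLoc_sq : ∫ y, scoreLoc β y ^ 2 ∂μ = constM β := by
  rw [h.integral_eq, constM, funext h.integrandM_eq]

lemma constH_nonneg : 0 ≤ constH β := by
  rw [← h.integral_scoreScale_sq]
  positivity

lemma constM_nonneg : 0 ≤ constM β := by
  rw [← h.integral_scoreLoc_sq]
  positivity

lemma integral_scoreScale_mul_scoreLoc : ∫ y, scoreScale β y * scoreLoc β y ∂μ = 0 := by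
  rw [h.integral_eq]
  have e := integral_neg_eq_self
    (fun y => scoreScale β y * scoreLoc β y * stdDensity β y) (volume : Measure ℝ)
  have e2 : ∀ y, scoreScale β (-y) * scoreLoc β (-y) * stdDensity β (-y) =
      -(scoreScale β y * scoreLoc β y * stdDensity β y) := by
    intro y
    simp only [scoreScale, scoreLoc, stdDensity_neg h.pos, stInt_neg]
    ring
  simp_rw [e2] at e
  rw [integral_neg] at e
  linarith

/-- The second moment of a combination of the scale and location scores. -/
lemma integral_scoreComb_sq (c₂ c₃ : ℝ) :
    ∫ y, scoreComb β 0 c₂ c₃ y ^ 2 ∂μ = c₂ ^ 2 * constH β + c₃ ^ 2 * constM β := by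
  obtain ⟨G, ρ, -, -, -, -, h1, h4, -, hS, hL, -⟩ := h.exists_envelope
  have hSL := integrable_mul_of_envelope h1 h4 h.measurable_scoreScale
    h.measurable_scoreLoc hS hL
  have e : ∀ y, scoreComb β 0 c₂ c₃ y ^ 2 = c₂ ^ 2 * scoreScale β y ^ 2 +
      c₃ ^ 2 * scoreLoc β y ^ 2 + 2 * c₂ * c₃ * (scoreScale β y * scoreLoc β y) := by
    intro y
    rw [scoreComb]
    ring
  simp_rw [e]
  have i1 := (h.integrable_scoreScale_sq).const_mul (c₂ ^ 2)
  have i2 := (h.integrable_scoreLoc_sq).const_mul (c₃ ^ 2)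
  have i3 : Integrable (fun y => c₂ ^ 2 * scoreScale β y ^ 2 + c₃ ^ 2 * scoreLoc β y ^ 2) μ :=
    i1.add i2
  rw [integral_add i3 (hSL.const_mul _), integral_add i1 i2, integral_const_mul, integral_const_mul,
    integral_const_mul, h.integral_scoreScale_sq, h.integral_scoreLoc_sq,
    h.integral_scoreScale_mul_scoreLoc]
  ring

lemma integral_scoreComb (c₁ c₂ c₃ : ℝ) : ∫ y, scoreComb β c₁ c₂ c₃ y ∂μ = 0 := by
  have := h.prob
  obtain ⟨G, ρ, hρ, hρβ, hρ1, hGm, h1, h4, hI, hS, hL, hexp⟩ := h.exists_envelope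
  have hG : Integrable G μ := by
    refine h4.mono' hGm.aestronglyMeasurable (ae_of_all _ fun y => ?_)
    rw [Real.norm_of_nonneg (by linarith [h1 y])]
    exact le_self_pow₀ (h1 y) (by norm_num)
  have hint : Integrable (scoreComb β c₁ c₂ c₃) μ :=
    (((hG.mono' h.measurable_scoreIndex.aestronglyMeasurable (ae_of_all _ hI)).const_mul _).add
    ((hG.mono' h.measurable_scoreScale.aestronglyMeasurable (ae_of_all _ hS)).const_mul _)).add
    ((hG.mono' h.measurable_scoreLoc.aestronglyMeasurable (ae_of_all _ hL)).const_mul _)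
  set K := |c₁| + |c₂| + |c₃| + 1 with hK
  have hK0 : 0 < K := by positivity
  set m := ∫ y, scoreComb β c₁ c₂ c₃ y ∂μ with hm
  have key : ∀ t : ℝ, 0 < t → t * K ≤ ρ → |m| ≤ t * (K ^ 2 * ∫ y, G y ∂μ) := by
    intro t ht htK
    have hb : ∀ c : ℝ, |c| ≤ K → |t * c| ≤ t * K := fun c hc => by
      rw [abs_mul, abs_of_pos ht]
      exact mul_le_mul_of_nonneg_left hc ht.le
    have b1 := hb c₁ (by rw [hK]; linarith [abs_nonneg c₂, abs_nonneg c₃])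
    have b2 := hb c₂ (by rw [hK]; linarith [abs_nonneg c₁, abs_nonneg c₃])
    have b3 := hb c₃ (by rw [hK]; linarith [abs_nonneg c₂, abs_nonneg c₁])
    have e := hexp (t * K) (t * c₁) (t * c₂) (t * c₃) htK b1 b2 b3
    have p1 : 0 < β + t * c₁ := by linarith [neg_abs_le (t * c₁)]
    have p2 : 0 < 1 + t * c₂ := by linarith [neg_abs_le (t * c₂)]
    have hdi : Integrable (fun y => ratioIncr β (t * c₁) (t * c₂) (t * c₃) y -
        scoreComb β (t * c₁) (t * c₂) (t * c₃) y) μ :=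
      (hG.const_mul ((t * K) ^ 2)).mono' ((h.measurable_ratioIncr p1 _ _).sub
        (h.measurable_scoreComb _ _ _)).aestronglyMeasurable (ae_of_all _ e)
    have e2 : ∀ y, scoreComb β (t * c₁) (t * c₂) (t * c₃) y = t * scoreComb β c₁ c₂ c₃ y := by
      intro y
      simp only [scoreComb]
      ring
    have hint' : Integrable (scoreComb β (t * c₁) (t * c₂) (t * c₃)) μ := by
      rw [funext e2]
      exact hint.const_mul t
    have hri : Integrable (ratioIncr β (t * c₁) (t * c₂) (t * c₃)) μ := by
      refine (hdi.add hint').congr (ae_of_all _ fun y => ?_)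
      simp
    have e3 : ∫ y, (ratioIncr β (t * c₁) (t * c₂) (t * c₃) y -
        scoreComb β (t * c₁) (t * c₂) (t * c₃) y) ∂μ = -(t * m) := by
      rw [integral_sub hri hint', h.integral_ratioIncr p1 p2, funext e2, integral_const_mul]
      ring
    have e4 : ‖∫ y, (ratioIncr β (t * c₁) (t * c₂) (t * c₃) y -
        scoreComb β (t * c₁) (t * c₂) (t * c₃) y) ∂μ‖ ≤ ∫ y, (t * K) ^ 2 * G y ∂μ :=
      norm_integral_le_of_norm_le (hG.const_mul ((t * K) ^ 2)) (ae_of_all _ e)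
    rw [e3, norm_neg, norm_mul, Real.norm_of_nonneg ht.le, integral_const_mul] at e4
    refine le_of_mul_le_mul_left (e4.trans (le_of_eq ?_)) ht
    ring
  have hlim : Tendsto (fun t : ℝ => t * (K ^ 2 * ∫ y, G y ∂μ)) (𝓝[>] 0) (𝓝 0) := by
    have : Tendsto (fun t : ℝ => t * (K ^ 2 * ∫ y, G y ∂μ)) (𝓝 0) (𝓝 (0 * _)) :=
      tendsto_id.mul_const _
    rw [zero_mul] at this
    exact this.mono_left nhdsWithin_le_nhds
  have hle : |m| ≤ 0 := by
    refine ge_of_tendsto hlim ?_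
    filter_upwards [Ioc_mem_nhdsGT (div_pos hρ hK0)] with t ht
    exact key t ht.1 ((le_div_iff₀ hK0).1 ht.2)
  exact abs_nonpos_iff.1 hle

end IsStdStable

section InMeasure

variable {Ω : Type*} [MeasurableSpace Ω] {P : Measure Ω}

lemma tendstoInMeasure_zero_iff {S : ℕ → Ω → ℝ} : TendstoInMeasure P S atTop (fun _ => 0) ↔
    ∀ ε : ℝ, 0 < ε → Tendsto (fun n => P {ω | ε ≤ |S n ω|}) atTop (𝓝 0) := by
  simp only [tendstoInMeasure_iff_norm, sub_zero, Real.norm_eq_abs]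

lemma tendstoInMeasure_zero_add {S T : ℕ → Ω → ℝ} (hS : TendstoInMeasure P S atTop (fun _ => 0))
    (hT : TendstoInMeasure P T atTop (fun _ => 0)) :
    TendstoInMeasure P (fun n ω => S n ω + T n ω) atTop (fun _ => 0) := by
  rw [tendstoInMeasure_zero_iff] at *
  intro ε hε
  have h := (hS (ε / 2) (by positivity)).add (hT (ε / 2) (by positivity))
  rw [add_zero] at h
  refine tendsto_of_tendsto_of_tendsto_of_le_of_le tendsto_const_nhds h (fun _ => zero_le) ?_
  intro n
  refine (measure_mono ?_).trans (measure_union_le _ _)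
  intro ω hω
  simp only [Set.mem_ofPred_eq, Set.mem_union] at *
  by_contra! hc
  linarith [abs_add_le (S n ω) (T n ω)]

lemma tendstoInMeasure_zero_const_mul {S : ℕ → Ω → ℝ} (c : ℝ)
    (hS : TendstoInMeasure P S atTop (fun _ => 0)) :
    TendstoInMeasure P (fun n ω => c * S n ω) atTop (fun _ => 0) := by
  rw [tendstoInMeasure_zero_iff] at *
  intro ε hε
  have hc : 0 < |c| + 1 := by positivity
  refine tendsto_of_tendsto_of_tendsto_of_le_of_le tendsto_const_nhds
    (hS (ε / (|c| + 1)) (by positivity)) (fun _ => zero_le) fun n => measure_mono fun ω hω => ?_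
  simp only [Set.mem_ofPred_eq] at *
  rw [div_le_iff₀ hc]
  rw [abs_mul] at hω
  nlinarith [abs_nonneg (S n ω)]

lemma tendstoInMeasure_zero_of_tendsto {a : ℕ → ℝ} (ha : Tendsto a atTop (𝓝 0)) :
    TendstoInMeasure P (fun n _ => a n) atTop (fun _ => 0) := by
  rw [tendstoInMeasure_zero_iff]
  intro ε hε
  refine tendsto_const_nhds.congr' ?_
  filter_upwards [(tendsto_order.1 ha.abs).2 ε (by simpa using hε)] with n hn
  simp [not_le.2 hn]

end InMeasure

/-- Triangular array whose `n`-th row, `n ≥ 1`, is an i.i.d. sequence of law `μ`. -/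
structure IsRowIID {Ω : Type*} [MeasurableSpace Ω] (Y : ℕ → ℕ → Ω → ℝ) (μ : Measure ℝ)
    (P : Measure Ω) : Prop where
  measurable : ∀ n j, Measurable (Y n j)
  indep : ∀ n, 0 < n → iIndepFun (Y n) P
  law : ∀ n j, 0 < n → P.map (Y n j) = μ

namespace IsRowIID

variable {Ω : Type*} [MeasurableSpace Ω] {P : Measure Ω}
  {Y : ℕ → ℕ → Ω → ℝ} {μ : Measure ℝ}

lemma integral_comp (hY : IsRowIID Y μ P) {n : ℕ} (hn : 0 < n) (j : ℕ) {f : ℝ → ℝ}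
    (hf : Measurable f) : ∫ ω, f (Y n j ω) ∂P = ∫ y, f y ∂μ := by
  rw [← hY.law n j hn, integral_map (hY.measurable n j).aemeasurable hf.aestronglyMeasurable]

lemma integrable_comp (hY : IsRowIID Y μ P) {n : ℕ} (hn : 0 < n) (j : ℕ) {f : ℝ → ℝ}
    (hf : Integrable f μ) : Integrable (fun ω => f (Y n j ω)) P := by
  rw [← hY.law n j hn] at hf
  exact hf.comp_measurable (hY.measurable n j)

lemma measure_le_abs_sum_le_integral_abs [IsProbabilityMeasure P]
    (hY : IsRowIID Y μ P) {n : ℕ} (hn : 0 < n) {f : ℝ → ℝ}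
    (hf : Measurable f) (hfi : Integrable f μ) {ε : ℝ} (hε : 0 < ε) :
    P {ω | ε ≤ |∑ j ∈ Finset.range n, f (Y n j ω)|} ≤
      ENNReal.ofReal (n * (∫ y, |f y| ∂μ) / ε) := by
  have hi : Integrable (fun ω => |∑ j ∈ Finset.range n, f (Y n j ω)|) P :=
    (integrable_finsetSum _ fun j _ => hY.integrable_comp hn j hfi).abs
  have h1 := mul_meas_ge_le_integral_of_nonneg (ae_of_all _ fun ω => abs_nonneg _) hi ε
  have h2 : ∫ ω, |∑ j ∈ Finset.range n, f (Y n j ω)| ∂P ≤ n * ∫ y, |f y| ∂μ := by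
    calc ∫ ω, |∑ j ∈ Finset.range n, f (Y n j ω)| ∂P
        ≤ ∫ ω, ∑ j ∈ Finset.range n, |f (Y n j ω)| ∂P :=
          integral_mono hi (integrable_finsetSum _ fun j _ => (hY.integrable_comp hn j hfi).abs)
            fun ω => Finset.abs_sum_le_sum_abs _ _
      _ = n * ∫ y, |f y| ∂μ := by
          rw [integral_finsetSum _ fun j _ => (hY.integrable_comp hn j hfi).abs]
          simp_rw [hY.integral_comp hn _ (f := fun y => |f y|) (by fun_prop)]
          simp
  rw [← ofReal_measureReal]
  refine ENNReal.ofReal_le_ofReal ?_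
  rw [le_div_iff₀ hε]
  linarith

lemma measure_le_abs_sum_le_integral_sq [IsProbabilityMeasure P]
    (hY : IsRowIID Y μ P) {n : ℕ} (hn : 0 < n) {f : ℝ → ℝ}
    (hf : Measurable f) (hfi : Integrable (fun y => f y ^ 2) μ) (h0 : ∫ y, f y ∂μ = 0)
    {ε : ℝ} (hε : 0 < ε) :
    P {ω | ε ≤ |∑ j ∈ Finset.range n, f (Y n j ω)|} ≤
      ENNReal.ofReal (n * (∫ y, f y ^ 2 ∂μ) / ε ^ 2) := by
  have hL : ∀ j, MemLp (fun ω => f (Y n j ω)) 2 P := fun j =>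
    (memLp_two_iff_integrable_sq (hf.comp (hY.measurable n j)).aestronglyMeasurable).2
      (hY.integrable_comp hn j hfi)
  have hind := (hY.indep n hn).comp (fun _ => f) fun _ => hf
  have hvar : Var[∑ j ∈ Finset.range n, (fun ω => f (Y n j ω)); P] = n * ∫ y, f y ^ 2 ∂μ := by
    rw [IndepFun.variance_sum (fun j _ => hL j) (fun i _ j _ hij => hind.indepFun hij)]
    have : ∀ j, Var[fun ω => f (Y n j ω); P] = ∫ y, f y ^ 2 ∂μ := by
      intro j
      rw [variance_of_integral_eq_zero (X := fun ω => f (Y n j ω))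
        (hf.comp (hY.measurable n j)).aemeasurable (by rw [hY.integral_comp hn j hf, h0])]
      exact hY.integral_comp hn j (f := fun y => f y ^ 2) (by fun_prop)
    simp [this]
  have hmean : ∫ ω, (∑ j ∈ Finset.range n, (fun ω => f (Y n j ω))) ω ∂P = 0 := by
    simp only [Finset.sum_apply]
    rw [integral_finsetSum _ fun j _ => (hL j).integrable one_le_two]
    simp [hY.integral_comp hn _ hf, h0]
  have h1 := meas_ge_le_variance_div_sq (memLp_finsetSum' (Finset.range n) fun j _ => hL j) hε
  rw [hvar, hmean] at h1
  simpa using h1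

lemma measure_le_abs_sum_le_measure_ne (hY : IsRowIID Y μ P) {n : ℕ} (hn : 0 < n) {f : ℝ → ℝ}
    {s : Set ℝ} (hs : MeasurableSet s) (hfs : ∀ y ∉ s, f y = 0) {ε : ℝ} (hε : 0 < ε) :
    P {ω | ε ≤ |∑ j ∈ Finset.range n, f (Y n j ω)|} ≤ n * μ s := by
  have hsub : {ω | ε ≤ |∑ j ∈ Finset.range n, f (Y n j ω)|} ⊆
      ⋃ j ∈ Finset.range n, Y n j ⁻¹' s := by
    intro ω hω
    by_contra hc
    simp only [Set.mem_iUnion, not_exists, Set.mem_preimage] at hc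
    rw [Set.mem_ofPred_eq, Finset.sum_eq_zero fun j hj => hfs _ (hc j hj)] at hω
    simp at hω
    linarith
  refine (measure_mono hsub).trans ((measure_biUnion_finset_le _ _).trans (le_of_eq ?_))
  have : ∀ j, P (Y n j ⁻¹' s) = μ s := fun j => by
    rw [← hY.law n j hn, Measure.map_apply (hY.measurable n j) hs]
  simp [this]

lemma tendstoInMeasure_sum_of_integral_abs [IsProbabilityMeasure P]
    (hY : IsRowIID Y μ P) {f : ℕ → ℝ → ℝ}
    (hf : ∀ᶠ n in atTop, Measurable (f n) ∧ Integrable (f n) μ)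
    (hlim : Tendsto (fun n : ℕ => n * ∫ y, |f n y| ∂μ) atTop (𝓝 0)) :
    TendstoInMeasure P (fun n ω => ∑ j ∈ Finset.range n, f n (Y n j ω)) atTop (fun _ => 0) := by
  rw [tendstoInMeasure_zero_iff]
  intro ε hε
  have h1 := ENNReal.tendsto_ofReal (hlim.div_const ε)
  rw [zero_div, ENNReal.ofReal_zero] at h1
  refine tendsto_of_tendsto_of_tendsto_of_le_of_le' tendsto_const_nhds h1
    (Eventually.of_forall fun _ => zero_le) ?_
  filter_upwards [hf, eventually_gt_atTop 0] with n hn hn0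
  exact hY.measure_le_abs_sum_le_integral_abs hn0 hn.1 hn.2 hε

lemma tendstoInMeasure_sum_of_integral_sq [IsProbabilityMeasure P]
    (hY : IsRowIID Y μ P) {f : ℕ → ℝ → ℝ}
    (hf : ∀ᶠ n in atTop, Measurable (f n) ∧ Integrable (fun y => f n y ^ 2) μ ∧ ∫ y, f n y ∂μ = 0)
    (hlim : Tendsto (fun n : ℕ => n * ∫ y, f n y ^ 2 ∂μ) atTop (𝓝 0)) :
    TendstoInMeasure P (fun n ω => ∑ j ∈ Finset.range n, f n (Y n j ω)) atTop (fun _ => 0) := by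
  rw [tendstoInMeasure_zero_iff]
  intro ε hε
  have h1 := ENNReal.tendsto_ofReal (hlim.div_const (ε ^ 2))
  rw [zero_div, ENNReal.ofReal_zero] at h1
  refine tendsto_of_tendsto_of_tendsto_of_le_of_le' tendsto_const_nhds h1
    (Eventually.of_forall fun _ => zero_le) ?_
  filter_upwards [hf, eventually_gt_atTop 0] with n hn hn0
  exact hY.measure_le_abs_sum_le_integral_sq hn0 hn.1 hn.2.1 hn.2.2 hε

end IsRowIID

lemma abs_log_one_add_sub_le {x : ℝ} (hx : |x| ≤ 1 / 2) :
    |Real.log (1 + x) - x + x ^ 2 / 2| ≤ 2 * |x| ^ 3 := by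
  have h := Real.abs_log_sub_add_sum_range_le (x := -x) (by rw [abs_neg]; linarith) 2
  rw [abs_neg, sub_neg_eq_add, Finset.sum_range_succ, Finset.sum_range_one] at h
  have e : (-x) ^ (0 + 1) / ((0 : ℕ) + 1 : ℝ) + (-x) ^ (1 + 1) / ((1 : ℕ) + 1 : ℝ)
      + Real.log (1 + x) = Real.log (1 + x) - x + x ^ 2 / 2 := by
    push_cast
    ring
  rw [e] at h
  refine h.trans ?_
  rw [div_le_iff₀ (by linarith)]
  have := mul_nonneg (pow_nonneg (abs_nonneg x) 3) (by linarith : 0 ≤ 1 / 2 - |x|)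
  norm_num
  linarith

/-- The data of a smooth family of relative density increments `r`, with linear part `v`,
in terms of an envelope `G` and a local scale `ε`. -/
structure IsLocalExpansion (μ : Measure ℝ) (G : ℝ → ℝ) (ε : ℝ) (r v : ℝ → ℝ) : Prop where
  measurable_r : Measurable r
  measurable_v : Measurable v
  nonneg : 0 ≤ ε
  le_one : ε ≤ 1
  abs_v_le : ∀ y, |v y| ≤ ε * G y
  abs_sub_le : ∀ y, |r y - v y| ≤ ε ^ 2 * G y
  integral_r : ∫ y, r y ∂μ = 0
  integral_v : ∫ y, v y ∂μ = 0

namespace IsLocalExpansion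

variable {μ : Measure ℝ} {G r v : ℝ → ℝ} {ε : ℝ}

lemma abs_r_le (hE : IsLocalExpansion μ G ε r v) (y : ℝ) : |r y| ≤ 2 * ε * G y := by
  have h1 := hE.abs_v_le y
  have h2 := hE.abs_sub_le y
  have h0 := hE.nonneg
  have hG : 0 ≤ ε ^ 2 * G y := (abs_nonneg _).trans h2
  have h3 : |r y| ≤ |r y - v y| + |v y| := by
    calc |r y| = |(r y - v y) + v y| := by ring_nf
      _ ≤ _ := abs_add_le _ _
  have h4 : ε ^ 2 * G y ≤ ε * G y := by
    calc ε ^ 2 * G y = ε * (ε * G y) := by ring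
      _ ≤ 1 * (ε * G y) := mul_le_mul_of_nonneg_right hE.le_one ((abs_nonneg _).trans h1)
      _ = ε * G y := one_mul _
  linarith

end IsLocalExpansion

/-- A local log-likelihood ratio of a triangular array with i.i.d. rows has a quadratic
expansion. -/
theorem IsRowIID.tendstoInMeasure_sum_log {Ω : Type*} [MeasurableSpace Ω] {P : Measure Ω}
    [IsProbabilityMeasure P] {Y : ℕ → ℕ → Ω → ℝ} {μ : Measure ℝ} [IsProbabilityMeasure μ]
    (hY : IsRowIID Y μ P) {G : ℝ → ℝ} (hG1 : ∀ y, 1 ≤ G y)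
    (hG4 : Integrable (fun y => G y ^ 4) μ) {ε : ℕ → ℝ} {r v L : ℕ → ℝ → ℝ} {B I : ℝ}
    (hE : ∀ᶠ n in atTop, IsLocalExpansion μ G (ε n) (r n) (v n))
    (hB : ∀ᶠ n : ℕ in atTop, n * ε n ^ 2 ≤ B) (hε : Tendsto ε atTop (𝓝 0))
    (hI : Tendsto (fun n : ℕ => n * ∫ y, v n y ^ 2 ∂μ) atTop (𝓝 I))
    (hL : ∀ᶠ n in atTop, ∀ y, |r n y| ≤ 1 / 2 → L n y = Real.log (1 + r n y)) :
    TendstoInMeasure P (fun n ω => ∑ j ∈ Finset.range n, L n (Y n j ω)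
      - (∑ j ∈ Finset.range n, v n (Y n j ω) - I / 2)) atTop (fun _ => 0) := by
  have dom : ∀ {f : ℝ → ℝ} (C : ℝ), 0 ≤ C → Measurable f → (∀ y, |f y| ≤ C * G y ^ 4) →
      Integrable f μ ∧ ∫ y, |f y| ∂μ ≤ C * ∫ y, G y ^ 4 ∂μ := by
    intro f C hC hf hb
    have hi : Integrable f μ := (hG4.const_mul C).mono' hf.aestronglyMeasurable (ae_of_all _ hb)
    refine ⟨hi, ?_⟩
    rw [← integral_const_mul]
    exact integral_mono hi.abs (hG4.const_mul C) hb
  have hGp : ∀ (k : ℕ) y, k ≤ 4 → G y ^ k ≤ G y ^ 4 := fun k y hk => pow_le_pow_right₀ (hG1 y) hk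
  have hG0 : ∀ y, 0 ≤ G y := fun y => zero_le_one.trans (hG1 y)
  set J := ∫ y, G y ^ 4 ∂μ with hJ
  -- a bound `C ε³ G⁴` on the summands makes the row sums negligible
  have hεB : ∀ C : ℝ, Tendsto (fun n : ℕ => (n : ℝ) * (C * ε n ^ 3 * J)) atTop (𝓝 0) := by
    intro C
    have h1 : Tendsto (fun n : ℕ => B * |C * J| * |ε n|) atTop (𝓝 0) := by
      simpa using (hε.abs).const_mul (B * |C * J|)
    refine squeeze_zero_norm' ?_ h1
    filter_upwards [hB] with n hn
    calc ‖(n : ℝ) * (C * ε n ^ 3 * J)‖ = (n * ε n ^ 2) * |C * J| * |ε n| := by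
          rw [Real.norm_eq_abs, show (n : ℝ) * (C * ε n ^ 3 * J) = (n * ε n ^ 2) * (C * J) * ε n
            by ring, abs_mul, abs_mul, abs_of_nonneg (by positivity : (0 : ℝ) ≤ n * ε n ^ 2)]
      _ ≤ B * |C * J| * |ε n| := by gcongr
  have small : ∀ {f : ℕ → ℝ → ℝ} (C : ℝ), 0 ≤ C →
      (∀ᶠ n in atTop, Measurable (f n) ∧ ∀ y, |f n y| ≤ C * ε n ^ 3 * G y ^ 4) →
      (∀ᶠ n in atTop, Measurable (f n) ∧ Integrable (f n) μ) ∧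
      Tendsto (fun n : ℕ => n * ∫ y, |f n y| ∂μ) atTop (𝓝 0) := by
    intro f C hC hf
    have hf' : ∀ᶠ n in atTop, Measurable (f n) ∧ Integrable (f n) μ ∧
        ∫ y, |f n y| ∂μ ≤ C * ε n ^ 3 * J := by
      filter_upwards [hf, hE] with n hn hEn
      have := hEn.nonneg
      have h2 := dom (C * ε n ^ 3) (by positivity) hn.1 hn.2
      exact ⟨hn.1, h2⟩
    refine ⟨hf'.mono fun n hn => ⟨hn.1, hn.2.1⟩, ?_⟩
    refine squeeze_zero' (Eventually.of_forall fun n => ?_) ?_ (hεB C)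
    · positivity
    · filter_upwards [hf'] with n hn
      exact mul_le_mul_of_nonneg_left hn.2.2 (by positivity)
  have hsq_int : ∀ᶠ n in atTop, Integrable (fun y => v n y ^ 2) μ ∧
      0 ≤ ∫ y, v n y ^ 2 ∂μ ∧ ∫ y, v n y ^ 2 ∂μ ≤ ε n ^ 2 * J := by
    filter_upwards [hE] with n hn
    have hb : ∀ y, |v n y ^ 2| ≤ ε n ^ 2 * G y ^ 4 := fun y => by
      rw [abs_pow]
      calc |v n y| ^ 2 ≤ (ε n * G y) ^ 2 := pow_le_pow_left₀ (abs_nonneg _) (hn.abs_v_le y) 2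
        _ = ε n ^ 2 * G y ^ 2 := by ring
        _ ≤ ε n ^ 2 * G y ^ 4 := mul_le_mul_of_nonneg_left (hGp 2 y (by norm_num)) (by positivity)
    have h2 := dom (ε n ^ 2) (by positivity) (hn.measurable_v.pow_const 2) hb
    refine ⟨h2.1, by positivity, ?_⟩
    refine le_trans (le_of_eq ?_) h2.2
    simp
  -- the remainder of the linearisation
  have T1 : TendstoInMeasure P (fun n ω => ∑ j ∈ Finset.range n, (r n (Y n j ω) - v n (Y n j ω)))
      atTop (fun _ => 0) := by
    have h1 : ∀ᶠ n in atTop, Measurable (fun y => (r n y - v n y) ^ 2) ∧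
        ∀ y, |(r n y - v n y) ^ 2| ≤ 1 * ε n ^ 3 * G y ^ 4 := by
      filter_upwards [hE] with n hn
      refine ⟨(hn.measurable_r.sub hn.measurable_v).pow_const 2, fun y => ?_⟩
      have h0 := hn.nonneg
      rw [abs_pow]
      calc |r n y - v n y| ^ 2 ≤ (ε n ^ 2 * G y) ^ 2 :=
            pow_le_pow_left₀ (abs_nonneg _) (hn.abs_sub_le y) 2
        _ = ε n ^ 4 * G y ^ 2 := by ring
        _ ≤ ε n ^ 3 * G y ^ 4 := mul_le_mul (pow_le_pow_of_le_one h0 hn.le_one (by norm_num))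
            (hGp 2 y (by norm_num)) (by positivity) (by positivity)
        _ = _ := by ring
    obtain ⟨h2, h3⟩ := small 1 zero_le_one h1
    refine hY.tendstoInMeasure_sum_of_integral_sq (f := fun n y => r n y - v n y) ?_
      (by simpa using h3)
    filter_upwards [h2, hE] with n hn hEn
    refine ⟨hEn.measurable_r.sub hEn.measurable_v, hn.2, ?_⟩
    have iv := dom (ε n) hEn.nonneg hEn.measurable_v fun y => (hEn.abs_v_le y).trans
      (mul_le_mul_of_nonneg_left (le_self_pow₀ (hG1 y) (by norm_num)) hEn.nonneg)
    have ir := dom (2 * ε n) (by linarith [hEn.nonneg]) hEn.measurable_r fun y =>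
      (hEn.abs_r_le y).trans
      (mul_le_mul_of_nonneg_left (le_self_pow₀ (hG1 y) (by norm_num)) (by linarith [hEn.nonneg]))
    rw [integral_sub ir.1 iv.1, hEn.integral_r, hEn.integral_v, sub_zero]
  have T2 : TendstoInMeasure P (fun n ω => ∑ j ∈ Finset.range n,
      (r n (Y n j ω) ^ 2 - v n (Y n j ω) ^ 2)) atTop (fun _ => 0) := by
    have h1 : ∀ᶠ n in atTop, Measurable (fun y => r n y ^ 2 - v n y ^ 2) ∧
        ∀ y, |r n y ^ 2 - v n y ^ 2| ≤ 3 * ε n ^ 3 * G y ^ 4 := by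
      filter_upwards [hE] with n hn
      refine ⟨(hn.measurable_r.pow_const 2).sub (hn.measurable_v.pow_const 2), fun y => ?_⟩
      have h0 := hn.nonneg
      have hg := hG0 y
      have ha : |r n y + v n y| ≤ 3 * (ε n * G y) := by
        linarith [abs_add_le (r n y) (v n y), hn.abs_v_le y, hn.abs_r_le y]
      calc |r n y ^ 2 - v n y ^ 2| = |r n y - v n y| * |r n y + v n y| := by
            rw [← abs_mul]; ring_nf
        _ ≤ (ε n ^ 2 * G y) * (3 * (ε n * G y)) :=
            mul_le_mul (hn.abs_sub_le y) ha (abs_nonneg _) (by positivity)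
        _ = 3 * ε n ^ 3 * G y ^ 2 := by ring
        _ ≤ 3 * ε n ^ 3 * G y ^ 4 :=
            mul_le_mul_of_nonneg_left (hGp 2 y (by norm_num)) (by positivity)
    obtain ⟨h2, h3⟩ := small 3 (by norm_num) h1
    exact hY.tendstoInMeasure_sum_of_integral_abs (f := fun n y => r n y ^ 2 - v n y ^ 2) h2 h3
  have T3 : TendstoInMeasure P (fun n ω => ∑ j ∈ Finset.range n,
      (v n (Y n j ω) ^ 2 - ∫ y, v n y ^ 2 ∂μ)) atTop (fun _ => 0) := by
    have h1 : ∀ᶠ n in atTop, Measurable (fun y => (v n y ^ 2 - ∫ y, v n y ^ 2 ∂μ) ^ 2) ∧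
        ∀ y, |(v n y ^ 2 - ∫ y, v n y ^ 2 ∂μ) ^ 2| ≤ (1 + J) ^ 2 * ε n ^ 3 * G y ^ 4 := by
      filter_upwards [hE, hsq_int] with n hn hsq
      refine ⟨((hn.measurable_v.pow_const 2).sub_const _).pow_const 2, fun y => ?_⟩
      have h0 := hn.nonneg
      have hJ0 : 0 ≤ J := by positivity
      have hg1 : 1 ≤ G y ^ 2 := one_le_pow₀ (hG1 y)
      have ha : |v n y ^ 2 - ∫ y, v n y ^ 2 ∂μ| ≤ (1 + J) * ε n ^ 2 * G y ^ 2 := by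
        have hv : |v n y ^ 2| ≤ ε n ^ 2 * G y ^ 2 := by
          rw [abs_pow]
          calc |v n y| ^ 2 ≤ (ε n * G y) ^ 2 := pow_le_pow_left₀ (abs_nonneg _) (hn.abs_v_le y) 2
            _ = _ := by ring
        have hm : |∫ y, v n y ^ 2 ∂μ| ≤ J * ε n ^ 2 * G y ^ 2 := by
          rw [abs_of_nonneg hsq.2.1]
          calc ∫ y, v n y ^ 2 ∂μ ≤ ε n ^ 2 * J := hsq.2.2
            _ = J * ε n ^ 2 * 1 := by ring
            _ ≤ J * ε n ^ 2 * G y ^ 2 := mul_le_mul_of_nonneg_left hg1 (by positivity)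
        calc |v n y ^ 2 - ∫ y, v n y ^ 2 ∂μ| ≤ |v n y ^ 2| + |∫ y, v n y ^ 2 ∂μ| := abs_sub _ _
          _ ≤ ε n ^ 2 * G y ^ 2 + J * ε n ^ 2 * G y ^ 2 := add_le_add hv hm
          _ = _ := by ring
      rw [abs_pow]
      calc |v n y ^ 2 - ∫ y, v n y ^ 2 ∂μ| ^ 2 ≤ ((1 + J) * ε n ^ 2 * G y ^ 2) ^ 2 :=
            pow_le_pow_left₀ (abs_nonneg _) ha 2
        _ = (1 + J) ^ 2 * ε n ^ 4 * G y ^ 4 := by ring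
        _ ≤ (1 + J) ^ 2 * ε n ^ 3 * G y ^ 4 := by
            refine mul_le_mul_of_nonneg_right ?_ (by positivity)
            exact mul_le_mul_of_nonneg_left (pow_le_pow_of_le_one h0 hn.le_one (by norm_num))
              (by positivity)
    obtain ⟨h2, h3⟩ := small ((1 + J) ^ 2) (by positivity) h1
    refine hY.tendstoInMeasure_sum_of_integral_sq
      (f := fun n y => v n y ^ 2 - ∫ y, v n y ^ 2 ∂μ) ?_ (by simpa using h3)
    filter_upwards [h2, hE, hsq_int] with n hn hEn hsq
    refine ⟨(hEn.measurable_v.pow_const 2).sub_const _, hn.2, ?_⟩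
    rw [integral_sub hsq.1 (integrable_const _)]
    simp
  -- the cubic remainder of the logarithm, on and off the event `|r| ≤ 1/2`
  set R : ℕ → ℝ → ℝ := fun n y => L n y - r n y + r n y ^ 2 / 2 with hR
  set A : ℕ → Set ℝ := fun n => {y | 1 / 2 < |r n y|} with hA
  have hAm : ∀ n, Measurable (r n) → MeasurableSet (A n) := fun n hn =>
    measurableSet_lt measurable_const hn.abs
  have hr3 : ∀ {n}, IsLocalExpansion μ G (ε n) (r n) (v n) → ∀ y,
      |r n y| ^ 3 ≤ 8 * ε n ^ 3 * G y ^ 4 := by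
    intro n hn y
    have h0 := hn.nonneg
    calc |r n y| ^ 3 ≤ (2 * ε n * G y) ^ 3 := pow_le_pow_left₀ (abs_nonneg _) (hn.abs_r_le y) 3
      _ = 8 * ε n ^ 3 * G y ^ 3 := by ring
      _ ≤ _ := mul_le_mul_of_nonneg_left (hGp 3 y (by norm_num)) (by positivity)
  have T4 : TendstoInMeasure P (fun n ω => ∑ j ∈ Finset.range n,
      (A n)ᶜ.indicator (R n) (Y n j ω)) atTop (fun _ => 0) := by
    have h1 : ∀ᶠ n in atTop, Measurable ((A n)ᶜ.indicator (R n)) ∧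
        ∀ y, |(A n)ᶜ.indicator (R n) y| ≤ 16 * ε n ^ 3 * G y ^ 4 := by
      filter_upwards [hE, hL] with n hn hLn
      have hRlog : (A n)ᶜ.indicator (R n) = (A n)ᶜ.indicator
          fun y => Real.log (1 + r n y) - r n y + r n y ^ 2 / 2 := by
        refine Set.indicator_congr fun y hy => ?_
        simp only [hR]
        rw [hLn y (not_lt.1 hy)]
      have hm := hn.measurable_r
      rw [hRlog]
      refine ⟨Measurable.indicator (by fun_prop) (hAm n hm).compl, fun y => ?_⟩
      have h3 := hr3 hn y
      by_cases hy : y ∈ A n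
      · rw [Set.indicator_of_notMem (by simpa using hy), abs_zero]
        have := pow_nonneg (abs_nonneg (r n y)) 3
        linarith
      · rw [Set.indicator_of_mem (by simpa using hy)]
        have := abs_log_one_add_sub_le (not_lt.1 hy)
        linarith
    obtain ⟨h2, h3⟩ := small 16 (by norm_num) h1
    exact hY.tendstoInMeasure_sum_of_integral_abs h2 h3
  have T5 : TendstoInMeasure P (fun n ω => ∑ j ∈ Finset.range n,
      (A n).indicator (R n) (Y n j ω)) atTop (fun _ => 0) := by
    rw [tendstoInMeasure_zero_iff]
    intro η hη
    have hlim := ENNReal.tendsto_ofReal (hεB 64)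
    rw [ENNReal.ofReal_zero] at hlim
    refine tendsto_of_tendsto_of_tendsto_of_le_of_le' tendsto_const_nhds hlim
      (Eventually.of_forall fun _ => zero_le) ?_
    filter_upwards [hE, eventually_gt_atTop 0] with n hn hn0
    refine (hY.measure_le_abs_sum_le_measure_ne hn0 (hAm n hn.measurable_r)
      (fun y hy => Set.indicator_of_notMem hy _) hη).trans ?_
    have h0 := hn.nonneg
    have d := dom (f := fun y => |r n y| ^ 3) (8 * ε n ^ 3) (by positivity)
      (hn.measurable_r.abs.pow_const 3) fun y => by
        rw [abs_pow, abs_abs]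
        exact hr3 hn y
    have m1 := mul_meas_ge_le_integral_of_nonneg (μ := μ) (f := fun y => |r n y| ^ 3)
      (ae_of_all _ fun y => pow_nonneg (abs_nonneg _) 3) d.1 (1 / 8)
    have m2 : μ.real (A n) ≤ μ.real {y | 1 / 8 ≤ |r n y| ^ 3} := by
      refine measureReal_mono fun y hy => ?_
      have hy' : 1 / 2 < |r n y| := hy
      have := pow_le_pow_left₀ (by norm_num) hy'.le 3
      refine le_trans (by norm_num) this
    have m3 : ∫ y, |r n y| ^ 3 ∂μ ≤ 8 * ε n ^ 3 * J := by
      refine le_trans (le_of_eq ?_) d.2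
      simp
    have m4 : μ.real (A n) ≤ 64 * ε n ^ 3 * J := by linarith
    rw [← ofReal_measureReal, ← ENNReal.ofReal_natCast, ← ENNReal.ofReal_mul (by positivity)]
    exact ENNReal.ofReal_le_ofReal (mul_le_mul_of_nonneg_left m4 (by positivity))
  have T6 : TendstoInMeasure P (fun n _ => -(1 / 2) * (n * ∫ y, v n y ^ 2 ∂μ - I)) atTop
      (fun _ => 0) := by
    refine tendstoInMeasure_zero_of_tendsto ?_
    have := (hI.sub_const I).const_mul (-(1 / 2))
    rwa [sub_self, mul_zero] at this
  have T := tendstoInMeasure_zero_add (tendstoInMeasure_zero_add (tendstoInMeasure_zero_add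
    (tendstoInMeasure_zero_add T1 (tendstoInMeasure_zero_const_mul (-(1 / 2)) T2))
    (tendstoInMeasure_zero_const_mul (-(1 / 2)) T3)) (tendstoInMeasure_zero_add T4 T5)) T6
  refine T.congr_left fun n => ae_of_all _ fun ω => ?_
  have e : ∑ j ∈ Finset.range n, (A n)ᶜ.indicator (R n) (Y n j ω)
      + ∑ j ∈ Finset.range n, (A n).indicator (R n) (Y n j ω)
      = ∑ j ∈ Finset.range n, R n (Y n j ω) := by
    rw [← Finset.sum_add_distrib]
    refine Finset.sum_congr rfl fun j _ => ?_
    rw [add_comm]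
    exact congrFun (Set.indicator_self_add_compl (A n) (R n)) _
  simp only
  rw [e]
  simp only [hR, Finset.sum_add_distrib, Finset.sum_sub_distrib, Finset.sum_const,
    Finset.card_range, nsmul_eq_mul, ← Finset.sum_div]
  ring

lemma charFun_map_eq_charFun_map_inner {Ω E : Type*} [MeasurableSpace Ω] [NormedAddCommGroup E]
    [InnerProductSpace ℝ E] [MeasurableSpace E] [BorelSpace E] [SecondCountableTopology E]
    {P : Measure Ω} {Z : Ω → E} (hZ : AEMeasurable Z P) (t : E) :
    charFun (P.map Z) t = charFun (P.map fun ω => inner ℝ (Z ω) t) 1 := by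
  rw [charFun_apply, charFun_apply, integral_map hZ (by fun_prop),
    integral_map (by fun_prop) (by fun_prop)]
  simp

/-- Powers of a characteristic function with mean zero and finite variance. -/
lemma tendsto_charFun_map_inv_sqrt_pow {μ : Measure ℝ} [IsProbabilityMeasure μ] {g : ℝ → ℝ}
    (hg : Measurable g) (hg2 : Integrable (fun y => g y ^ 2) μ) (h0 : ∫ y, g y ∂μ = 0) :
    Tendsto (fun n : ℕ => charFun (μ.map g) ((√n)⁻¹) ^ n) atTop
      (𝓝 (Complex.exp (-((∫ y, g y ^ 2 ∂μ : ℝ) : ℂ) / 2))) := by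
  set v := ∫ y, g y ^ 2 ∂μ with hv
  have hv0 : 0 ≤ v := by positivity
  rcases hv0.eq_or_lt with hz | hpos
  · have hae : g =ᵐ[μ] fun _ => 0 := by
      have := (integral_eq_zero_iff_of_nonneg (fun y => sq_nonneg (g y)) hg2).1 hz.symm
      filter_upwards [this] with y hy
      simpa using hy
    rw [← hz, Measure.map_congr hae]
    simp
  · have hs : 0 < √v := Real.sqrt_pos.2 hpos
    have h := tendsto_charFun_inv_sqrt_mul_pow (P := μ) (X := fun y => (√v)⁻¹ * g y)
      (by fun_prop) (by rw [integral_const_mul, h0, mul_zero]) (by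
        simp only [Pi.pow_apply, mul_pow]
        rw [integral_const_mul, inv_pow, Real.sq_sqrt hv0, inv_mul_cancel₀ hpos.ne']) (√v)
    have e : ∀ n : ℕ, charFun (μ.map fun y => (√v)⁻¹ * g y) ((√(n : ℝ))⁻¹ * √v) =
        charFun (μ.map g) ((√(n : ℝ))⁻¹) := by
      intro n
      rw [charFun_map_mul_comp hg.aemeasurable]
      congr 1
      field_simp
    simp_rw [e] at h
    convert h using 3
    rw [← Complex.ofReal_pow, Real.sq_sqrt hv0]

/-- Central limit theorem for a triangular array with identically distributed i.i.d. rows. -/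
theorem IsRowIID.tendstoInDistribution {Ω ι : Type*} [MeasurableSpace Ω] [Fintype ι]
    [DecidableEq ι] {P : Measure Ω} [IsProbabilityMeasure P] {Y : ℕ → ℕ → Ω → ℝ} {μ : Measure ℝ}
    [IsProbabilityMeasure μ] (hY : IsRowIID Y μ P) {V : ℝ → EuclideanSpace ℝ ι}
    (hV : Measurable V) {S : Matrix ι ι ℝ} (hS : S.PosSemidef)
    (h0 : ∀ t, ∫ y, inner ℝ (V y) t ∂μ = 0)
    (hint : ∀ t, Integrable (fun y => (inner ℝ (V y) t) ^ 2) μ)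
    (h2 : ∀ t : EuclideanSpace ℝ ι, ∫ y, (inner ℝ (V y) t) ^ 2 ∂μ =
      t.ofLp ⬝ᵥ S.mulVec t.ofLp) :
    TendstoInDistribution (fun (n : ℕ) ω => (√(n : ℝ))⁻¹ • ∑ j ∈ Finset.range n, V (Y n j ω)) atTop
      (id : EuclideanSpace ℝ ι → EuclideanSpace ℝ ι) (fun _ => P) (multivariateGaussian 0 S) := by
  have hYm := hY.measurable
  have hm : ∀ n : ℕ, Measurable
      fun ω => (√(n : ℝ))⁻¹ • ∑ j ∈ Finset.range n, V (Y n j ω) := fun n => by fun_prop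
  refine ⟨fun n => (hm n).aemeasurable, aemeasurable_id, ?_⟩
  refine ProbabilityMeasure.tendsto_iff_tendsto_charFun.2 fun t => ?_
  simp only [ProbabilityMeasure.coe_mk, Measure.map_id]
  rw [charFun_multivariateGaussian hS]
  have hlim := tendsto_charFun_map_inv_sqrt_pow (μ := μ) (g := fun y => inner ℝ (V y) t)
    (by fun_prop) (hint t) (h0 t)
  rw [h2 t] at hlim
  have e2 : Complex.exp (-((t.ofLp ⬝ᵥ S.mulVec t.ofLp : ℝ) : ℂ) / 2) =
      Complex.exp ((inner ℝ t 0 : ℝ) * Complex.I -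
        ((t.ofLp ⬝ᵥ S.mulVec t.ofLp : ℝ) : ℂ) / 2) := by
    congr 1
    simp
    ring
  rw [e2] at hlim
  refine hlim.congr' ?_
  filter_upwards [eventually_gt_atTop 0] with n hn
  have hg : Measurable fun y => inner ℝ (V y) t := by fun_prop
  rw [charFun_map_eq_charFun_map_inner (hm n).aemeasurable]
  have e3 : (fun ω => inner ℝ ((√(n : ℝ))⁻¹ • ∑ j ∈ Finset.range n, V (Y n j ω)) t) =
      fun ω => (√(n : ℝ))⁻¹ * ∑ j ∈ Finset.range n, inner ℝ (V (Y n j ω)) t := by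
    funext ω
    rw [real_inner_smul_left, sum_inner]
  have hind := (hY.indep n hn).comp (fun _ y => inner ℝ (V y) t) fun _ => hg
  have hmap : ∀ j, P.map (fun ω => inner ℝ (V (Y n j ω)) t) = μ.map fun y => inner ℝ (V y) t := by
    intro j
    rw [← hY.law n j hn, Measure.map_map hg (hYm n j)]
    rfl
  have e4 := charFun_inv_sqrt_mul_sum (X := fun j ω => inner ℝ (V (Y n j ω)) t) (P := P) hind
    (fun i => ⟨by fun_prop, by fun_prop, by rw [hmap, hmap]⟩) (n := n) (t := 1)
  rw [e3, e4, hmap, mul_one]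

/-- A continuous `n`-th root of unity on `ℝ` is constant. -/
lemma eq_one_of_continuous_of_pow_eq_one {g : ℝ → ℂ} (hg : Continuous g) {n : ℕ} (hn : 0 < n)
    (h : ∀ u, g u ^ n = 1) (h0 : g 0 = 1) (u : ℝ) : g u = 1 := by
  have hfin : {z : ℂ | z ^ n = 1}.Finite := by
    refine (Polynomial.nthRoots n (1 : ℂ)).toFinset.finite_toSet.subset fun z hz => ?_
    simpa [Polynomial.mem_nthRoots hn] using hz
  obtain ⟨y, -, hy⟩ := isPreconnected_univ.eqOn_const_of_mapsTo hfin.isDiscrete hg.continuousOn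
    (fun u _ => h u) ⟨1, one_pow n⟩
  rw [hy (Set.mem_univ u), ← h0, hy (Set.mem_univ 0)]
  rfl

namespace IsLevyProcess

variable {Ω : Type*} [MeasurableSpace Ω] {P : Measure Ω} {X : ℝ≥0 → Ω → ℝ}

lemma charFun_increment (hX : IsLevyProcess X P) (s t : ℝ≥0) :
    charFun (P.map fun ω => X (s + t) ω - X s ω) = charFun (P.map (X t)) := by
  rw [← (hX.stationary_increments s t).map_eq]
  rfl

lemma charFun_add [IsProbabilityMeasure P] (hX : IsLevyProcess X P) (s t : ℝ≥0) (u : ℝ) :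
    charFun (P.map (X (s + t))) u = charFun (P.map (X s)) u * charFun (P.map (X t)) u := by
  have hm := hX.measurable
  have hind : X s ⟂ᵢ[P] (X (s + t) - X s) :=
    hX.indep_increments.indepFun_eval_sub (zero_le) le_self_add hX.start_zero
  have h := hind.charFun_map_add_eq_mul (hm s).aemeasurable ((hm _).sub (hm s)).aemeasurable
  rw [add_sub_cancel, (hX.stationary_increments s t).map_eq] at h
  rw [h]
  rfl

lemma charFun_zero_time [IsProbabilityMeasure P] (hX : IsLevyProcess X P) (u : ℝ) : charFun (P.map (X 0)) u = 1 := by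
  have h : X 0 =ᵐ[P] fun _ => 0 := hX.start_zero
  rw [Measure.map_congr h]
  simp

lemma charFun_nat_mul [IsProbabilityMeasure P] (hX : IsLevyProcess X P) (k : ℕ) (t : ℝ≥0) (u : ℝ) :
    charFun (P.map (X (k * t))) u = charFun (P.map (X t)) u ^ k := by
  induction k with
  | zero => simp [hX.charFun_zero_time]
  | succ k ih =>
    rw [pow_succ, ← ih, ← hX.charFun_add]
    congr 4
    push_cast
    ring

lemma tendsto_charFun [IsProbabilityMeasure P] (hX : IsLevyProcess X P) {s : ℕ → ℝ≥0} {t : ℝ≥0}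
    (hs : Tendsto s atTop (𝓝 t)) (u : ℝ) :
    Tendsto (fun n => charFun (P.map (X (s n))) u) atTop (𝓝 (charFun (P.map (X t)) u)) := by
  have h1 := ((hX.continuous_in_probability t).comp hs).tendstoInDistribution
    fun i => (hX.measurable _).aemeasurable
  exact ProbabilityMeasure.tendsto_iff_tendsto_charFun.1 h1.tendsto u

/-- The characteristic function of a Lévy process at time `t`, when the one at time `1` is
`exp ∘ ψ` with `ψ` continuous and `ψ 0 = 0`. -/
lemma charFun_eq_exp [IsProbabilityMeasure P] (hX : IsLevyProcess X P) {ψ : ℝ → ℂ} (hψ : Continuous ψ) (hψ0 : ψ 0 = 0)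
    (h1 : ∀ u, charFun (P.map (X 1)) u = Complex.exp (ψ u)) (t : ℝ≥0) (u : ℝ) :
    charFun (P.map (X t)) u = Complex.exp (t * ψ u) := by
  have hprob : ∀ s, IsProbabilityMeasure (P.map (X s)) := fun s =>
    Measure.isProbabilityMeasure_map (hX.measurable s).aemeasurable
  have hroot : ∀ (n : ℕ), 0 < n → ∀ u : ℝ,
      charFun (P.map (X (n : ℝ≥0)⁻¹)) u = Complex.exp (ψ u / n) := by
    intro n hn u
    have hn' : (n : ℂ) ≠ 0 := by exact_mod_cast hn.ne'
    have hcont : Continuous fun u : ℝ =>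
        charFun (P.map (X (n : ℝ≥0)⁻¹)) u * Complex.exp (-(ψ u / n)) := by
      have : Continuous (charFun (P.map (X (n : ℝ≥0)⁻¹))) := continuous_charFun
      fun_prop
    have hone := eq_one_of_continuous_of_pow_eq_one hcont hn (fun u => by
      rw [mul_pow, ← hX.charFun_nat_mul, mul_inv_cancel₀ (by exact_mod_cast hn.ne'), h1,
        ← Complex.exp_nat_mul, ← Complex.exp_add]
      rw [mul_neg, mul_div_cancel₀ _ hn']
      simp) (by simp [hψ0]) u
    calc charFun (P.map (X (n : ℝ≥0)⁻¹)) u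
        = charFun (P.map (X (n : ℝ≥0)⁻¹)) u * Complex.exp (-(ψ u / n)) * Complex.exp (ψ u / n) := by
          rw [mul_assoc, ← Complex.exp_add]
          simp
      _ = Complex.exp (ψ u / n) := by rw [hone, one_mul]
  have hfloor : Tendsto (fun n : ℕ => (⌊(t : ℝ) * n⌋₊ : ℝ) / n) atTop (𝓝 (t : ℝ)) :=
    (tendsto_nat_floor_mul_div_atTop t.2).comp tendsto_natCast_atTop_atTop
  have hs : Tendsto (fun n : ℕ => (⌊(t : ℝ) * n⌋₊ : ℝ≥0) * (n : ℝ≥0)⁻¹) atTop (𝓝 t) := by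
    rw [← NNReal.tendsto_coe]
    refine hfloor.congr fun n => ?_
    push_cast
    rfl
  have h2 := hX.tendsto_charFun hs u
  refine tendsto_nhds_unique h2 ?_
  have h3 : Tendsto (fun n : ℕ => Complex.exp ((((⌊(t : ℝ) * n⌋₊ : ℝ) / n : ℝ) : ℂ) * ψ u)) atTop
      (𝓝 (Complex.exp (((t : ℝ) : ℂ) * ψ u))) := by
    refine (Complex.continuous_exp.tendsto _).comp ?_
    exact ((Complex.continuous_ofReal.tendsto _).comp hfloor).mul_const _
  refine h3.congr' ?_
  filter_upwards [eventually_gt_atTop 0] with n hn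
  rw [hX.charFun_nat_mul, hroot n hn, ← Complex.exp_nat_mul]
  congr 1
  push_cast
  ring

end IsLevyProcess

/-- The normalised increments of a path. -/
def normIncrement (θ : Fin 3 → ℝ) (x : ℝ≥0 → ℝ) (δ : ℝ≥0) (j : ℕ) : ℝ :=
  (increment x δ j - θ 2 * δ) / (θ 1 * (δ : ℝ) ^ (1 / θ 0))

namespace IsSymStableLevy

variable {Ω : Type*} [MeasurableSpace Ω] {P : Measure Ω} {X : ℝ≥0 → Ω → ℝ} {θ : Fin 3 → ℝ}

lemma charFun_eq [IsProbabilityMeasure P] (hX : IsSymStableLevy X P θ) (hβ : 0 < θ 0) (t : ℝ≥0) (u : ℝ) :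
    charFun (P.map (X t)) u =
      Complex.exp (t * (-(((θ 1 * |u|) ^ θ 0 : ℝ) : ℂ) + Complex.I * θ 2 * u)) := by
  refine hX.toIsLevyProcess.charFun_eq_exp
    (ψ := fun u => -(((θ 1 * |u|) ^ θ 0 : ℝ) : ℂ) + Complex.I * θ 2 * u) ?_ ?_ hX.charFun_one t u
  · have : Continuous fun u : ℝ => (θ 1 * |u|) ^ θ 0 :=
      Continuous.rpow_const (by fun_prop) fun _ => Or.inr hβ.le
    fun_prop
  · simp [Real.zero_rpow hβ.ne']

lemma measurable_normIncrement (hX : IsSymStableLevy X P θ) (δ : ℝ≥0) (j : ℕ) :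
    Measurable fun ω => normIncrement θ (fun t => X t ω) δ j := by
  have h := hX.measurable
  unfold normIncrement increment
  fun_prop

lemma charFun_normIncrement [IsProbabilityMeasure P] (hX : IsSymStableLevy X P θ) (hβ : 0 < θ 0) (hσ : 0 < θ 1) {δ : ℝ≥0}
    (hδ : 0 < δ) (j : ℕ) (u : ℝ) :
    charFun (P.map fun ω => normIncrement θ (fun t => X t ω) δ j) u =
      Complex.exp (-((|u| ^ θ 0 : ℝ) : ℂ)) := by
  have hm := hX.measurable
  have hδ' : (0 : ℝ) < δ := hδ
  set τ : ℝ := θ 1 * (δ : ℝ) ^ (1 / θ 0) with hτ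
  have hτ0 : 0 < τ := mul_pos hσ (Real.rpow_pos_of_pos hδ' _)
  have hinc : charFun (P.map fun ω => increment (fun t => X t ω) δ j) = charFun (P.map (X δ)) := by
    rw [← hX.toIsLevyProcess.charFun_increment (j * δ) δ]
    congr 3
    funext ω
    rw [increment, add_mul, one_mul]
  have hincm : Measurable fun ω => increment (fun t => X t ω) δ j := by
    unfold increment
    fun_prop
  have e1 : (fun ω => normIncrement θ (fun t => X t ω) δ j) =
      fun ω => τ⁻¹ * (increment (fun t => X t ω) δ j + -(θ 2 * δ)) := by
    funext ω
    rw [normIncrement, ← hτ]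
    ring
  have e2 : (P.map fun ω => increment (fun t => X t ω) δ j + -(θ 2 * δ)) =
      (P.map fun ω => increment (fun t => X t ω) δ j).map fun x => x + -(θ 2 * δ) := by
    rw [Measure.map_map (by fun_prop) hincm]
    rfl
  rw [e1, charFun_map_mul_comp (hincm.add_const _).aemeasurable, e2, charFun_map_add_const, hinc, hX.charFun_eq hβ,
    ← Complex.exp_add]
  congr 1
  have e3 : (δ : ℝ) * (θ 1 * |τ⁻¹ * u|) ^ θ 0 = |u| ^ θ 0 := by
    rw [abs_mul, abs_of_pos (inv_pos.2 hτ0), hτ, mul_inv, ← Real.rpow_neg hδ'.le]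
    rw [show θ 1 * ((θ 1)⁻¹ * (δ : ℝ) ^ (-(1 / θ 0)) * |u|) = (δ : ℝ) ^ (-(1 / θ 0)) * |u| by
      field_simp, Real.mul_rpow (Real.rpow_nonneg hδ'.le _) (abs_nonneg u), ← Real.rpow_mul hδ'.le]
    rw [show -(1 / θ 0) * θ 0 = -1 by field_simp, Real.rpow_neg_one]
    field_simp
  rw [← e3]
  simp only [RCLike.inner_apply, conj_trivial]
  push_cast
  ring

/-- The normalised increments form a triangular array with i.i.d. standard stable rows. -/
lemma exists_isRowIID [IsProbabilityMeasure P] (hX : IsSymStableLevy X P θ) (hβ : 0 < θ 0) (hβ2 : θ 0 < 2) (hσ : 0 < θ 1)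
    {h : ℕ → ℝ≥0} (h_pos : ∀ n, 0 < n → 0 < h n) :
    ∃ μ : Measure ℝ, IsStdStable (θ 0) μ ∧
      IsRowIID (fun n j ω => normIncrement θ (fun t => X t ω) (h n) j) μ P := by
  have hm := hX.measurable_normIncrement
  have hprob : ∀ n j, IsProbabilityMeasure
      (P.map fun ω => normIncrement θ (fun t => X t ω) (h n) j) := fun n j =>
    Measure.isProbabilityMeasure_map (hm _ _).aemeasurable
  refine ⟨P.map fun ω => normIncrement θ (fun t => X t ω) (h 1) 0, ⟨hβ, hβ2, hprob 1 0,
    hX.charFun_normIncrement hβ hσ (h_pos 1 one_pos) 0⟩, fun n j => hm _ _, fun n hn => ?_,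
    fun n j hn => ?_⟩
  · have hmono : Monotone fun j : ℕ => (j : ℝ≥0) * h n := fun i j hij => by
      simp only
      gcongr
    have h1 := hX.indep_increments.nat hmono
    have h2 := h1.comp (fun _ x => (x - θ 2 * (h n : ℝ)) / (θ 1 * (h n : ℝ) ^ (1 / θ 0)))
      fun _ => by fun_prop
    convert! h2 using 1
    funext j ω
    simp [normIncrement, increment]
  · refine Measure.ext_of_charFun (funext fun u => ?_)
    rw [hX.charFun_normIncrement hβ hσ (h_pos n hn), hX.charFun_normIncrement hβ hσ (h_pos 1 one_pos)]

end IsSymStableLevy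

/-- The derivative of the log-density along a curve in the index, scale and argument. -/
lemma hasDerivAt_log_density {b τ x : ℝ → ℝ} {b' τ' x' t : ℝ} (hb : HasDerivAt b b' t)
    (hτ : HasDerivAt τ τ' t) (hx : HasDerivAt x x' t) (hb0 : 0 < b t) (hτ0 : 0 < τ t)
    (hpos : 0 < stdDensity (b t) (x t / τ t)) :
    HasDerivAt (fun s => Real.log (density (b s) (τ s) (x s)))
      (b' * scoreIndex (b t) (x t / τ t) + τ' / τ t * scoreScale (b t) (x t / τ t)
        + -(x' / τ t) * scoreLoc (b t) (x t / τ t)) t := by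
  set y := x t / τ t with hy
  have h1 : HasDerivAt (fun s => x s / τ s) ((x' * τ t - x t * τ') / τ t ^ 2) t :=
    hx.div hτ hτ0.ne'
  have h2 := ((hasDerivAt_stInt_comp 0 0 0 hb0 hb h1).const_mul (1 / Real.pi))
  have h3 := (hτ.inv hτ0.ne').mul h2
  have e0 : 1 / Real.pi * stInt 0 0 0 (b t) y = stdDensity (b t) y := (stdDensity_eq hb0 y).symm
  have hne : (τ t)⁻¹ * (1 / Real.pi * stInt 0 0 0 (b t) y) ≠ 0 := by
    rw [e0]
    positivity
  have h4 := h3.log hne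
  have hev : (fun s => Real.log (density (b s) (τ s) (x s))) =ᶠ[𝓝 t]
      fun s => Real.log ((τ s)⁻¹ * (1 / Real.pi * stInt 0 0 0 (b s) (x s / τ s))) := by
    filter_upwards [hb.continuousAt.eventually (lt_mem_nhds hb0),
      hτ.continuousAt.eventually (lt_mem_nhds hτ0)] with s hs1 hs2
    rw [density_eq hs1 hs2, stdDensity_eq hs1]
  refine (h4.congr_of_eventuallyEq hev).congr_deriv ?_
  have e := mul_stInt_succ 0 0 0 hb0 y
  simp only [zero_add, Nat.cast_zero, zero_mul, add_zero, one_mul, zero_sub] at e ⊢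
  simp only [Pi.inv_apply, Pi.mul_apply]
  rw [← hy, e0, scoreIndex, scoreScale, scoreLoc]
  have hx2 : x t = y * τ t := by rw [hy]; field_simp
  have hE : b t * stInt 0 1 0 (b t) y = y * stInt 0 0 1 (b t) y + Real.pi * stdDensity (b t) y := by
    rw [e, ← e0]
    field_simp
    ring
  rw [hE, hx2]
  field_simp
  ring

/-- The per-observation scores. -/
lemma gradLogLik_eq {θ : Fin 3 → ℝ} (hβ : 0 < θ 0) (hσ : 0 < θ 1)
    (hpos : ∀ y, 0 < stdDensity (θ 0) y) (x : ℝ≥0 → ℝ) {δ : ℝ≥0} (hδ : 0 < δ) (n : ℕ) :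
    gradLogLik x δ n θ = ![
      ∑ j ∈ Finset.range n, (scoreIndex (θ 0) (normIncrement θ x δ j)
        + Real.log (1 / δ) / θ 0 ^ 2 * scoreScale (θ 0) (normIncrement θ x δ j)),
      ∑ j ∈ Finset.range n, 1 / θ 1 * scoreScale (θ 0) (normIncrement θ x δ j),
      ∑ j ∈ Finset.range n,
        (δ : ℝ) ^ (1 - 1 / θ 0) / θ 1 * scoreLoc (θ 0) (normIncrement θ x δ j)] := by
  have hδ' : (0 : ℝ) < δ := hδ
  have hp : 0 < (δ : ℝ) ^ (1 / θ 0) := Real.rpow_pos_of_pos hδ' _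
  have hτ0 : 0 < θ 1 * (δ : ℝ) ^ (1 / θ 0) := mul_pos hσ hp
  funext k
  fin_cases k
  · simp only [gradLogLik, logLik, Fin.zero_eta, Function.update_self, Fin.isValue,
      Matrix.cons_val_zero, ne_eq, one_ne_zero, not_false_eq_true, Function.update_of_ne,
      Fin.reduceEq]
    refine (HasDerivAt.fun_sum fun j _ => ?_).deriv
    have h1 : HasDerivAt (fun s : ℝ => θ 1 * (δ : ℝ) ^ (1 / s))
        (θ 1 * ((δ : ℝ) ^ (1 / θ 0) * Real.log δ * (-1 / θ 0 ^ 2))) (θ 0) := by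
      have h2 : HasDerivAt (fun s : ℝ => 1 / s) (-1 / θ 0 ^ 2) (θ 0) := by
        simpa [div_eq_mul_inv] using hasDerivAt_inv hβ.ne'
      have h3 := (Real.hasStrictDerivAt_const_rpow hδ' (1 / θ 0)).hasDerivAt.comp (θ 0) h2
      exact h3.const_mul _
    have h4 := hasDerivAt_log_density (hasDerivAt_id (θ 0)) h1
      (hasDerivAt_const (θ 0) (increment x δ j - θ 2 * δ)) hβ hτ0 (hpos _)
    refine h4.congr_deriv ?_
    simp only [id_eq, ← normIncrement.eq_1]
    rw [one_div (δ : ℝ), Real.log_inv]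
    field_simp
    ring
  · simp only [gradLogLik, logLik, Fin.mk_one, Function.update_self, Fin.isValue,
      Matrix.cons_val_one, ne_eq, zero_ne_one, not_false_eq_true, Function.update_of_ne,
      Fin.reduceEq]
    refine (HasDerivAt.fun_sum fun j _ => ?_).deriv
    have h1 : HasDerivAt (fun s : ℝ => s * (δ : ℝ) ^ (1 / θ 0)) (1 * (δ : ℝ) ^ (1 / θ 0)) (θ 1) :=
      (hasDerivAt_id (θ 1)).mul_const _
    have h4 := hasDerivAt_log_density (hasDerivAt_const (θ 1) (θ 0)) h1
      (hasDerivAt_const (θ 1) (increment x δ j - θ 2 * δ)) hβ hτ0 (hpos _)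
    refine h4.congr_deriv ?_
    simp only [← normIncrement.eq_1]
    field_simp
    ring
  · simp only [gradLogLik, logLik, Fin.reduceFinMk, Function.update_self, Fin.isValue,
      Matrix.cons_val, ne_eq, not_false_eq_true, Function.update_of_ne, Fin.reduceEq]
    refine (HasDerivAt.fun_sum fun j _ => ?_).deriv
    have h1 : HasDerivAt (fun s : ℝ => increment x δ j - s * δ) (-(1 * (δ : ℝ))) (θ 2) :=
      ((hasDerivAt_id (θ 2)).mul_const _).const_sub _
    have h4 := hasDerivAt_log_density (hasDerivAt_const (θ 2) (θ 0))
      (hasDerivAt_const (θ 2) (θ 1 * (δ : ℝ) ^ (1 / θ 0))) h1 hβ hτ0 (hpos _)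
    refine h4.congr_deriv ?_
    simp only [← normIncrement.eq_1]
    rw [Real.rpow_sub hδ', Real.rpow_one]
    field_simp
    ring

/-- The density at parameter `θ'` of one observation, in terms of the increment normalised at
`θ`. -/
lemma density_eq_shiftedDensity {θ θ' : Fin 3 → ℝ} (hσ : 0 < θ 1) (hβ' : 0 < θ' 0)
    (hσ' : 0 < θ' 1) (x : ℝ≥0 → ℝ) {δ : ℝ≥0} (hδ : 0 < δ) (j : ℕ) :
    density (θ' 0) (θ' 1 * (δ : ℝ) ^ (1 / θ' 0)) (increment x δ j - θ' 2 * δ) =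
      (θ 1 * (δ : ℝ) ^ (1 / θ 0))⁻¹ * shiftedDensity (θ 0) (θ' 0 - θ 0)
      (θ' 1 * (δ : ℝ) ^ (1 / θ' 0) / (θ 1 * (δ : ℝ) ^ (1 / θ 0)) - 1)
      ((θ' 2 - θ 2) * δ / (θ 1 * (δ : ℝ) ^ (1 / θ 0))) (normIncrement θ x δ j) := by
  have hδ' : (0 : ℝ) < δ := hδ
  set τ := θ 1 * (δ : ℝ) ^ (1 / θ 0) with hτ
  set τ' := θ' 1 * (δ : ℝ) ^ (1 / θ' 0) with hτ'
  have hτ0 : 0 < τ := mul_pos hσ (Real.rpow_pos_of_pos hδ' _)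
  have hτ0' : 0 < τ' := mul_pos hσ' (Real.rpow_pos_of_pos hδ' _)
  have e1 : (increment x δ j - θ 2 * δ) / τ = normIncrement θ x δ j := rfl
  have e2 : (normIncrement θ x δ j - (θ' 2 - θ 2) * δ / τ) / (1 + (τ' / τ - 1)) =
      (increment x δ j - θ' 2 * δ) / τ' := by
    rw [add_sub_cancel, ← e1]
    field_simp
    ring
  rw [density_eq hβ' hτ0', shiftedDensity, e2, add_sub_cancel, add_sub_cancel]
  field_simp

lemma log_shiftedDensity_sub {β δ₁ δ₂ δ₃ y τ : ℝ} (hτ : 0 < τ) (hpos : 0 < stdDensity β y)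
    (hr : |ratioIncr β δ₁ δ₂ δ₃ y| ≤ 1 / 2) :
    Real.log (τ⁻¹ * shiftedDensity β δ₁ δ₂ δ₃ y) - Real.log (τ⁻¹ * stdDensity β y) =
      Real.log (1 + ratioIncr β δ₁ δ₂ δ₃ y) := by
  have h1 : shiftedDensity β δ₁ δ₂ δ₃ y = (1 + ratioIncr β δ₁ δ₂ δ₃ y) * stdDensity β y := by
    rw [ratioIncr]
    field_simp
    ring
  have h2 : 0 < 1 + ratioIncr β δ₁ δ₂ δ₃ y := by linarith [neg_abs_le (ratioIncr β δ₁ δ₂ δ₃ y)]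
  rw [h1, ← Real.log_div (by positivity) (by positivity)]
  congr 1
  field_simp

/-- The relative scale under a local change of the index and the scale, where `ε` is the size of
the change and `L` is the logarithm of the inverse step. -/
def scaleRatio (β σ u₁ u₂ ε L : ℝ) : ℝ :=
  (1 + u₂ / σ * ε) * Real.exp (L * (1 / β - 1 / (β + u₁ * (ε / L))))

lemma exists_abs_scaleRatio_sub_le {β : ℝ} (hβ : 0 < β) (σ u₁ u₂ : ℝ) :
    ∃ C ε₀ : ℝ, 0 ≤ C ∧ 0 < ε₀ ∧ ∀ ε L : ℝ, 0 ≤ ε → ε ≤ ε₀ → 1 ≤ L →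
      |scaleRatio β σ u₁ u₂ ε L - 1 - ε * (u₁ / β ^ 2 + u₂ / σ)| ≤ C * ε ^ 2 := by
  set B := 2 * |u₁| / β ^ 2 with hB
  have hB0 : 0 ≤ B := by positivity
  refine ⟨B ^ 2 + 2 * u₁ ^ 2 / β ^ 3 + |u₂ / σ| * (2 * B), min (β / (2 * (|u₁| + 1))) (1 / (B + 1)),
    by positivity, by positivity, fun ε L hε hε₀ hL => ?_⟩
  have h1 : ε * (2 * (|u₁| + 1)) ≤ β := (le_div_iff₀ (by positivity)).1 (hε₀.trans (min_le_left _ _))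
  have h2 : ε * (B + 1) ≤ 1 := (le_div_iff₀ (by positivity)).1 (hε₀.trans (min_le_right _ _))
  have hL0 : 0 < L := by linarith
  set q := u₁ * (ε / L) with hq
  have hq1 : |q| ≤ |u₁| * ε := by
    rw [hq, abs_mul, abs_of_nonneg (by positivity : 0 ≤ ε / L)]
    exact mul_le_mul_of_nonneg_left (div_le_self hε hL) (abs_nonneg _)
  have hq2 : β / 2 ≤ β + q := by nlinarith [neg_abs_le q]
  have hq0 : 0 < β + q := by linarith
  set w := L * (1 / β - 1 / (β + q)) with hw
  have hw1 : w = u₁ * ε / (β * (β + q)) := by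
    have : q * L = u₁ * ε := by rw [hq]; field_simp
    rw [hw, ← this]
    field_simp
    ring
  have hw2 : |w| ≤ B * ε := by
    rw [hw1, abs_div, abs_mul, abs_of_nonneg hε, abs_of_pos (by positivity : 0 < β * (β + q)), hB,
      div_le_iff₀ (by positivity)]
    calc |u₁| * ε = 2 * |u₁| / β ^ 2 * ε * (β * (β / 2)) := by field_simp
      _ ≤ 2 * |u₁| / β ^ 2 * ε * (β * (β + q)) := by
          refine mul_le_mul_of_nonneg_left ?_ (by positivity)
          exact mul_le_mul_of_nonneg_left hq2 hβ.le
  have hw3 : |w| ≤ 1 := by nlinarith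
  have hw4 : |w - u₁ * ε / β ^ 2| ≤ 2 * u₁ ^ 2 / β ^ 3 * ε ^ 2 := by
    have e : w - u₁ * ε / β ^ 2 = -(u₁ * ε * q / (β ^ 2 * (β + q))) := by
      rw [hw1]
      field_simp
      ring
    rw [e, abs_neg, abs_div, abs_mul, abs_mul, abs_of_nonneg hε,
      abs_of_pos (by positivity : 0 < β ^ 2 * (β + q)), div_le_iff₀ (by positivity)]
    calc |u₁| * ε * |q| ≤ |u₁| * ε * (|u₁| * ε) := mul_le_mul_of_nonneg_left hq1 (by positivity)
      _ = 2 * u₁ ^ 2 / β ^ 3 * ε ^ 2 * (β ^ 2 * (β / 2)) := by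
          rw [← sq_abs u₁]
          field_simp
      _ ≤ 2 * u₁ ^ 2 / β ^ 3 * ε ^ 2 * (β ^ 2 * (β + q)) := by
          refine mul_le_mul_of_nonneg_left ?_ (by positivity)
          exact mul_le_mul_of_nonneg_left hq2 (by positivity)
  have hx1 : |Real.exp w - 1 - w| ≤ B ^ 2 * ε ^ 2 := by
    refine (Real.abs_exp_sub_one_sub_id_le hw3).trans ?_
    rw [← sq_abs, ← mul_pow]
    exact pow_le_pow_left₀ (abs_nonneg _) hw2 2
  have hx2 : |u₂ / σ * ε * (Real.exp w - 1)| ≤ |u₂ / σ| * (2 * B) * ε ^ 2 := by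
    rw [abs_mul, abs_mul, abs_of_nonneg hε]
    calc |u₂ / σ| * ε * |Real.exp w - 1| ≤ |u₂ / σ| * ε * (2 * (B * ε)) := by
          refine mul_le_mul_of_nonneg_left ?_ (by positivity)
          exact (Real.abs_exp_sub_one_le hw3).trans (by linarith)
      _ = _ := by ring
  have e : scaleRatio β σ u₁ u₂ ε L - 1 - ε * (u₁ / β ^ 2 + u₂ / σ) =
      (Real.exp w - 1 - w) + (w - u₁ * ε / β ^ 2) + u₂ / σ * ε * (Real.exp w - 1) := by
    rw [scaleRatio, ← hq, ← hw]
    ring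
  rw [e]
  refine (abs_add_three _ _ _).trans ?_
  linarith

lemma tendsto_inv_sqrt : Tendsto (fun n : ℕ => (√(n : ℝ))⁻¹) atTop (𝓝 0) :=
  tendsto_inv_atTop_zero.comp (Real.tendsto_sqrt_atTop.comp tendsto_natCast_atTop_atTop)

namespace IsStdStable

variable {β : ℝ} {μ : Measure ℝ} (h : IsStdStable β μ)
include h

lemma tendsto_integral_scoreComb_sq {c : ℕ → ℝ} (hc : Tendsto c atTop (𝓝 0)) (c₂ c₃ : ℝ) :
    Tendsto (fun n => ∫ y, scoreComb β (c n) c₂ c₃ y ^ 2 ∂μ) atTop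
      (𝓝 (c₂ ^ 2 * constH β + c₃ ^ 2 * constM β)) := by
  rw [← h.integral_scoreComb_sq]
  obtain ⟨G, ρ, -, -, -, -, h1, h4, hI, hS, hL, -⟩ := h.exists_envelope
  refine tendsto_integral_filter_of_dominated_convergence
    (fun y => (1 + |c₂| + |c₃|) ^ 2 * G y ^ 4)
    (Eventually.of_forall fun n => ((h.measurable_scoreComb _ _ _).pow_const 2).aestronglyMeasurable)
    ?_ (h4.const_mul _) (ae_of_all _ fun y => ?_)
  · filter_upwards [(tendsto_order.1 hc.abs).2 1 (by simp)] with n hn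
    refine ae_of_all _ fun y => ?_
    have hG := h1 y
    have hb : |scoreComb β (c n) c₂ c₃ y| ≤ (1 + |c₂| + |c₃|) * G y := by
      refine (abs_add_three _ _ _).trans ?_
      rw [abs_mul, abs_mul, abs_mul]
      have a1 := mul_le_mul hn.le (hI y) (abs_nonneg _) zero_le_one
      have a2 := mul_le_mul_of_nonneg_left (hS y) (abs_nonneg c₂)
      have a3 := mul_le_mul_of_nonneg_left (hL y) (abs_nonneg c₃)
      linarith
    rw [norm_pow, Real.norm_eq_abs]
    calc |scoreComb β (c n) c₂ c₃ y| ^ 2 ≤ ((1 + |c₂| + |c₃|) * G y) ^ 2 :=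
          pow_le_pow_left₀ (abs_nonneg _) hb 2
      _ = (1 + |c₂| + |c₃|) ^ 2 * G y ^ 2 := by ring
      _ ≤ (1 + |c₂| + |c₃|) ^ 2 * G y ^ 4 :=
          mul_le_mul_of_nonneg_left (pow_le_pow_right₀ hG (by norm_num)) (by positivity)
  · have : Tendsto (fun n => scoreComb β (c n) c₂ c₃ y) atTop (𝓝 (scoreComb β 0 c₂ c₃ y)) := by
      simp only [scoreComb]
      exact ((hc.mul_const _).add_const _).add_const _
    exact this.pow 2

lemma integrable_scoreComb_sq (c₁ c₂ c₃ : ℝ) :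
    Integrable (fun y => scoreComb β c₁ c₂ c₃ y ^ 2) μ := by
  obtain ⟨G, ρ, -, -, -, -, h1, h4, hI, hS, hL, -⟩ := h.exists_envelope
  have m1 := h.measurable_scoreIndex
  have m2 := h.measurable_scoreScale
  have m3 := h.measurable_scoreLoc
  have i12 := integrable_mul_of_envelope h1 h4 m1 m2 hI hS
  have i13 := integrable_mul_of_envelope h1 h4 m1 m3 hI hL
  have i23 := integrable_mul_of_envelope h1 h4 m2 m3 hS hL
  have i11 := integrable_mul_of_envelope h1 h4 m1 m1 hI hI
  have i22 := integrable_mul_of_envelope h1 h4 m2 m2 hS hS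
  have i33 := integrable_mul_of_envelope h1 h4 m3 m3 hL hL
  refine (((i11.const_mul (c₁ ^ 2)).add ((i22.const_mul (c₂ ^ 2)).add (i33.const_mul (c₃ ^ 2)))).add
    ((i12.const_mul (2 * c₁ * c₂)).add ((i13.const_mul (2 * c₁ * c₃)).add
    (i23.const_mul (2 * c₂ * c₃))))).congr (ae_of_all _ fun y => ?_)
  simp only [scoreComb, Pi.add_apply]
  ring

/-- The relative density increments under local changes of index, scale and location, with their
linear parts. -/
lemma exists_isLocalExpansion (σ u₁ u₂ u₃ : ℝ) :
    ∃ (G : ℝ → ℝ) (K ε₁ : ℝ), (∀ y, 1 ≤ G y) ∧ Integrable (fun y => G y ^ 4) μ ∧ 0 < ε₁ ∧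
      ∀ ε L : ℝ, 0 < ε → ε ≤ ε₁ → 1 ≤ L → IsLocalExpansion μ G (K * ε)
        (ratioIncr β (u₁ * (ε / L)) (scaleRatio β σ u₁ u₂ ε L - 1) (u₃ / σ * ε))
        (scoreComb β (u₁ * (ε / L)) (ε * (u₁ / β ^ 2 + u₂ / σ)) (u₃ / σ * ε)) := by
  have hβ := h.pos
  obtain ⟨G, ρ, hρ, hρβ, hρ1, hGm, h1, h4, hI, hS, hLoc, hexp⟩ := h.exists_envelope
  obtain ⟨C, ε₀, hC, hε₀, hscale⟩ := exists_abs_scaleRatio_sub_le hβ σ u₁ u₂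
  set κ := u₁ / β ^ 2 + u₂ / σ with hκ
  set K₁ := |u₁| + (C + |κ|) + |u₃ / σ| with hK₁
  have hK₁0 : 0 ≤ K₁ := by positivity
  set K := K₁ + C + 1 with hK
  have hK0 : 0 < K := by positivity
  refine ⟨G, K, min (min 1 (1 / K)) (min (ρ / (K₁ + 1)) ε₀), h1, h4, by positivity,
    fun ε L he0 he hLn => ?_⟩
  have he1 : ε ≤ 1 := he.trans ((min_le_left _ _).trans (min_le_left _ _))
  have heK : K * ε ≤ 1 := by
    have := he.trans ((min_le_left _ _).trans (min_le_right _ _))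
    rw [le_div_iff₀ hK0] at this
    linarith
  have heρ : K₁ * ε ≤ ρ := by
    have := he.trans ((min_le_right _ _).trans (min_le_left _ _))
    rw [le_div_iff₀ (by positivity)] at this
    linarith
  have heε : ε ≤ ε₀ := he.trans ((min_le_right _ _).trans (min_le_right _ _))
  have hL0 : 0 < L := by linarith
  set s := scaleRatio β σ u₁ u₂ ε L with hs
  have hs1 : |s - 1 - ε * κ| ≤ C * ε ^ 2 := hscale ε L he0.le heε hLn
  have hee : ε ^ 2 ≤ ε := by nlinarith
  have b1 : |u₁ * (ε / L)| ≤ |u₁| * ε := by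
    rw [abs_mul, abs_of_pos (by positivity : 0 < ε / L)]
    exact mul_le_mul_of_nonneg_left (div_le_self he0.le hLn) (abs_nonneg _)
  have b3 : |u₃ / σ * ε| = |u₃ / σ| * ε := by rw [abs_mul, abs_of_pos he0]
  have bκ : |ε * κ| = |κ| * ε := by rw [abs_mul, abs_of_pos he0, mul_comm]
  have b2 : |s - 1| ≤ (C + |κ|) * ε := by
    have e1 : |s - 1| ≤ |s - 1 - ε * κ| + |ε * κ| := by
      calc |s - 1| = |(s - 1 - ε * κ) + ε * κ| := by ring_nf
        _ ≤ _ := abs_add_le _ _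
    have e2 := mul_le_mul_of_nonneg_left hee hC
    linarith
  have n1 : 0 ≤ |u₁| * ε := by positivity
  have n2 : 0 ≤ (C + |κ|) * ε := by positivity
  have n3 : 0 ≤ |u₃ / σ| * ε := by positivity
  have eK₁ : K₁ * ε = |u₁| * ε + (C + |κ|) * ε + |u₃ / σ| * ε := by rw [hK₁]; ring
  have c1 : |u₁ * (ε / L)| ≤ K₁ * ε := by linarith
  have c2 : |s - 1| ≤ K₁ * ε := by linarith
  have c3 : |u₃ / σ * ε| ≤ K₁ * ε := by linarith
  have p1 : 0 < β + u₁ * (ε / L) := by linarith [neg_abs_le (u₁ * (ε / L))]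
  have p2 : 0 < 1 + (s - 1) := by linarith [neg_abs_le (s - 1)]
  refine ⟨h.measurable_ratioIncr p1 _ _, h.measurable_scoreComb _ _ _, by positivity, heK,
    fun y => ?_, fun y => ?_, h.integral_ratioIncr p1 p2 _, h.integral_scoreComb _ _ _⟩
  · have hG0 : 0 ≤ G y := zero_le_one.trans (h1 y)
    refine (abs_add_three _ _ _).trans ?_
    rw [abs_mul _ (scoreIndex β y), abs_mul _ (scoreScale β y), abs_mul _ (scoreLoc β y), b3, bκ]
    have a1 := mul_le_mul b1 (hI y) (abs_nonneg _) n1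
    have a2 := mul_le_mul_of_nonneg_left (hS y) (by positivity : 0 ≤ |κ| * ε)
    have a3 := mul_le_mul_of_nonneg_left (hLoc y) n3
    have : (|u₁| + |κ| + |u₃ / σ|) * (ε * G y) ≤ K * (ε * G y) := by
      refine mul_le_mul_of_nonneg_right ?_ (by positivity)
      rw [hK, hK₁]
      linarith
    linarith
  · have hG0 : 0 ≤ G y := zero_le_one.trans (h1 y)
    have a1 := hexp (K₁ * ε) _ _ _ heρ c1 c2 c3 y
    have e1 : ratioIncr β (u₁ * (ε / L)) (s - 1) (u₃ / σ * ε) y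
        - scoreComb β (u₁ * (ε / L)) (ε * κ) (u₃ / σ * ε) y =
        (ratioIncr β (u₁ * (ε / L)) (s - 1) (u₃ / σ * ε) y
        - scoreComb β (u₁ * (ε / L)) (s - 1) (u₃ / σ * ε) y)
        + (s - 1 - ε * κ) * scoreScale β y := by
      simp only [scoreComb]
      ring
    rw [e1]
    refine (abs_add_le _ _).trans ?_
    rw [abs_mul]
    have a2 := mul_le_mul hs1 (hS y) (abs_nonneg _) (by positivity)
    have a3 : (K₁ ^ 2 + C) * (ε ^ 2 * G y) ≤ K ^ 2 * (ε ^ 2 * G y) := by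
      refine mul_le_mul_of_nonneg_right ?_ (by positivity)
      have : K ^ 2 = K₁ ^ 2 + C + (C ^ 2 + 2 * (K₁ * C) + 2 * K₁ + C + 1) := by
        rw [hK]
        ring
      have : 0 ≤ C ^ 2 + 2 * (K₁ * C) + 2 * K₁ + C + 1 := by positivity
      linarith
    rw [mul_pow] at a1 ⊢
    linarith

/-- Quadratic expansion of the log-likelihood ratio of standard stable rows under local changes
of index, scale and location. -/
theorem tendstoInMeasure_logLik_ratio {Ω : Type*} [MeasurableSpace Ω] {P : Measure Ω}
    [IsProbabilityMeasure P] {Y : ℕ → ℕ → Ω → ℝ} (hY : IsRowIID Y μ P) (σ : ℝ)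
    {L τ : ℕ → ℝ} (hL : Tendsto L atTop atTop) (hτ : ∀ᶠ n in atTop, 0 < τ n) (u₁ u₂ u₃ : ℝ) :
    TendstoInMeasure P (fun n ω => ∑ j ∈ Finset.range n,
        (Real.log ((τ n)⁻¹ * shiftedDensity β (u₁ * ((√(n : ℝ))⁻¹ / L n))
          (scaleRatio β σ u₁ u₂ (√(n : ℝ))⁻¹ (L n) - 1) (u₃ / σ * (√(n : ℝ))⁻¹) (Y n j ω))
          - Real.log ((τ n)⁻¹ * stdDensity β (Y n j ω)))
      - (∑ j ∈ Finset.range n, scoreComb β (u₁ * ((√(n : ℝ))⁻¹ / L n))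
          ((√(n : ℝ))⁻¹ * (u₁ / β ^ 2 + u₂ / σ)) (u₃ / σ * (√(n : ℝ))⁻¹) (Y n j ω)
        - ((u₁ / β ^ 2 + u₂ / σ) ^ 2 * constH β + (u₃ / σ) ^ 2 * constM β) / 2))
      atTop (fun _ => 0) := by
  have := h.prob
  obtain ⟨G, K, ε₁, h1, h4, hε₁, hexp⟩ := h.exists_isLocalExpansion σ u₁ u₂ u₃
  set κ := u₁ / β ^ 2 + u₂ / σ with hκ
  have hε := tendsto_inv_sqrt
  refine hY.tendstoInMeasure_sum_log (G := G) h1 h4 (ε := fun n => K * (√(n : ℝ))⁻¹)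
    (r := fun n => ratioIncr β (u₁ * ((√(n : ℝ))⁻¹ / L n))
      (scaleRatio β σ u₁ u₂ (√(n : ℝ))⁻¹ (L n) - 1) (u₃ / σ * (√(n : ℝ))⁻¹))
    (v := fun n => scoreComb β (u₁ * ((√(n : ℝ))⁻¹ / L n)) ((√(n : ℝ))⁻¹ * κ)
      (u₃ / σ * (√(n : ℝ))⁻¹))
    (L := fun n y => Real.log ((τ n)⁻¹ * shiftedDensity β (u₁ * ((√(n : ℝ))⁻¹ / L n))
          (scaleRatio β σ u₁ u₂ (√(n : ℝ))⁻¹ (L n) - 1) (u₃ / σ * (√(n : ℝ))⁻¹) y)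
          - Real.log ((τ n)⁻¹ * stdDensity β y)) (B := K ^ 2) ?_ ?_ ?_ ?_ ?_
  · filter_upwards [hε.eventually (gt_mem_nhds hε₁), hL.eventually_ge_atTop 1,
      eventually_gt_atTop 0] with n a1 a2 a3
    have hn : (0 : ℝ) < n := by exact_mod_cast a3
    exact hexp _ _ (by positivity) a1.le a2
  · filter_upwards [eventually_gt_atTop 0] with n hn
    have hn' : (0 : ℝ) < n := by exact_mod_cast hn
    rw [mul_pow, inv_pow, Real.sq_sqrt hn'.le]
    field_simp
    exact le_rfl
  · simpa using hε.const_mul K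
  · have hc : Tendsto (fun n => u₁ / L n) atTop (𝓝 0) := hL.const_div_atTop u₁
    refine (h.tendsto_integral_scoreComb_sq hc κ (u₃ / σ)).congr' ?_
    filter_upwards [eventually_gt_atTop 0] with n hn
    have hn' : (0 : ℝ) < n := by exact_mod_cast hn
    rw [← integral_const_mul]
    congr 1
    funext y
    have e : scoreComb β (u₁ * ((√(n : ℝ))⁻¹ / L n)) ((√(n : ℝ))⁻¹ * κ) (u₃ / σ * (√(n : ℝ))⁻¹) y
        = (√(n : ℝ))⁻¹ * scoreComb β (u₁ / L n) κ (u₃ / σ) y := by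
      simp only [scoreComb]
      ring
    rw [e, mul_pow, inv_pow, Real.sq_sqrt hn'.le]
    field_simp
  · filter_upwards [hτ] with n hn y hy
    exact log_shiftedDensity_sub hn (h.density_pos y) hy

end IsStdStable

lemma rate_mulVec (δ : ℝ≥0) (n : ℕ) (β : ℝ) (w : Fin 3 → ℝ) : (rate δ n β).mulVec w =
    ![w 0 * ((√(n : ℝ))⁻¹ / Real.log (1 / δ)), w 1 * (√(n : ℝ))⁻¹,
      w 2 * ((√(n : ℝ))⁻¹ / (δ : ℝ) ^ (1 - 1 / β))] := by
  funext k
  rw [rate, Matrix.mulVec_diagonal]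
  fin_cases k <;> simp [div_eq_mul_inv] <;> ring

lemma tendsto_log_one_div {h : ℕ → ℝ≥0} (h_pos : ∀ n, 0 < n → 0 < h n)
    (h_lim : Tendsto h atTop (𝓝 0)) :
    Tendsto (fun n => Real.log (1 / (h n : ℝ))) atTop atTop := by
  have h1 : Tendsto (fun n => (h n : ℝ)) atTop (𝓝[>] 0) := by
    refine tendsto_nhdsWithin_iff.2 ⟨NNReal.tendsto_coe.2 h_lim, ?_⟩
    filter_upwards [eventually_gt_atTop 0] with n hn
    exact NNReal.coe_pos.2 (h_pos n hn)
  have h2 := tendsto_neg_atBot_atTop.comp (Real.tendsto_log_nhdsGT_zero.comp h1)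
  refine h2.congr fun n => ?_
  simp

/-- The local parameters converge to the centre. -/
lemma tendsto_rate_mulVec {h : ℕ → ℝ≥0} (h_pos : ∀ n, 0 < n → 0 < h n)
    (h_lim : Tendsto h atTop (𝓝 0))
    (h_liminf : ∃ c : ℝ, 0 < c ∧ ∀ᶠ n : ℕ in atTop, c ≤ (n : ℝ) * (h n : ℝ)) {β : ℝ} (hβ : 0 < β)
    (hβ2 : β < 2) (w : Fin 3 → ℝ) :
    Tendsto (fun n => (rate (h n) n β).mulVec w) atTop (𝓝 0) := by
  have hε := tendsto_inv_sqrt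
  have hL := tendsto_log_one_div h_pos h_lim
  have t0 : Tendsto (fun n : ℕ => (√(n : ℝ))⁻¹ / Real.log (1 / (h n : ℝ))) atTop (𝓝 0) :=
    hε.div_atTop hL
  have t2 : Tendsto (fun n : ℕ => (√(n : ℝ))⁻¹ / (h n : ℝ) ^ (1 - 1 / β)) atTop (𝓝 0) := by
    obtain ⟨c, hc, hcn⟩ := h_liminf
    have hexp : 0 < 1 / β - 1 / 2 := sub_pos.2 (one_div_lt_one_div_of_lt hβ hβ2)
    have hlim : Tendsto (fun n => (√c)⁻¹ * (h n : ℝ) ^ (1 / β - 1 / 2)) atTop (𝓝 0) := by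
      have h1 : Tendsto (fun n => (h n : ℝ)) atTop (𝓝 0) :=
        NNReal.tendsto_coe.2 h_lim
      have h2 := (h1.rpow_const (p := 1 / β - 1 / 2) (Or.inr hexp.le)).const_mul (√c)⁻¹
      rwa [Real.zero_rpow hexp.ne', mul_zero] at h2
    refine squeeze_zero' (Eventually.of_forall fun n => by positivity) ?_ hlim
    filter_upwards [hcn, eventually_gt_atTop 0] with n hn hn0
    have hδ : (0 : ℝ) < h n := NNReal.coe_pos.2 (h_pos n hn0)
    have hn' : (0 : ℝ) < n := by exact_mod_cast hn0
    have hs : √c ≤ √(n : ℝ) * (h n : ℝ) ^ (1 / 2 : ℝ) := by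
      rw [← Real.sqrt_eq_rpow, ← Real.sqrt_mul hn'.le]
      exact Real.sqrt_le_sqrt hn
    have hsc : 0 < √c := Real.sqrt_pos.2 hc
    have hsn : 0 < √(n : ℝ) := Real.sqrt_pos.2 hn'
    have e : (h n : ℝ) ^ (1 / β - 1 / 2) * (h n : ℝ) ^ (1 - 1 / β) = (h n : ℝ) ^ (1 / 2 : ℝ) := by
      rw [← Real.rpow_add hδ]
      congr 1
      ring
    rw [div_le_iff₀ (Real.rpow_pos_of_pos hδ _), mul_assoc, e, inv_mul_eq_div,
      inv_le_iff_one_le_mul₀ hsn, div_mul_eq_mul_div, one_le_div hsc]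
    linarith
  rw [tendsto_pi_nhds]
  intro k
  simp_rw [rate_mulVec]
  fin_cases k
  · simpa using t0.const_mul (w 0)
  · simpa using hε.const_mul (w 1)
  · simpa using t2.const_mul (w 2)

lemma score_eq {θ : Fin 3 → ℝ} (hβ : 0 < θ 0) (hσ : 0 < θ 1)
    (hpos : ∀ y, 0 < stdDensity (θ 0) y) (x : ℝ≥0 → ℝ) {δ : ℝ≥0} (hδ : 0 < δ)
    (hL : Real.log (1 / (δ : ℝ)) ≠ 0) (n : ℕ) :
    score x δ n θ = ![
      (√(n : ℝ))⁻¹ / Real.log (1 / δ) * ∑ j ∈ Finset.range n,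
          scoreIndex (θ 0) (normIncrement θ x δ j)
        + (√(n : ℝ))⁻¹ / θ 0 ^ 2 * ∑ j ∈ Finset.range n,
          scoreScale (θ 0) (normIncrement θ x δ j),
      (√(n : ℝ))⁻¹ / θ 1 * ∑ j ∈ Finset.range n, scoreScale (θ 0) (normIncrement θ x δ j),
      (√(n : ℝ))⁻¹ / θ 1 * ∑ j ∈ Finset.range n, scoreLoc (θ 0) (normIncrement θ x δ j)] := by
  have hp : (δ : ℝ) ^ (1 - 1 / θ 0) ≠ 0 := (Real.rpow_pos_of_pos (NNReal.coe_pos.2 hδ) _).ne'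
  rw [score, rate_mulVec, gradLogLik_eq hβ hσ hpos x hδ]
  simp only [Matrix.cons_val_zero, Matrix.cons_val_one, Matrix.cons_val, Finset.sum_add_distrib,
    ← Finset.mul_sum]
  funext k
  fin_cases k
  · simp only [Fin.zero_eta, Matrix.cons_val_zero]
    field_simp
  · simp only [Fin.mk_one, Matrix.cons_val_one, Matrix.cons_val_zero]
    field_simp
  · simp only [Fin.reduceFinMk, Matrix.cons_val]
    field_simp

lemma score_dotProduct {θ : Fin 3 → ℝ} (hβ : 0 < θ 0) (hσ : 0 < θ 1)
    (hpos : ∀ y, 0 < stdDensity (θ 0) y) (x : ℝ≥0 → ℝ) {δ : ℝ≥0} (hδ : 0 < δ)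
    (hL : Real.log (1 / (δ : ℝ)) ≠ 0) (n : ℕ) (u : Fin 3 → ℝ) :
    score x δ n θ ⬝ᵥ u = ∑ j ∈ Finset.range n,
      scoreComb (θ 0) (u 0 * ((√(n : ℝ))⁻¹ / Real.log (1 / δ)))
        ((√(n : ℝ))⁻¹ * (u 0 / θ 0 ^ 2 + u 1 / θ 1)) (u 2 / θ 1 * (√(n : ℝ))⁻¹)
        (normIncrement θ x δ j) := by
  rw [score_eq hβ hσ hpos x hδ hL]
  simp only [scoreComb, dotProduct, Fin.sum_univ_three, Finset.sum_add_distrib, ← Finset.mul_sum,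
    Matrix.cons_val_zero, Matrix.cons_val_one, Matrix.cons_val]
  ring

lemma dotProduct_fisherInfo (θ u : Fin 3 → ℝ) : u ⬝ᵥ (fisherInfo θ).mulVec u =
    (u 0 / θ 0 ^ 2 + u 1 / θ 1) ^ 2 * constH (θ 0) + (u 2 / θ 1) ^ 2 * constM (θ 0) := by
  simp only [fisherInfo, dotProduct, Matrix.mulVec, Fin.sum_univ_three, Matrix.of_apply,
    Matrix.cons_val_zero, Matrix.cons_val_one, Matrix.cons_val]
  ring

lemma det_fisherInfo (θ : Fin 3 → ℝ) : (fisherInfo θ).det = 0 := by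
  rw [fisherInfo, Matrix.det_fin_three]
  simp only [Matrix.of_apply, Matrix.cons_val_zero, Matrix.cons_val_one, Matrix.cons_val]
  ring

lemma posSemidef_fisherInfo {θ : Fin 3 → ℝ} (hH : 0 ≤ constH (θ 0)) (hM : 0 ≤ constM (θ 0)) :
    (fisherInfo θ).PosSemidef := by
  refine Matrix.PosSemidef.of_dotProduct_mulVec_nonneg ?_ fun x => ?_
  · ext i j
    fin_cases i <;> fin_cases j <;> simp [fisherInfo]
  · rw [star_trivial, dotProduct_fisherInfo]
    positivity

/-- The log-likelihood ratio in terms of the normalised increments. -/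
lemma logLik_sub_logLik {θ u : Fin 3 → ℝ} (hβ : 0 < θ 0) (hσ : 0 < θ 1) (x : ℝ≥0 → ℝ) {δ : ℝ≥0}
    (hδ : 0 < δ) (n : ℕ)
    (hβ' : 0 < (θ + (rate δ n (θ 0)).mulVec u) 0) (hσ' : 0 < (θ + (rate δ n (θ 0)).mulVec u) 1) :
    logLik x δ n (θ + (rate δ n (θ 0)).mulVec u) - logLik x δ n θ = ∑ j ∈ Finset.range n,
      (Real.log ((θ 1 * (δ : ℝ) ^ (1 / θ 0))⁻¹ * shiftedDensity (θ 0)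
        (u 0 * ((√(n : ℝ))⁻¹ / Real.log (1 / δ)))
        (scaleRatio (θ 0) (θ 1) (u 0) (u 1) (√(n : ℝ))⁻¹ (Real.log (1 / δ)) - 1)
        (u 2 / θ 1 * (√(n : ℝ))⁻¹) (normIncrement θ x δ j))
      - Real.log ((θ 1 * (δ : ℝ) ^ (1 / θ 0))⁻¹ * stdDensity (θ 0) (normIncrement θ x δ j))) := by
  have hδ' : (0 : ℝ) < δ := NNReal.coe_pos.2 hδ
  set θ' := θ + (rate δ n (θ 0)).mulVec u with hθ'
  have e0 : θ' 0 = θ 0 + u 0 * ((√(n : ℝ))⁻¹ / Real.log (1 / δ)) := by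
    rw [hθ', rate_mulVec]
    simp
  have e1 : θ' 1 = θ 1 + u 1 * (√(n : ℝ))⁻¹ := by
    rw [hθ', rate_mulVec]
    simp
  have e2 : θ' 2 = θ 2 + u 2 * ((√(n : ℝ))⁻¹ / (δ : ℝ) ^ (1 - 1 / θ 0)) := by
    rw [hθ', rate_mulVec]
    simp
  have hp : 0 < (δ : ℝ) ^ (1 / θ 0) := Real.rpow_pos_of_pos hδ' _
  have hτ0 : 0 < θ 1 * (δ : ℝ) ^ (1 / θ 0) := mul_pos hσ hp
  have hscale : θ' 1 * (δ : ℝ) ^ (1 / θ' 0) / (θ 1 * (δ : ℝ) ^ (1 / θ 0)) =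
      scaleRatio (θ 0) (θ 1) (u 0) (u 1) (√(n : ℝ))⁻¹ (Real.log (1 / δ)) := by
    rw [scaleRatio, ← e0, mul_div_mul_comm, ← Real.rpow_sub hδ', Real.rpow_def_of_pos hδ', e1]
    congr 1
    · field_simp
    · rw [one_div (δ : ℝ), Real.log_inv]
      congr 1
      ring
  have hloc : (θ' 2 - θ 2) * δ / (θ 1 * (δ : ℝ) ^ (1 / θ 0)) = u 2 / θ 1 * (√(n : ℝ))⁻¹ := by
    rw [e2, Real.rpow_sub hδ', Real.rpow_one]
    field_simp
    ring
  rw [logLik, logLik, ← Finset.sum_sub_distrib]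
  refine Finset.sum_congr rfl fun j _ => ?_
  rw [density_eq_shiftedDensity hσ hβ' hσ' x hδ j, hscale, hloc, density_eq hβ hτ0]
  congr 5
  rw [e0, add_sub_cancel_left]

namespace IsSymStableLevy

variable {Ω : Type*} [MeasurableSpace Ω] {P : Measure Ω} {X : ℝ≥0 → Ω → ℝ} {θ : Fin 3 → ℝ}
  {μ : Measure ℝ}

lemma measurable_score (hX : IsSymStableLevy X P θ) (hμ : IsStdStable (θ 0) μ) (hσ : 0 < θ 1)
    {h : ℕ → ℝ≥0} (h_pos : ∀ n, 0 < n → 0 < h n) (n : ℕ) :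
    Measurable fun ω => score (fun t => X t ω) (h n) n θ := by
  have hm := fun j => hX.measurable_normIncrement (h n) j
  have h1 := hμ.measurable_scoreIndex
  have h2 := hμ.measurable_scoreScale
  have h3 := hμ.measurable_scoreLoc
  rcases Nat.eq_zero_or_pos n with rfl | hn
  · have : ∀ ω, gradLogLik (fun t => X t ω) (h 0) 0 θ = 0 := fun ω => by
      funext k
      simp [gradLogLik, logLik]
    simp [score, this]
  · simp only [score]
    simp_rw [gradLogLik_eq hμ.pos hσ hμ.density_pos _ (h_pos n hn), rate_mulVec]
    refine measurable_pi_lambda _ fun k => ?_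
    fin_cases k <;>
    · simp only [Fin.zero_eta, Fin.mk_one, Fin.reduceFinMk, Matrix.cons_val_zero,
        Matrix.cons_val_one, Matrix.cons_val, Fin.isValue]
      fun_prop

/-- Asymptotic normality of the normalised score. -/
theorem tendstoInDistribution_score [IsProbabilityMeasure P] (hX : IsSymStableLevy X P θ)
    (hμ : IsStdStable (θ 0) μ) (hσ : 0 < θ 1) {h : ℕ → ℝ≥0} (h_pos : ∀ n, 0 < n → 0 < h n)
    (h_lim : Tendsto h atTop (𝓝 0))
    (hY : IsRowIID (fun n j ω => normIncrement θ (fun t => X t ω) (h n) j) μ P) :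
    TendstoInDistribution
      (fun (n : ℕ) (ω : Ω) => WithLp.toLp 2 (score (fun t => X t ω) (h n) n θ))
      atTop (id : EuclideanSpace ℝ (Fin 3) → EuclideanSpace ℝ (Fin 3)) (fun _ => P)
      (multivariateGaussian 0 (fisherInfo θ)) := by
  have := hμ.prob
  have hL := tendsto_log_one_div h_pos h_lim
  set V : ℝ → EuclideanSpace ℝ (Fin 3) := fun y => WithLp.toLp 2
    ![scoreScale (θ 0) y / θ 0 ^ 2, scoreScale (θ 0) y / θ 1, scoreLoc (θ 0) y / θ 1] with hV
  have hVm : Measurable V := by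
    have h2 := hμ.measurable_scoreScale
    have h3 := hμ.measurable_scoreLoc
    refine (WithLp.measurable_toLp 2 _).comp (measurable_pi_lambda _ fun k => ?_)
    fin_cases k <;>
    · simp only [Fin.zero_eta, Fin.mk_one, Fin.reduceFinMk, Matrix.cons_val_zero,
        Matrix.cons_val_one, Matrix.cons_val, Fin.isValue]
      fun_prop
  have hinner : ∀ (t : EuclideanSpace ℝ (Fin 3)) y, inner ℝ (V y) t =
      scoreComb (θ 0) 0 (t 0 / θ 0 ^ 2 + t 1 / θ 1) (t 2 / θ 1) y := by
    intro t y
    simp [hV, PiLp.inner_apply, Fin.sum_univ_three, scoreComb]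
    ring
  have hclt := hY.tendstoInDistribution hVm
    (posSemidef_fisherInfo hμ.constH_nonneg hμ.constM_nonneg) (S := fisherInfo θ)
    (fun t => by simp_rw [hinner]; exact hμ.integral_scoreComb _ _ _)
    (fun t => by simp_rw [hinner]; exact hμ.integrable_scoreComb_sq _ _ _)
    (fun t => by simp_rw [hinner]; rw [hμ.integral_scoreComb_sq, dotProduct_fisherInfo])
  refine tendstoInDistribution_of_tendstoInMeasure_sub _ _ hclt ?_ fun n =>
    ((WithLp.measurable_toLp 2 _).comp (hX.measurable_score hμ hσ h_pos n)).aemeasurable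
  have hI := hμ.integrable_scoreComb_sq 1 0 0
  simp only [scoreComb, one_mul, zero_mul, add_zero] at hI
  have hI0 := hμ.integral_scoreComb 1 0 0
  simp only [scoreComb, one_mul, zero_mul, add_zero] at hI0
  have hrem : TendstoInMeasure P (fun n ω => ∑ j ∈ Finset.range n,
      (√(n : ℝ))⁻¹ / Real.log (1 / (h n : ℝ)) *
        scoreIndex (θ 0) (normIncrement θ (fun t => X t ω) (h n) j)) atTop (fun _ => 0) := by
    refine hY.tendstoInMeasure_sum_of_integral_sq (f := fun n y =>
      (√(n : ℝ))⁻¹ / Real.log (1 / (h n : ℝ)) * scoreIndex (θ 0) y)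
      (Eventually.of_forall fun n => ⟨hμ.measurable_scoreIndex.const_mul _, ?_, ?_⟩) ?_
    · simp_rw [mul_pow]
      exact hI.const_mul _
    · rw [integral_const_mul, hI0, mul_zero]
    · have h1 := ((tendsto_inv_atTop_zero.comp hL).pow 2).mul_const
        (∫ y, scoreIndex (θ 0) y ^ 2 ∂μ)
      rw [zero_pow two_ne_zero, zero_mul] at h1
      refine h1.congr' ?_
      filter_upwards [eventually_gt_atTop 0] with n hn
      have hn' : (0 : ℝ) < n := by exact_mod_cast hn
      simp_rw [mul_pow]
      rw [integral_const_mul, div_pow, inv_pow, Real.sq_sqrt hn'.le]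
      simp only [Function.comp_apply, inv_pow]
      field_simp
  rw [tendstoInMeasure_iff_norm]
  intro η hη
  refine ((tendstoInMeasure_zero_iff.1 hrem) η hη).congr' ?_
  filter_upwards [eventually_gt_atTop 0, hL.eventually_gt_atTop 0] with n hn hLn
  congr 1
  ext ω
  have e : WithLp.toLp 2 (score (fun t => X t ω) (h n) n θ) - (√(n : ℝ))⁻¹ •
      ∑ j ∈ Finset.range n, V (normIncrement θ (fun t => X t ω) (h n) j) =
      EuclideanSpace.single (0 : Fin 3) (∑ j ∈ Finset.range n,
      (√(n : ℝ))⁻¹ / Real.log (1 / (h n : ℝ)) *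
        scoreIndex (θ 0) (normIncrement θ (fun t => X t ω) (h n) j)) := by
    rw [score_eq hμ.pos hσ hμ.density_pos _ (h_pos n hn) hLn.ne']
    ext k
    fin_cases k
    · simp [hV, ← Finset.mul_sum, ← Finset.sum_div]
      ring
    · simp [hV, ← Finset.mul_sum, ← Finset.sum_div]
      ring
    · simp [hV, ← Finset.mul_sum, ← Finset.sum_div]
      ring
  simp only [Set.mem_ofPred_eq, Pi.sub_apply, Pi.zero_apply, sub_zero]
  rw [e, PiLp.norm_single, Real.norm_eq_abs]

end IsSymStableLevy

end SymStable

end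

theorem mainTheorem4
    (Θ : Set (Fin 3 → ℝ)) (hΘ_open : IsOpen Θ) (hΘ_conv : Convex ℝ Θ)
    (hΘ_compact : IsCompact (closure Θ))
    (hΘ_sub : closure Θ ⊆ {θ | 0 < θ 0 ∧ θ 0 < 2 ∧ 0 < θ 1})
    (h : ℕ → ℝ≥0) (h_pos : ∀ n, 0 < n → 0 < h n) (h_lim : Tendsto h atTop (𝓝 0))
    (h_liminf : ∃ c : ℝ, 0 < c ∧ ∀ᶠ n : ℕ in atTop, c ≤ (n : ℝ) * (h n : ℝ))
    (θ : Fin 3 → ℝ) (hθ : θ ∈ Θ)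
    {Ω : Type*} [MeasurableSpace Ω] (P : Measure Ω) [IsProbabilityMeasure P]
    (X : ℝ≥0 → Ω → ℝ) (hX : SymStable.IsSymStableLevy X P θ) :
    -- `H_β` and `M_β` are finite
    Integrable (SymStable.integrandH (θ 0)) ∧
    Integrable (SymStable.integrandM (θ 0)) ∧
    -- the local parameters eventually lie in the parameter space
    (∀ u : Fin 3 → ℝ, ∀ᶠ n : ℕ in atTop,
      θ + (SymStable.rate (h n) n (θ 0)).mulVec u ∈ Θ) ∧
    -- the stochastic expansion of the log-likelihood ratio
    (∀ u : Fin 3 → ℝ, TendstoInMeasure P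
      (fun (n : ℕ) (ω : Ω) =>
        (SymStable.logLik (fun t => X t ω) (h n) n
            (θ + (SymStable.rate (h n) n (θ 0)).mulVec u)
          - SymStable.logLik (fun t => X t ω) (h n) n θ)
        - (SymStable.score (fun t => X t ω) (h n) n θ ⬝ᵥ u
          - (1 / 2) * (u ⬝ᵥ (SymStable.fisherInfo θ).mulVec u)))
      atTop (fun _ => 0)) ∧
    -- asymptotic normality of the normalized score
    (SymStable.fisherInfo θ).PosSemidef ∧
    TendstoInDistribution
      (fun (n : ℕ) (ω : Ω) => WithLp.toLp 2 (SymStable.score (fun t => X t ω) (h n) n θ))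
      atTop (id : EuclideanSpace ℝ (Fin 3) → EuclideanSpace ℝ (Fin 3)) (fun _ => P)
      (multivariateGaussian 0 (SymStable.fisherInfo θ)) ∧
    -- singularity of the Fisher information matrix
    (SymStable.fisherInfo θ).det = 0 := by
  obtain ⟨hβ, hβ2, hσ⟩ := hΘ_sub (subset_closure hθ)
  obtain ⟨μ, hμ, hY⟩ := hX.exists_isRowIID hβ hβ2 hσ h_pos
  have hmem : ∀ u : Fin 3 → ℝ, ∀ᶠ n : ℕ in atTop,
      θ + (SymStable.rate (h n) n (θ 0)).mulVec u ∈ Θ := by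
    intro u
    have h1 := (SymStable.tendsto_rate_mulVec h_pos h_lim h_liminf hβ hβ2 u).const_add θ
    rw [add_zero] at h1
    exact h1.eventually (hΘ_open.mem_nhds hθ)
  have hL := SymStable.tendsto_log_one_div h_pos h_lim
  refine ⟨hμ.integrable_integrandH, hμ.integrable_integrandM, hmem, fun u => ?_,
    SymStable.posSemidef_fisherInfo hμ.constH_nonneg hμ.constM_nonneg,
    hX.tendstoInDistribution_score hμ hσ h_pos h_lim hY, SymStable.det_fisherInfo θ⟩
  have hτ : ∀ᶠ n in atTop, 0 < θ 1 * (h n : ℝ) ^ (1 / θ 0) := by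
    filter_upwards [eventually_gt_atTop 0] with n hn
    exact mul_pos hσ (Real.rpow_pos_of_pos (NNReal.coe_pos.2 (h_pos n hn)) _)
  refine (hμ.tendstoInMeasure_logLik_ratio hY (θ 1) hL hτ (u 0) (u 1) (u 2)).congr' ?_ .rfl
  filter_upwards [eventually_gt_atTop 0, hmem u, hL.eventually_gt_atTop 0] with n hn hnΘ hLn
  refine ae_of_all _ fun ω => ?_
  obtain ⟨hβ', -, hσ'⟩ := hΘ_sub (subset_closure hnΘ)
  simp only
  rw [SymStable.logLik_sub_logLik hβ hσ _ (h_pos n hn) n hβ' hσ',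
    SymStable.score_dotProduct hβ hσ hμ.density_pos _ (h_pos n hn) hLn.ne',
    SymStable.dotProduct_fisherInfo]
  ring
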